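/- **Setting.** Let $\Omega=\mathbb R^3/(2\pi\mathbb Z)^3$, and let $\mathcal V$ be the space of $\mathbb R^3$-valued $2\pi$-periodic trigonometric polynomials $v$ with $\operatorname{div}v=0$ and $\int_\Omega v\,dx=0$. Let $H$ and $V$ be the closures of $\mathcal V$ in $L^2(\Omega)^3$ and $H^1(\Omega)^3$, let $|\cdot|$ be the norm of $L^2(\Omega)^3$, $P$ the orthogonal projection of $L^2(\Omega)^3$ onto $H$, $A=-P\Delta$ the Stokes operator and $B(v,w)=P[(v\cdot\nabla)w]$. For $j\in\mathbb N=\{1,2,\dots\}$ let $R_j$ be the orthogonal projection onto the eigenspace of $A$ for $j$ ($R_j=0$ if $j$ is not an eigenvalue). For $\alpha\ge0$ let $A^\alpha u=\sum_{j\ge1} j^\alpha R_ju$, with domain $\mathcal D(A^\alpha)\subset H$ normed by $|A^\alpha u|$, and let $E^\infty=C^\infty(\mathbb R^3,\mathbb R^3)\cap V$, with the topology generated by the norms $|A^\alpha\cdot|$, $\alpha\ge0$. For a sequence $\xi=(\xi_j)_{j\ge1}$ with $\xi_j\in R_jH$ define recursively the $\mathcal V$-valued polynomials in $t$ $$q_j(t,\xi)=\xi_j-\int_0^tR_j\beta_j(\tau)\,d\tau+\sum_{n\ge0}(-1)^{n+1}(A-j)^{-n-1}\frac{d^n}{dt^n}(I-R_j)\beta_j(t),\qquad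 \beta_j=\sum_{\substack{k+l=j\\k,l\ge1}}B(q_k,q_l),$$ and put $$\mathcal P_j(\xi)=q_j(0,\xi),\qquad \mathcal B_j(\xi)=\sum_{\substack{k+l=j\\k,l\ge1}}R_jB(\mathcal P_k(\xi),\mathcal P_l(\xi)).$$ Let $\mathcal P_j^{[d]}$ and $\mathcal B_j^{[d]}$ be the homogeneous parts of degree $d$ of the polynomials $\mathcal P_j$ and $\mathcal B_j$. An element $\xi\in H$ is identified with $(R_j\xi)_{j\ge1}$, and $$\mathcal P^{[d]}(\xi)=\sum_{j=d}^\infty\mathcal P_j^{[d]}(\xi)\quad(d\ge1),\qquad \mathcal B^{[d]}(\xi)=\sum_{j=1}^\infty\mathcal B_j^{[d]}(\xi)\quad(d\ge2).$$ A continuous homogeneous polynomial of degree $d$ is the restriction to the diagonal of a continuous $d$-linear map. **Theorem.** Let $\alpha\ge1/2$. For $d\ge1$ (respectively $d\ge2$) the series $\mathcal P^{[d]}(\xi)$ (respectively $\mathcal B^{[d]}(\xi)$) converges in $\mathcal D(A^\alpha)$ for all $\xi\in\mathcal D(A^{\alpha+3d/2})$ and defines a continuous homogeneous polynomial of degree $d$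 from $\mathcal D(A^{\alpha+3d/2})$ to $\mathcal D(A^\alpha)$. There are positive constants $M(\alpha,d)$ and $C(\alpha,d)$ such that for all $\xi\in\mathcal D(A^{\alpha+3d/2})$ $$|A^\alpha\mathcal P^{[d]}(\xi)|\le\sum_{j=d}^\infty|A^\alpha\mathcal P_j^{[d]}(\xi)|\le M(\alpha,d)\,|A^{\alpha+3d/2}\xi|^d\qquad(d\ge1),$$ $$|A^\alpha\mathcal B^{[d]}(\xi)|\le\sum_{j=1}^\infty|A^\alpha\mathcal B_j^{[d]}(\xi)|\le C(\alpha,d)\,|A^{\alpha+3d/2}\xi|^d\qquad(d\ge2).$$ Consequently, for $\xi\in E^\infty$ the series $\mathcal P^{[d]}(\xi)=\sum_{j=d}^\infty\mathcal P_j^{[d]}(\xi)$ ($d\ge1$) and $\mathcal B^{[d]}(\xi)=\sum_{j=d}^\infty\mathcal B_j^{[d]}(\xi)$ ($d\ge2$) converge in $E^\infty$, and they are continuous homogeneous polynomials of degree $d$ from $E^\infty$ to $E^\infty$. -/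

import Mathlib

open MeasureTheory Laplacian
open scoped ContDiff RealInnerProductSpace

noncomputable section

namespace NSE

/-- `ℝ³` with its Euclidean structure. -/
abbrev E3 := EuclideanSpace ℝ (Fin 3)

/-- The periodicity cell `[0, 2π)³`, a fundamental domain of the periodic domain `Ω`. -/
def cell : Set E3 := {x | ∀ i, x i ∈ Set.Ico 0 (2 * Real.pi)}

/-- `L²(Ω)³`. -/
abbrev L2 := Lp E3 2 (volume.restrict cell)

/-- A vector of `ℤ³` as a vector of `ℝ³`. -/
def wave (k : Fin 3 → ℤ) : E3 := WithLp.toLp 2 fun i => (k i : ℝ)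

/-- `x ↦ cos (k · x + θ) a`; the phases `θ = 0` and `θ = -π/2` give cosine and sine. -/
def mode (k : Fin 3 → ℤ) (θ : ℝ) (a : E3) : E3 → E3 := fun x => Real.cos (⟪wave k, x⟫ + θ) • a

/-- The `ℝ³`-valued `2π`-periodic trigonometric polynomials. -/
def TrigPoly : Submodule ℝ (E3 → E3) :=
  Submodule.span ℝ {u | ∃ k θ a, u = mode k θ a}

instance : AddCommGroup TrigPoly := Submodule.addCommGroup TrigPoly

instance : Module ℝ TrigPoly := Submodule.module TrigPoly

/-- The divergence of a vector field. -/
def dvg (u : E3 → E3) : E3 → ℝ := fun x => ∑ i, fderiv ℝ u x (EuclideanSpace.single i 1) i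

/-- `(u · ∇) v`. -/
def adv (u v : E3 → E3) : E3 → E3 := fun x => fderiv ℝ v x (u x)

/-- `2π`-periodicity in all coordinates. -/
def IsPeriodic (u : E3 → E3) : Prop :=
  ∀ x i, u (x + EuclideanSpace.single i (2 * Real.pi)) = u x

theorem mode_mem (k : Fin 3 → ℤ) (θ : ℝ) (a : E3) : mode k θ a ∈ TrigPoly :=
  Submodule.subset_span ⟨k, θ, a, rfl⟩

theorem trigPoly_ind {p : (E3 → E3) → Prop} (hm : ∀ k θ a, p (mode k θ a))
    (hadd : ∀ u ∈ TrigPoly, ∀ v ∈ TrigPoly, p u → p v → p (u + v))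
    (hsmul : ∀ (c : ℝ), ∀ u ∈ TrigPoly, p u → p (c • u)) {u : E3 → E3} (hu : u ∈ TrigPoly) :
    p u := by
  induction hu using Submodule.span_induction with
  | mem x h => obtain ⟨k, θ, a, rfl⟩ := h; exact hm k θ a
  | zero => simpa using hsmul 0 _ (mode_mem 0 0 0) (hm 0 0 0)
  | add x y hx hy h1 h2 => exact hadd x hx y hy h1 h2
  | smul c x hx h => exact hsmul c x hx h

theorem mode_hasFDerivAt (k : Fin 3 → ℤ) (θ : ℝ) (a x : E3) :
    HasFDerivAt (mode k θ a)
      ((-Real.sin (⟪wave k, x⟫ + θ) • innerSL ℝ (wave k)).smulRight a) x := by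
  have h1 : HasFDerivAt (fun x : E3 => ⟪wave k, x⟫ + θ) (innerSL ℝ (wave k)) x :=
    ((innerSL ℝ (wave k)).hasFDerivAt).add_const θ
  exact (h1.cos).smul_const a

theorem trigPoly_contDiff {u : E3 → E3} (hu : u ∈ TrigPoly) : ContDiff ℝ ∞ u := by
  refine trigPoly_ind (p := fun u => ContDiff ℝ ∞ u) ?_ ?_ ?_ hu
  · intro k θ a
    have h : ContDiff ℝ ∞ fun x : E3 => ⟪wave k, x⟫ + θ :=
      ((innerSL ℝ (wave k)).contDiff).add contDiff_const
    exact (h.cos).smul contDiff_const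
  · intro u _ v _ h1 h2
    exact h1.add h2
  · intro c u _ h
    exact contDiff_const.smul h

theorem trigPoly_differentiable {u : E3 → E3} (hu : u ∈ TrigPoly) : Differentiable ℝ u :=
  (trigPoly_contDiff hu).differentiable (by simp)

theorem trigPoly_continuous {u : E3 → E3} (hu : u ∈ TrigPoly) : Continuous u :=
  (trigPoly_contDiff hu).continuous

theorem trigPoly_fderiv_continuous {u : E3 → E3} (hu : u ∈ TrigPoly) :
    Continuous (fderiv ℝ u) :=
  (trigPoly_contDiff hu).continuous_fderiv (by simp)

theorem inner_wave_single (k : Fin 3 → ℤ) (i : Fin 3) (r : ℝ) :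
    ⟪wave k, EuclideanSpace.single i r⟫ = k i * r := by
  simp [wave, EuclideanSpace.inner_single_right, mul_comm]

theorem trigPoly_periodic {u : E3 → E3} (hu : u ∈ TrigPoly) : IsPeriodic u := by
  refine trigPoly_ind (p := IsPeriodic) ?_ ?_ ?_ hu
  · intro k θ a x i
    have : ⟪wave k, x + EuclideanSpace.single i (2 * Real.pi)⟫ + θ
        = (⟪wave k, x⟫ + θ) + k i * (2 * Real.pi) := by
      rw [inner_add_right, inner_wave_single]; ring
    simp only [mode]
    rw [this, Real.cos_add_int_mul_two_pi]
  · intro u _ v _ h1 h2 x i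
    simp [h1 x i, h2 x i]
  · intro c u _ h x i
    simp [h x i]

theorem cell_eq : cell = (WithLp.ofLp : E3 → Fin 3 → ℝ) ⁻¹'
    (Set.univ.pi fun _ => Set.Ico 0 (2 * Real.pi)) := by
  ext x; simp [cell]

theorem cell_measurable : MeasurableSet cell := by
  rw [cell_eq]
  exact (PiLp.volume_preserving_ofLp (Fin 3)).measurable
    (MeasurableSet.univ_pi fun _ => measurableSet_Ico)

theorem cell_bounded : cell ⊆ Metric.closedBall 0 (8 * Real.pi) := by
  intro x hx
  rw [mem_closedBall_zero_iff, EuclideanSpace.norm_eq, Fin.sum_univ_three]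
  have h := fun i => hx i
  have hp := Real.pi_pos
  apply Real.sqrt_le_iff.2 ⟨by positivity, ?_⟩
  have h2 : ∀ i, ‖x i‖ ^ 2 ≤ (2 * Real.pi) ^ 2 := by
    intro i
    rw [Real.norm_eq_abs, sq_abs]
    exact pow_le_pow_left₀ (h i).1 (h i).2.le 2
  nlinarith [h2 0, h2 1, h2 2]

instance : IsFiniteMeasure (volume.restrict cell) :=
  isFiniteMeasure_restrict.2
    ((measure_mono cell_bounded).trans_lt measure_closedBall_lt_top).ne

theorem memLp_cell {F : Type*} [NormedAddCommGroup F] [SecondCountableTopologyEither E3 F]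
    {f : E3 → F} (hf : Continuous f) (p : ENNReal) :
    MemLp f p (volume.restrict cell) := by
  obtain ⟨C, hC⟩ := (isCompact_closedBall (0 : E3) (8 * Real.pi)).exists_bound_of_continuousOn
    hf.continuousOn
  refine MemLp.of_bound hf.aestronglyMeasurable C ?_
  exact ae_restrict_of_forall_mem cell_measurable fun x hx => hC x (cell_bounded hx)

theorem integrable_cell {F : Type*} [NormedAddCommGroup F] [SecondCountableTopologyEither E3 F]
    {f : E3 → F} (hf : Continuous f) : Integrable f (volume.restrict cell) :=
  memLp_one_iff_integrable.1 (memLp_cell hf 1)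

/-- A continuous periodic field which vanishes almost everywhere on the cell vanishes. -/
theorem eq_zero_of_ae {u : E3 → E3} (hc : Continuous u) (hp : IsPeriodic u)
    (h : u =ᵐ[volume.restrict cell] 0) : u = 0 := by
  have hpi := Real.pi_pos
  have hconv : Convex ℝ cell := by
    rw [cell_eq]
    exact (convex_pi fun _ _ => convex_Ico _ _).is_linear_preimage
      (WithLp.linearEquiv 2 ℝ (Fin 3 → ℝ)).isLinear
  have hint : (interior cell).Nonempty := by
    have ho : IsOpen ((WithLp.ofLp : E3 → Fin 3 → ℝ) ⁻¹'
        (Set.univ.pi fun _ => Set.Ioo 0 (2 * Real.pi))) :=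
      (isOpen_set_pi Set.finite_univ fun _ _ => isOpen_Ioo).preimage
        (PiLp.continuous_ofLp 2 _)
    refine ⟨WithLp.toLp 2 fun _ => Real.pi, interior_maximal ?_ ho ?_⟩
    · intro x hx i
      exact Set.Ioo_subset_Ico_self (hx i trivial)
    · intro i _
      constructor <;> simp <;> linarith
  have hcell : Set.EqOn u 0 cell :=
    Measure.eqOn_of_ae_eq h hc.continuousOn continuousOn_const
      (by rw [hconv.closure_interior_eq_closure_of_nonempty_interior hint]; exact subset_closure)
  have hpn : ∀ (i : Fin 3) (n : ℕ) (x : E3),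
      u (x + EuclideanSpace.single i (n * (2 * Real.pi))) = u x := by
    intro i n
    induction n with
    | zero => intro x; congr 1; ext j; simp
    | succ n ih =>
      intro x
      rw [← ih x, ← hp (x + EuclideanSpace.single i (n * (2 * Real.pi))) i]
      congr 1
      ext j
      by_cases hj : j = i <;> simp [hj]
      ring
  have hpz : ∀ (i : Fin 3) (n : ℤ) (x : E3),
      u (x + EuclideanSpace.single i (n * (2 * Real.pi))) = u x := by
    intro i n x
    obtain ⟨m, rfl | rfl⟩ := n.eq_nat_or_neg
    · exact_mod_cast hpn i m x
    · rw [← hpn i m (x + _)]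
      congr 1
      ext j
      by_cases hj : j = i <;> simp [hj]
  funext x
  set y : E3 := WithLp.toLp 2 fun i => toIcoMod Real.two_pi_pos 0 (x i) with hy
  have hyc : y ∈ cell := by
    intro i
    simpa [hy] using toIcoMod_mem_Ico Real.two_pi_pos 0 (x i)
  have : u x = u y := by
    rw [← hpz 0 (-toIcoDiv Real.two_pi_pos 0 (x 0)) x,
      ← hpz 1 (-toIcoDiv Real.two_pi_pos 0 (x 1)), ← hpz 2 (-toIcoDiv Real.two_pi_pos 0 (x 2))]
    congr 1
    ext j
    have hm : ∀ r : ℝ, toIcoMod Real.two_pi_pos 0 r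
        = r + -((toIcoDiv Real.two_pi_pos 0 r : ℤ) * (2 * Real.pi)) := by
      intro r
      rw [← self_sub_toIcoDiv_zsmul, zsmul_eq_mul]; ring
    fin_cases j <;> simp [hy, hm]
  rw [this]
  exact hcell hyc

/-- Divergence of a sum and of a multiple. -/
theorem dvg_add {u v : E3 → E3} (hu : Differentiable ℝ u) (hv : Differentiable ℝ v) :
    dvg (u + v) = dvg u + dvg v := by
  funext x
  simp [dvg, fderiv_add (hu x) (hv x), Finset.sum_add_distrib]

theorem dvg_smul (c : ℝ) {u : E3 → E3} (hu : Differentiable ℝ u) :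
    dvg (c • u) = c • dvg u := by
  funext x
  simp [dvg, fderiv_const_smul (hu x), Finset.mul_sum]

/-- The space `𝒱` of divergence-free trigonometric polynomials with zero average. -/
def VV : Submodule ℝ (E3 → E3) where
  carrier := {v | v ∈ TrigPoly ∧ dvg v = 0 ∧ ∫ x in cell, v x = 0}
  add_mem' := by
    rintro u v ⟨hu, hu1, hu2⟩ ⟨hv, hv1, hv2⟩
    refine ⟨add_mem hu hv, ?_, ?_⟩
    · rw [dvg_add (trigPoly_differentiable hu) (trigPoly_differentiable hv), hu1, hv1, add_zero]
    · simp only [Pi.add_apply]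
      rw [integral_add (integrable_cell (trigPoly_continuous hu))
        (integrable_cell (trigPoly_continuous hv)), hu2, hv2, add_zero]
  zero_mem' := ⟨zero_mem _, by funext x; simp [dvg], by simp⟩
  smul_mem' := by
    rintro c u ⟨hu, hu1, hu2⟩
    refine ⟨Submodule.smul_mem _ c hu, ?_, ?_⟩
    · rw [dvg_smul c (trigPoly_differentiable hu), hu1, smul_zero]
    · simp only [Pi.smul_apply]
      rw [integral_smul, hu2, smul_zero]

instance : AddCommGroup VV := Submodule.addCommGroup VV

instance : Module ℝ VV := Submodule.module VV

/-- The class in `L²(Ω)³` of a trigonometric polynomial. -/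
def trigToL2 : TrigPoly →ₗ[ℝ] L2 where
  toFun u := (memLp_cell (trigPoly_continuous u.2) 2).toLp u.1
  map_add' _ _ := MemLp.toLp_add _ _
  map_smul' _ _ := MemLp.toLp_const_smul _ _

/-- `𝒱 ⊆` trigonometric polynomials. -/
def incl : VV →ₗ[ℝ] TrigPoly := Submodule.inclusion fun _ h => h.1

/-- The class in `L²(Ω)³` of an element of `𝒱`. -/
def toL2 : VV →ₗ[ℝ] L2 := trigToL2 ∘ₗ incl

theorem trigToL2_injective : Function.Injective trigToL2 := by
  rw [← LinearMap.ker_eq_bot, LinearMap.ker_eq_bot']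
  intro u hu
  apply Subtype.ext
  refine eq_zero_of_ae (trigPoly_continuous u.2) (trigPoly_periodic u.2) ?_
  have h := (memLp_cell (trigPoly_continuous u.2) 2).coeFn_toLp
  have h0 := Lp.coeFn_zero E3 2 (volume.restrict cell)
  change (memLp_cell (trigPoly_continuous u.2) 2).toLp u.1 = 0 at hu
  rw [hu] at h
  exact h.symm.trans h0

theorem toL2_injective : Function.Injective toL2 :=
  trigToL2_injective.comp (Submodule.inclusion_injective _)

theorem inner_trigToL2 (u v : TrigPoly) :
    ⟪trigToL2 u, trigToL2 v⟫ = ∫ x in cell, ⟪u.1 x, v.1 x⟫ := by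
  rw [L2.inner_def]
  refine integral_congr_ae ?_
  have h := (memLp_cell (trigPoly_continuous u.2) 2).coeFn_toLp
  have h' := (memLp_cell (trigPoly_continuous v.2) 2).coeFn_toLp
  filter_upwards [h, h'] with x hx hx'
  change ⟪(memLp_cell (trigPoly_continuous u.2) 2).toLp u.1 x,
    (memLp_cell (trigPoly_continuous v.2) 2).toLp v.1 x⟫ = _
  rw [hx, hx']

theorem integral_cos_eq_zero {k : Fin 3 → ℤ} (hk : k ≠ 0) (θ : ℝ) :
    ∫ x in cell, Real.cos (⟪wave k, x⟫ + θ) = 0 := by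
  obtain ⟨i₀, hi₀⟩ : ∃ i, k i ≠ 0 := by
    by_contra h
    push Not at h
    exact hk (funext h)
  have hC : ∫ x in cell, Complex.exp ((⟪wave k, x⟫ + θ : ℝ) * Complex.I) = 0 := by
    have h1 : ∀ x : E3, Complex.exp ((⟪wave k, x⟫ + θ : ℝ) * Complex.I)
        = Complex.exp (θ * Complex.I) * ∏ i, Complex.exp ((k i : ℂ) * Complex.I * (x i : ℝ)) := by
      intro x
      rw [← Complex.exp_sum, ← Complex.exp_add]
      congr 1
      simp only [wave, PiLp.inner_apply, RCLike.inner_apply, conj_trivial, Fin.sum_univ_three]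
      push_cast
      ring
    simp_rw [h1]
    rw [integral_const_mul]
    have h2 : ∫ x in cell, ∏ i, Complex.exp ((k i : ℂ) * Complex.I * (x i : ℝ))
        = ∫ y in Set.univ.pi fun _ : Fin 3 => Set.Ico 0 (2 * Real.pi),
          ∏ i, Complex.exp ((k i : ℂ) * Complex.I * (y i : ℝ)) := by
      rw [cell_eq]
      exact (PiLp.volume_preserving_ofLp (Fin 3)).setIntegral_preimage_emb
        (MeasurableEquiv.toLp 2 (Fin 3 → ℝ)).symm.measurableEmbedding
        (fun y => ∏ i, Complex.exp ((k i : ℂ) * Complex.I * (y i : ℝ))) _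
    rw [h2, volume_pi, Measure.restrict_pi_pi,
      integral_fintype_prod_eq_prod (fun i (y : ℝ) => Complex.exp ((k i : ℂ) * Complex.I * y)),
      Finset.prod_eq_zero (Finset.mem_univ i₀), mul_zero]
    have hc : (k i₀ : ℂ) * Complex.I ≠ 0 := mul_ne_zero (by exact_mod_cast hi₀) Complex.I_ne_zero
    rw [integral_Ico_eq_integral_Ioc, ← intervalIntegral.integral_of_le Real.two_pi_pos.le,
      integral_exp_mul_complex hc]
    have : Complex.exp ((k i₀ : ℂ) * Complex.I * ((2 * Real.pi : ℝ) : ℂ)) = 1 := by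
      rw [← Complex.exp_int_mul_two_pi_mul_I (k i₀)]
      congr 1
      push_cast
      ring
    rw [this]
    simp
  have hint : Integrable (fun x : E3 => Complex.exp ((⟪wave k, x⟫ + θ : ℝ) * Complex.I))
      (volume.restrict cell) := integrable_cell (by fun_prop)
  have := congrArg Complex.re hC
  rw [← RCLike.re_eq_complex_re, ← integral_re hint] at this
  simpa [Complex.exp_ofReal_mul_I_re, -Complex.ofReal_add] using this

theorem mode_shift (k : Fin 3 → ℤ) (θ : ℝ) (x : E3) :
    -Real.sin (⟪wave k, x⟫ + θ) = Real.cos (⟪wave k, x⟫ + (θ + Real.pi / 2)) := by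
  rw [← add_assoc, Real.cos_add_pi_div_two]

theorem fderiv_mode (k : Fin 3 → ℤ) (θ : ℝ) (a x h : E3) :
    fderiv ℝ (mode k θ a) x h
      = Real.cos (⟪wave k, x⟫ + (θ + Real.pi / 2)) • ⟪wave k, h⟫ • a := by
  rw [(mode_hasFDerivAt k θ a x).fderiv, ← mode_shift]
  simp [smul_smul]

theorem dvg_mode (k : Fin 3 → ℤ) (θ : ℝ) (a x : E3) :
    dvg (mode k θ a) x
      = Real.cos (⟪wave k, x⟫ + (θ + Real.pi / 2)) * ⟪wave k, a⟫ := by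
  simp only [dvg, fderiv_mode, inner_wave_single]
  simp [wave, Fin.sum_univ_three, PiLp.inner_apply]
  ring

theorem wave_zero : wave 0 = 0 := by ext i; simp [wave]

theorem continuous_dvg {u : E3 → E3} (hu : u ∈ TrigPoly) : Continuous (dvg u) := by
  have h := trigPoly_fderiv_continuous hu
  unfold dvg
  fun_prop

theorem integral_dvg {u : E3 → E3} (hu : u ∈ TrigPoly) : ∫ x in cell, dvg u x = 0 := by
  refine trigPoly_ind (p := fun u => ∫ x in cell, dvg u x = 0) ?_ ?_ ?_ hu
  · intro k θ a
    simp_rw [dvg_mode]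
    rw [integral_mul_const]
    by_cases hk : k = 0
    · subst hk; simp [wave_zero]
    · rw [integral_cos_eq_zero hk, zero_mul]
  · intro u hu v hv h1 h2
    rw [dvg_add (trigPoly_differentiable hu) (trigPoly_differentiable hv)]
    simp only [Pi.add_apply]
    rw [integral_add (integrable_cell (continuous_dvg hu)) (integrable_cell (continuous_dvg hv)),
      h1, h2, add_zero]
  · intro c u hu h
    rw [dvg_smul c (trigPoly_differentiable hu)]
    simp only [Pi.smul_apply]
    rw [integral_smul, h, smul_zero]

theorem cos_smul_mode (k l : Fin 3 → ℤ) (θ η : ℝ) (a : E3) :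
    (fun x => Real.cos (⟪wave k, x⟫ + θ) • mode l η a x)
      = (1 / 2 : ℝ) • mode (k + l) (θ + η) a + (1 / 2 : ℝ) • mode (k - l) (θ - η) a := by
  funext x
  have hp : ⟪wave (k + l), x⟫ + (θ + η) = (⟪wave k, x⟫ + θ) + (⟪wave l, x⟫ + η) := by
    have : wave (k + l) = wave k + wave l := by ext i; simp [wave]
    rw [this, inner_add_left]; ring
  have hm : ⟪wave (k - l), x⟫ + (θ - η) = (⟪wave k, x⟫ + θ) - (⟪wave l, x⟫ + η) := by
    have : wave (k - l) = wave k - wave l := by ext i; simp [wave]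
    rw [this, inner_sub_left]; ring
  simp only [mode, Pi.add_apply, Pi.smul_apply, hp, hm, Real.cos_add, Real.cos_sub, smul_smul,
    ← add_smul]
  congr 1
  ring

theorem cos_smul_mem (k : Fin 3 → ℤ) (θ : ℝ) {u : E3 → E3} (hu : u ∈ TrigPoly) :
    (fun x => Real.cos (⟪wave k, x⟫ + θ) • u x) ∈ TrigPoly := by
  refine trigPoly_ind (p := fun u => (fun x => Real.cos (⟪wave k, x⟫ + θ) • u x) ∈ TrigPoly)
    ?_ ?_ ?_ hu
  · intro l η a
    rw [cos_smul_mode]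
    exact add_mem (Submodule.smul_mem _ _ (mode_mem _ _ _))
      (Submodule.smul_mem _ _ (mode_mem _ _ _))
  · intro u _ v _ h1 h2
    convert! add_mem h1 h2 using 1
    funext x
    simp
  · intro c u _ h
    convert! Submodule.smul_mem _ c h using 1
    funext x
    exact smul_comm (Real.cos (⟪wave k, x⟫ + θ)) c (u x)

theorem adv_mem {u v : E3 → E3} (hu : u ∈ TrigPoly) (hv : v ∈ TrigPoly) :
    adv u v ∈ TrigPoly := by
  refine trigPoly_ind (p := fun v => adv u v ∈ TrigPoly) ?_ ?_ ?_ hv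
  · intro k θ a
    have h1 : (fun x => ⟪wave k, u x⟫ • a) ∈ TrigPoly := by
      refine trigPoly_ind (p := fun u => (fun x => ⟪wave k, u x⟫ • a) ∈ TrigPoly) ?_ ?_ ?_ hu
      · intro l η b
        convert! mode_mem l η (⟪wave k, b⟫ • a) using 1
        funext x
        simp [mode, inner_smul_right, smul_smul]
      · intro u _ v _ h1 h2
        convert! add_mem h1 h2 using 1
        funext x
        simp [inner_add_right, add_smul]
      · intro c u _ h
        convert! Submodule.smul_mem _ c h using 1
        funext x
        simp [inner_smul_right, smul_smul]
    convert! cos_smul_mem k (θ + Real.pi / 2) h1 using 1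
    funext x
    simp [adv, fderiv_mode]
  · intro v hv w hw h1 h2
    convert! add_mem h1 h2 using 1
    funext x
    simp [adv, fderiv_add (trigPoly_differentiable hv x) (trigPoly_differentiable hw x)]
  · intro c v hv h
    convert! Submodule.smul_mem _ c h using 1
    funext x
    simp [adv, fderiv_const_smul (trigPoly_differentiable hv x)]

theorem laplacian_mode (k : Fin 3 → ℤ) (θ : ℝ) (a : E3) :
    Δ (mode k θ a) = (-‖wave k‖ ^ 2) • mode k θ a := by
  rw [InnerProductSpace.laplacian_eq_iteratedFDeriv_orthonormalBasis _
    (EuclideanSpace.basisFun (Fin 3) ℝ)]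
  funext x
  have hd : ∀ h : E3, HasFDerivAt (fun y => fderiv ℝ (mode k θ a) y h)
      ((-Real.sin (⟪wave k, x⟫ + (θ + Real.pi / 2)) • innerSL ℝ (wave k)).smulRight
        (⟪wave k, h⟫ • a)) x := by
    intro h
    have : (fun y => fderiv ℝ (mode k θ a) y h) = mode k (θ + Real.pi / 2) (⟪wave k, h⟫ • a) := by
      funext y; rw [fderiv_mode]; rfl
    rw [this]
    exact mode_hasFDerivAt _ _ _ _
  have hdd : DifferentiableAt ℝ (fderiv ℝ (mode k θ a)) x :=
    ((trigPoly_contDiff (mode_mem k θ a)).fderiv_right (m := 1) (by norm_cast)).differentiable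
      (by simp) x
  have h2 : ∀ h : E3, fderiv ℝ (fderiv ℝ (mode k θ a)) x h h
      = (-(⟪wave k, h⟫ ^ 2)) • mode k θ a x := by
    intro h
    have h3 := (hdd.hasFDerivAt.clm_apply (hasFDerivAt_const h x)).unique (hd h)
    have h4 := congrArg (fun L => L h) h3
    simp only [ContinuousLinearMap.comp_zero, zero_add, ContinuousLinearMap.flip_apply,
      ContinuousLinearMap.smulRight_apply, smul_apply] at h4
    rw [h4, mode_shift, ← add_assoc, ← add_assoc, Real.cos_add_pi_div_two, Real.sin_add_pi_div_two]
    simp only [mode, innerSL_apply_apply, smul_smul, smul_eq_mul]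
    congr 1
    ring
  simp only [iteratedFDeriv_two_apply, Matrix.cons_val_zero, Matrix.cons_val_one, h2]
  rw [← Finset.sum_smul, EuclideanSpace.norm_sq_eq]
  simp only [EuclideanSpace.basisFun_apply, inner_wave_single, Fin.sum_univ_three]
  simp [wave]
  congr 1
  ring

theorem laplacian_add' {u v : E3 → E3} (hu : u ∈ TrigPoly) (hv : v ∈ TrigPoly) :
    Δ (u + v) = Δ u + Δ v := by
  funext x
  exact ContDiffAt.laplacian_add ((trigPoly_contDiff hu).contDiffAt.of_le (by norm_cast))
    ((trigPoly_contDiff hv).contDiffAt.of_le (by norm_cast))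

theorem laplacian_smul' (c : ℝ) {u : E3 → E3} (hu : u ∈ TrigPoly) :
    Δ (c • u) = c • Δ u := by
  funext x
  exact InnerProductSpace.laplacian_smul c ((trigPoly_contDiff hu).contDiffAt.of_le (by norm_cast))

theorem laplacian_mem {u : E3 → E3} (hu : u ∈ TrigPoly) : Δ u ∈ TrigPoly := by
  refine trigPoly_ind (p := fun u => Δ u ∈ TrigPoly) ?_ ?_ ?_ hu
  · intro k θ a
    rw [laplacian_mode]
    exact Submodule.smul_mem _ _ (mode_mem _ _ _)
  · intro u hu v hv h1 h2
    rw [laplacian_add' hu hv]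
    exact add_mem h1 h2
  · intro c u hu h
    rw [laplacian_smul' c hu]
    exact Submodule.smul_mem _ _ h

/-- The Laplacian on trigonometric polynomials. -/
def lap : TrigPoly →ₗ[ℝ] TrigPoly where
  toFun u := ⟨Δ u.1, laplacian_mem u.2⟩
  map_add' u v := Subtype.ext (laplacian_add' u.2 v.2)
  map_smul' c u := Subtype.ext (laplacian_smul' c u.2)

/-- The space `H`, the closure of `𝒱` in `L²(Ω)³`. -/
def H : Submodule ℝ L2 := (LinearMap.range toL2).topologicalClosure

instance : CompleteSpace H := (Submodule.isClosed_topologicalClosure _).completeSpace_coe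

/-- The Leray projection, the orthogonal projection of `L²(Ω)³` onto `H`. -/
def P : L2 →L[ℝ] L2 := H.starProjection

theorem toL2_mem (v : VV) : toL2 v ∈ H := Submodule.le_topologicalClosure _ ⟨v, rfl⟩

theorem orth_H {f : L2} (hf : ∀ v : VV, ⟪f, toL2 v⟫ = 0) : f ∈ Hᗮ := by
  rw [H, Submodule.orthogonal_closure, Submodule.mem_orthogonal']
  rintro _ ⟨v, rfl⟩
  exact hf v

/-- The gradient part of a mode is orthogonal to `𝒱`. -/
theorem grad_orth (k : Fin 3 → ℤ) (θ : ℝ) (v : VV) :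
    ∫ x in cell, ⟪mode k θ (wave k) x, v.1 x⟫ = 0 := by
  have hw := cos_smul_mem k (θ - Real.pi / 2) v.2.1
  rw [← integral_dvg hw]
  refine integral_congr_ae (Filter.Eventually.of_forall fun x => ?_)
  have h1 : HasFDerivAt (fun x : E3 => ⟪wave k, x⟫ + (θ - Real.pi / 2)) (innerSL ℝ (wave k)) x :=
    ((innerSL ℝ (wave k)).hasFDerivAt).add_const _
  have h2 := (h1.cos).fun_smul (trigPoly_differentiable v.2.1 x).hasFDerivAt
  have hd : dvg (v : E3 → E3) x = 0 := congrFun v.2.2.1 x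
  have hs : Real.sin (⟪wave k, x⟫ + (θ - Real.pi / 2)) = -Real.cos (⟪wave k, x⟫ + θ) := by
    rw [← add_sub_assoc, Real.sin_sub_pi_div_two]
  simp only [dvg, Fin.sum_univ_three] at hd
  simp only [dvg]
  change _ = ∑ i, (fderiv ℝ (fun x => Real.cos (⟪wave k, x⟫ + (θ - Real.pi / 2)) • (v : E3 → E3) x)
    x (EuclideanSpace.single i 1)) i
  rw [h2.fderiv, hs]
  simp only [mode]
  generalize Real.cos (⟪wave k, x⟫ + θ) = C
  generalize Real.cos (⟪wave k, x⟫ + (θ - Real.pi / 2)) = D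
  simp [wave, PiLp.inner_apply, Fin.sum_univ_three]
  linear_combination (-D) * hd

theorem exists_leray_mode (k : Fin 3 → ℤ) (θ : ℝ) (a : E3) :
    ∃ v : VV, (∃ b, v.1 = mode k θ b) ∧ (k = 0 → v = 0) ∧ toL2 v = P (trigToL2 ⟨mode k θ a, mode_mem k θ a⟩) := by
  by_cases hk : k = 0
  · refine ⟨0, ⟨0, by funext x; simp [mode]⟩, fun _ => rfl, ?_⟩
    rw [map_zero]
    refine (Submodule.eq_starProjection_of_mem_orthogonal (zero_mem _) (orth_H fun v => ?_)).symm
    rw [sub_zero]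
    refine (inner_trigToL2 _ (incl v)).trans ?_
    have : ∀ x, ⟪mode k θ a x, (incl v).1 x⟫ = ⟪Real.cos θ • a, v.1 x⟫ := by
      intro x; simp [mode, hk, wave_zero]; rfl
    simp_rw [this]
    rw [integral_inner (integrable_cell (trigPoly_continuous v.2.1)), v.2.2.2, inner_zero_right]
  · have hw : ⟪wave k, wave k⟫ ≠ 0 := by
      rw [inner_self_ne_zero]
      intro h
      apply hk
      funext i
      have := congrArg (fun y : E3 => y i) h
      simpa [wave] using this
    set c : ℝ := ⟪wave k, a⟫ / ⟪wave k, wave k⟫ with hc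
    set b : E3 := a - c • wave k with hb
    have hkb : ⟪wave k, b⟫ = 0 := by
      rw [hb, inner_sub_right, inner_smul_right, hc]
      field_simp
      ring
    have hmem : mode k θ b ∈ VV := by
      refine ⟨mode_mem _ _ _, ?_, ?_⟩
      · funext x
        rw [dvg_mode, hkb, mul_zero]; rfl
      · simp only [mode]
        rw [integral_smul_const, integral_cos_eq_zero hk, zero_smul]
    refine ⟨⟨_, hmem⟩, ⟨b, rfl⟩, fun h => absurd h hk, ?_⟩
    refine (Submodule.eq_starProjection_of_mem_orthogonal (toL2_mem _) (orth_H fun v => ?_)).symm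
    have h1 : trigToL2 ⟨mode k θ a, mode_mem k θ a⟩ - toL2 ⟨mode k θ b, hmem⟩
        = c • trigToL2 ⟨mode k θ (wave k), mode_mem k θ _⟩ := by
      change _ - trigToL2 (incl ⟨mode k θ b, hmem⟩) = _
      rw [← map_sub, ← map_smul]
      congr 1
      apply Subtype.ext
      funext x
      change mode k θ a x - mode k θ b x = c • mode k θ (wave k) x
      simp only [mode, hb, smul_sub, sub_sub_cancel]
      rw [smul_comm]
    rw [h1, inner_smul_left]
    have h2 := (inner_trigToL2 ⟨mode k θ (wave k), mode_mem k θ _⟩ (incl v)).trans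
      (grad_orth k θ v)
    change ⟪_, toL2 v⟫ = 0 at h2
    rw [h2, mul_zero]

/-- The Leray projection of a trigonometric polynomial is an element of `𝒱`. -/
theorem exists_leray (w : TrigPoly) : ∃ v : VV, toL2 v = P (trigToL2 w) := by
  obtain ⟨w, hw⟩ := w
  refine trigPoly_ind (p := fun w => ∀ hw : w ∈ TrigPoly, ∃ v : VV, toL2 v = P (trigToL2 ⟨w, hw⟩))
    ?_ ?_ ?_ hw hw
  · intro k θ a _
    obtain ⟨v, -, -, hv⟩ := exists_leray_mode k θ a
    exact ⟨v, hv⟩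
  · intro u hu v hv h1 h2 _
    obtain ⟨a, ha⟩ := h1 hu
    obtain ⟨b, hb⟩ := h2 hv
    refine ⟨a + b, ?_⟩
    rw [map_add, ha, hb, ← map_add, ← map_add]
    rfl
  · intro c u hu h _
    obtain ⟨a, ha⟩ := h hu
    refine ⟨c • a, ?_⟩
    rw [map_smul, ha, ← map_smul, ← map_smul]
    rfl

/-- The Leray projection as a map from trigonometric polynomials to `𝒱`. -/
def leray : TrigPoly →ₗ[ℝ] VV :=
  (LinearEquiv.ofInjective toL2 toL2_injective).symm.toLinearMap ∘ₗ
    (P.toLinearMap ∘ₗ trigToL2).codRestrict (LinearMap.range toL2) exists_leray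

theorem toL2_leray (w : TrigPoly) : toL2 (leray w) = P (trigToL2 w) := by
  have := (LinearEquiv.ofInjective toL2 toL2_injective).apply_symm_apply
    ((P.toLinearMap ∘ₗ trigToL2).codRestrict (LinearMap.range toL2) exists_leray w)
  exact congrArg Subtype.val this

/-- The Stokes operator `A v = - P Δ v` on `𝒱`. -/
def stokes : VV →ₗ[ℝ] VV := -(leray ∘ₗ lap ∘ₗ incl)

/-- The bilinear form `B (u, v) = P [(u · ∇) v]` on `𝒱`. -/
def bil (u v : VV) : VV := leray ⟨adv u v, adv_mem u.2.1 v.2.1⟩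

/-- The eigenspace of the Stokes operator for the number `n`. All eigenfunctions of the Stokes
operator are trigonometric polynomials; the eigenspace is `0` when `n` is not an eigenvalue. -/
def eig (n : ℕ) : Submodule ℝ VV := Module.End.eigenspace stokes (n : ℝ)

theorem incl_injective : Function.Injective incl := Submodule.inclusion_injective _

theorem leray_incl (v : VV) : leray (incl v) = v := by
  apply toL2_injective
  rw [toL2_leray]
  exact Submodule.starProjection_eq_self_iff.2 (toL2_mem v)

theorem lap_mode (k : Fin 3 → ℤ) (θ : ℝ) (a : E3) :
    lap ⟨mode k θ a, mode_mem k θ a⟩ = (-‖wave k‖ ^ 2) • ⟨mode k θ a, mode_mem k θ a⟩ :=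
  Subtype.ext (laplacian_mode k θ a)

theorem trigPoly_ext {M : Type*} [AddCommGroup M] [Module ℝ M] {f g : TrigPoly →ₗ[ℝ] M}
    (h : ∀ k θ a, f ⟨mode k θ a, mode_mem k θ a⟩ = g ⟨mode k θ a, mode_mem k θ a⟩) : f = g := by
  ext ⟨u, hu⟩
  refine trigPoly_ind (p := fun u => ∀ hu : u ∈ TrigPoly, f ⟨u, hu⟩ = g ⟨u, hu⟩)
    (fun k θ a _ => h k θ a) ?_ ?_ hu hu
  · intro u hu v hv h1 h2 _
    have e : ∀ h, (⟨u + v, h⟩ : TrigPoly) = ⟨u, hu⟩ + ⟨v, hv⟩ := fun _ => rfl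
    rw [e, map_add, map_add, h1 hu, h2 hv]
  · intro c u hu h1 _
    have e : ∀ h, (⟨c • u, h⟩ : TrigPoly) = c • ⟨u, hu⟩ := fun _ => rfl
    rw [e, map_smul, map_smul, h1 hu]

theorem leray_mode (k : Fin 3 → ℤ) (θ : ℝ) (a : E3) :
    (∃ b, incl (leray ⟨mode k θ a, mode_mem k θ a⟩) = ⟨mode k θ b, mode_mem k θ b⟩) ∧
      (k = 0 → leray ⟨mode k θ a, mode_mem k θ a⟩ = 0) := by
  obtain ⟨v, ⟨b, hb⟩, h0, hv⟩ := exists_leray_mode k θ a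
  have : leray ⟨mode k θ a, mode_mem k θ a⟩ = v := toL2_injective (by rw [toL2_leray, hv])
  rw [this]
  exact ⟨⟨b, Subtype.ext hb⟩, h0⟩

theorem leray_lap : incl ∘ₗ leray ∘ₗ lap = lap ∘ₗ incl ∘ₗ leray := by
  apply trigPoly_ext
  intro k θ a
  obtain ⟨⟨b, hb⟩, -⟩ := leray_mode k θ a
  simp only [LinearMap.comp_apply, lap_mode, map_smul, hb]

theorem incl_stokes (v : VV) : incl (stokes v) = -lap (incl v) := by
  have := LinearMap.congr_fun leray_lap (incl v)
  simp only [LinearMap.comp_apply, leray_incl] at this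
  simp only [stokes, LinearMap.neg_apply, LinearMap.comp_apply, map_neg, this]

/-- Span of the modes of wave number `|k|² = n`. -/
def shell (n : ℕ) : Submodule ℝ TrigPoly :=
  Submodule.span ℝ {u | ∃ k θ a, ‖wave k‖ ^ 2 = n ∧ u = ⟨mode k θ a, mode_mem k θ a⟩}

theorem norm_wave_sq (k : Fin 3 → ℤ) : ∃ n : ℕ, ‖wave k‖ ^ 2 = n := by
  refine ⟨(k 0 ^ 2 + k 1 ^ 2 + k 2 ^ 2).toNat, ?_⟩
  have h : ((k 0 ^ 2 + k 1 ^ 2 + k 2 ^ 2).toNat : ℤ) = k 0 ^ 2 + k 1 ^ 2 + k 2 ^ 2 :=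
    Int.toNat_of_nonneg (by positivity)
  have h' : ((k 0 ^ 2 + k 1 ^ 2 + k 2 ^ 2).toNat : ℝ) = k 0 ^ 2 + k 1 ^ 2 + k 2 ^ 2 := by
    exact_mod_cast h
  rw [h', EuclideanSpace.norm_sq_eq]
  simp [wave, Fin.sum_univ_three]

theorem wave_finite (n : ℕ) : {k : Fin 3 → ℤ | ‖wave k‖ ^ 2 = n}.Finite := by
  refine (Set.Finite.pi' (fun _ : Fin 3 => Set.finite_Icc (-(n : ℤ)) n)).subset ?_
  intro k hk i
  have h1 : ‖wave k‖ ^ 2 = (n : ℝ) := hk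
  rw [EuclideanSpace.norm_sq_eq] at h1
  simp only [wave, Real.norm_eq_abs, sq_abs] at h1
  have h2 : (k i : ℝ) ^ 2 ≤ n := by
    rw [← h1]
    exact Finset.single_le_sum (f := fun i => (k i : ℝ) ^ 2) (fun _ _ => sq_nonneg _)
      (Finset.mem_univ i)
  have h3 : k i ^ 2 ≤ (n : ℤ) := by exact_mod_cast h2
  rw [Set.mem_Icc]
  constructor <;> nlinarith [sq_nonneg (k i), sq_nonneg (k i + 1), sq_nonneg (k i - 1)]

instance shell_finite (n : ℕ) : FiniteDimensional ℝ (shell n) := by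
  set S : Set TrigPoly := (fun p : (Fin 3 → ℤ) × Bool × Fin 3 =>
    (⟨mode p.1 (if p.2.1 then 0 else Real.pi / 2) (EuclideanSpace.single p.2.2 1),
      mode_mem _ _ _⟩ : TrigPoly)) '' ({k | ‖wave k‖ ^ 2 = n} ×ˢ Set.univ) with hS
  have hfin : S.Finite := ((wave_finite n).prod Set.finite_univ).image _
  have : FiniteDimensional ℝ (Submodule.span ℝ S) := FiniteDimensional.span_of_finite ℝ hfin
  refine Submodule.finiteDimensional_of_le (S₂ := Submodule.span ℝ S) ?_
  refine Submodule.span_le.2 ?_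
  rintro _ ⟨k, θ, a, hk, rfl⟩
  have hmem : ∀ (b : Bool) (i : Fin 3), (⟨mode k (if b then 0 else Real.pi / 2) (EuclideanSpace.single i 1),
      mode_mem _ _ _⟩ : TrigPoly) ∈ Submodule.span ℝ S := fun b i =>
    Submodule.subset_span ⟨(k, b, i), ⟨hk, trivial⟩, rfl⟩
  have he : (⟨mode k θ a, mode_mem k θ a⟩ : TrigPoly) = ∑ i, a i •
      (Real.cos θ • (⟨mode k (if true then 0 else Real.pi / 2) (EuclideanSpace.single i 1),
          mode_mem _ _ _⟩ : TrigPoly) +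
        Real.sin θ • (⟨mode k (if false then 0 else Real.pi / 2) (EuclideanSpace.single i 1),
          mode_mem _ _ _⟩ : TrigPoly)) := by
    apply Subtype.ext
    funext x
    ext j
    fin_cases j <;>
    simp [Fin.sum_univ_three, mode, Real.cos_add] <;>
    ring
  rw [he]
  exact Submodule.sum_mem _ fun i _ => Submodule.smul_mem _ _ (add_mem
    (Submodule.smul_mem _ _ (hmem true i)) (Submodule.smul_mem _ _ (hmem false i)))

theorem shell_lap {n : ℕ} {u : TrigPoly} (hu : u ∈ shell n) : lap u = (-(n : ℝ)) • u := by
  induction hu using Submodule.span_induction with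
  | mem x h =>
    obtain ⟨k, θ, a, hk, rfl⟩ := h
    rw [lap_mode, hk]
  | zero => simp
  | add x y _ _ h1 h2 => rw [map_add, h1, h2, smul_add]
  | smul c x _ h => rw [map_smul, h, smul_comm]

theorem iSup_shell : ⨆ n, shell n = ⊤ := by
  rw [eq_top_iff]
  rintro ⟨u, hu⟩ -
  refine trigPoly_ind (p := fun u => ∀ hu : u ∈ TrigPoly, (⟨u, hu⟩ : TrigPoly) ∈ ⨆ n, shell n)
    ?_ ?_ ?_ hu hu
  · intro k θ a _
    obtain ⟨n, hn⟩ := norm_wave_sq k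
    exact Submodule.mem_iSup_of_mem n (Submodule.subset_span ⟨k, θ, a, hn, rfl⟩)
  · intro u hu v hv h1 h2 _
    exact add_mem (h1 hu) (h2 hv)
  · intro c u hu h _
    exact Submodule.smul_mem _ c (h hu)

theorem mem_shell {n : ℕ} {u : TrigPoly} (hu : lap u = (-(n : ℝ)) • u) : u ∈ shell n := by
  classical
  have hind := (Module.End.eigenspaces_iSupIndep lap).comp
    (f := fun n : ℕ => -(n : ℝ)) (fun a b h => by simpa using h)
  have hle : ∀ m : ℕ, shell m ≤ Module.End.eigenspace lap (-(m : ℝ)) := fun m v hv =>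
    Module.End.mem_eigenspace_iff.2 (shell_lap hv)
  have hu' : u ∈ ⨆ m, shell m := by rw [iSup_shell]; trivial
  have hsplit : (⨆ m, shell m) = shell n ⊔ ⨆ m, ⨆ (_ : m ≠ n), shell m :=
    iSup_split_single shell n
  rw [hsplit, Submodule.mem_sup] at hu'
  obtain ⟨a, ha, b, hb, hab⟩ := hu'
  have hb2 : b ∈ ⨆ m, ⨆ (_ : m ≠ n), Module.End.eigenspace lap (-(m : ℝ)) :=
    iSup₂_mono (fun m _ => hle m) hb
  have hb1 : b ∈ Module.End.eigenspace lap (-(n : ℝ)) := by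
    rw [← eq_sub_iff_add_eq'] at hab
    rw [hab]
    exact sub_mem (Module.End.mem_eigenspace_iff.2 hu) (hle n ha)
  have hb0 : b = 0 := by
    have := (hind n).le_bot ⟨hb1, hb2⟩
    simpa using this
  rw [← hab, hb0, add_zero]
  exact ha

theorem eig_shell {n : ℕ} {v : VV} (hv : v ∈ eig n) : incl v ∈ shell n := by
  apply mem_shell
  have h1 : stokes v = (n : ℝ) • v := Module.End.mem_eigenspace_iff.1 hv
  have h2 := incl_stokes v
  rw [h1, map_smul] at h2
  have h3 : lap (incl v) = -((n : ℝ) • incl v) := by rw [h2, neg_neg]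
  rw [h3]
  exact (neg_smul (n : ℝ) (incl v)).symm

instance eig_finite (n : ℕ) : FiniteDimensional ℝ (eig n) := by
  let f : eig n →ₗ[ℝ] shell n :=
    (incl ∘ₗ (eig n).subtype).codRestrict (shell n) fun v => eig_shell v.2
  have : IsNoetherian ℝ (shell n) := isNoetherian_of_isNoetherianRing_of_finite ℝ (shell n)
  refine Module.Finite.of_injective f ?_
  intro a b h
  have : incl a.1 = incl b.1 := congrArg Subtype.val h
  exact Subtype.ext (incl_injective this)

theorem eig_zero {v : VV} (hv : v ∈ eig 0) : v = 0 := by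
  rw [← leray_incl v]
  have h := eig_shell hv
  generalize incl v = w at h
  induction h using Submodule.span_induction with
  | mem x h =>
    obtain ⟨k, θ, a, hk, rfl⟩ := h
    apply (leray_mode k θ a).2
    have hk' : wave k = 0 := by simpa using hk
    funext i
    have := congrArg (fun y : E3 => y i) hk'
    simpa [wave] using this
  | zero => simp
  | add x y _ _ h1 h2 => rw [map_add, h1, h2, add_zero]
  | smul c x _ h => rw [map_smul, h, smul_zero]

theorem leray_shell {n : ℕ} {u : TrigPoly} (hu : u ∈ shell n) : leray u ∈ eig n := by
  refine Module.End.mem_eigenspace_iff.2 (incl_injective ?_)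
  change incl (stokes (leray u)) = incl ((n : ℝ) • leray u)
  have := LinearMap.congr_fun leray_lap u
  simp only [LinearMap.comp_apply] at this
  rw [incl_stokes, ← this, shell_lap hu, map_smul, map_smul, map_smul]
  exact neg_eq_iff_eq_neg.2 (neg_smul (n : ℝ) (incl (leray u)))

theorem iSup_eig : ⨆ n, eig n = ⊤ := by
  rw [eq_top_iff]
  rintro v -
  rw [← leray_incl v]
  have h : incl v ∈ ⨆ n, shell n := by rw [iSup_shell]; trivial
  have h2 : (⨆ n, shell n).map leray ≤ ⨆ n, eig n := by
    rw [Submodule.map_iSup]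
    refine iSup_mono fun n => ?_
    rintro _ ⟨u, hu, rfl⟩
    exact leray_shell hu
  exact h2 ⟨_, h, rfl⟩

theorem mode_orth {k l : Fin 3 → ℤ} (h : ‖wave k‖ ^ 2 ≠ ‖wave l‖ ^ 2) (θ η : ℝ) (a b : E3) :
    ∫ x in cell, ⟪mode k θ a x, mode l η b x⟫ = 0 := by
  have hp : k + l ≠ 0 := by
    intro h0
    apply h
    have : wave k = -wave l := by
      rw [eq_neg_of_add_eq_zero_left h0]; ext i; simp [wave]
    rw [this, norm_neg]
  have hm : k - l ≠ 0 := by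
    intro h0
    exact h (by rw [sub_eq_zero.1 h0])
  have e : ∀ x, ⟪mode k θ a x, mode l η b x⟫
      = (1 / 2 * Real.cos (⟪wave (k + l), x⟫ + (θ + η))
          + 1 / 2 * Real.cos (⟪wave (k - l), x⟫ + (θ - η))) * ⟪a, b⟫ := by
    intro x
    have h1 := congrFun (cos_smul_mode k l θ η b) x
    have h2 : ⟪mode k θ a x, mode l η b x⟫
        = ⟪a, Real.cos (⟪wave k, x⟫ + θ) • mode l η b x⟫ := by
      rw [inner_smul_right]
      simp [mode, inner_smul_left]
    rw [h2, h1]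
    simp [mode, inner_add_right, inner_smul_right]
    ring
  simp_rw [e]
  rw [integral_mul_const, integral_add, integral_const_mul, integral_const_mul,
    integral_cos_eq_zero hp, integral_cos_eq_zero hm]
  · simp
  · exact integrable_cell (by fun_prop)
  · exact integrable_cell (by fun_prop)

theorem shell_orth {m n : ℕ} (h : m ≠ n) {u v : TrigPoly} (hu : u ∈ shell m) (hv : v ∈ shell n) :
    ⟪trigToL2 u, trigToL2 v⟫ = 0 := by
  induction hu using Submodule.span_induction with
  | mem x hx =>
    obtain ⟨k, θ, a, hk, rfl⟩ := hx
    induction hv using Submodule.span_induction with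
    | mem y hy =>
      obtain ⟨l, η, b, hl, rfl⟩ := hy
      rw [inner_trigToL2]
      exact mode_orth (by rw [hk, hl]; exact_mod_cast h) θ η a b
    | zero => simp
    | add x y _ _ h1 h2 => rw [map_add, inner_add_right, h1, h2, add_zero]
    | smul c x _ h => rw [map_smul, inner_smul_right, h, mul_zero]
  | zero => simp
  | add x y _ _ h1 h2 => rw [map_add, inner_add_left, h1, h2, add_zero]
  | smul c x _ h => rw [map_smul, inner_smul_left, h, mul_zero]

/-- The orthogonal projection `R n` of `L²(Ω)³` onto the eigenspace of the Stokes operator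
for `n`; its values are regarded as elements of the eigenspace in `𝒱`. -/
def R (n : ℕ) : L2 →ₗ[ℝ] eig n :=
  (Submodule.equivMapOfInjective toL2 toL2_injective (eig n)).symm.toLinearMap ∘ₗ
    ((eig n).map toL2).orthogonalProjectionOnto.toLinearMap

theorem toL2_R (n : ℕ) (f : L2) : toL2 (R n f) = ((eig n).map toL2).starProjection f := by
  have := (Submodule.equivMapOfInjective toL2 toL2_injective (eig n)).apply_symm_apply
    (((eig n).map toL2).orthogonalProjectionOnto f)
  exact congrArg Subtype.val this

theorem R_of_ne {m n : ℕ} (h : m ≠ n) {v : VV} (hv : v ∈ eig m) : R n (toL2 v) = 0 := by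
  apply Subtype.ext
  apply toL2_injective
  rw [toL2_R]
  simp only [ZeroMemClass.coe_zero, map_zero]
  refine Submodule.eq_starProjection_of_mem_orthogonal (zero_mem _) ?_
  rw [sub_zero, Submodule.mem_orthogonal']
  rintro _ ⟨w, hw, rfl⟩
  exact shell_orth h (eig_shell hv) (eig_shell hw)

theorem R_finite (v : VV) : {n | R n (toL2 v) ≠ 0}.Finite := by
  have hv : v ∈ ⨆ n, eig n := by rw [iSup_eig]; trivial
  induction hv using Submodule.iSup_induction' with
  | mem m x hx =>
    refine (Set.finite_singleton m).subset fun n hn => ?_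
    by_contra hne
    exact hn (R_of_ne (fun h => hne h.symm) hx)
  | zero => simp
  | add x y _ _ h1 h2 =>
    refine (h1.union h2).subset fun n hn => ?_
    by_contra hne
    simp only [Set.mem_union, Set.mem_ofPred_eq, not_or, not_not] at hne
    exact hn (by rw [map_add, map_add, hne.1, hne.2, add_zero])

/-- `A^α u = ∑ n^α R_n u`. -/
def powA (α : ℝ) (u : L2) : L2 := ∑' n : ℕ, (n : ℝ) ^ α • toL2 (R n u)

/-- The domain of `A^α` in `H`: the series `∑ n^α R_n u` converges. -/
def domA (α : ℝ) : Submodule ℝ L2 where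
  carrier := {u | u ∈ H ∧ Summable fun n : ℕ => (n : ℝ) ^ α • toL2 (R n u)}
  add_mem' := by
    rintro u v ⟨hu, hu'⟩ ⟨hv, hv'⟩
    refine ⟨add_mem hu hv, ?_⟩
    simpa using hu'.add hv'
  zero_mem' := ⟨zero_mem _, by simp⟩
  smul_mem' := by
    rintro c u ⟨hu, hu'⟩
    refine ⟨Submodule.smul_mem _ c hu, ?_⟩
    simpa [smul_comm c] using hu'.const_smul c

/-- The space `D(A^α)`, to be normed by `|A^α u|` (and not as a subspace of `L²`). -/
def Dom (α : ℝ) : Type := domA α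

instance (α : ℝ) : AddCommGroup (Dom α) := inferInstanceAs (AddCommGroup (domA α))

instance (α : ℝ) : Module ℝ (Dom α) := inferInstanceAs (Module ℝ (domA α))

/-- The inclusion of `D(A^α)` in `L²(Ω)³`. -/
def Dom.val {α : ℝ} : Dom α →ₗ[ℝ] L2 := (domA α).subtype

/-- `A^α` as a linear map on its domain. -/
def Dom.pow (α : ℝ) : Dom α →ₗ[ℝ] L2 where
  toFun u := powA α u.val
  map_add' u v := by
    simp only [powA, map_add, Submodule.coe_add, smul_add]
    exact u.2.2.tsum_add v.2.2
  map_smul' c u := by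
    simp only [powA, map_smul, Submodule.coe_smul, RingHom.id_apply, smul_comm _ c]
    exact u.2.2.tsum_const_smul c

theorem inner_R {n : ℕ} (f : L2) {w : VV} (hw : w ∈ eig n) :
    ⟪toL2 (R n f), toL2 w⟫ = ⟪f, toL2 w⟫ := by
  rw [toL2_R]
  have h := Submodule.sub_starProjection_mem_orthogonal (K := (eig n).map toL2) f
  have := (Submodule.mem_orthogonal' _ _).1 h (toL2 w) ⟨w, hw, rfl⟩
  rw [inner_sub_left, sub_eq_zero] at this
  exact this.symm

theorem Dom.pow_injective (α : ℝ) : Function.Injective (Dom.pow α) := by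
  rw [← LinearMap.ker_eq_bot, LinearMap.ker_eq_bot']
  rintro ⟨u, huH, hus⟩ hu
  change powA α u = 0 at hu
  have hR : ∀ (n : ℕ) (w : VV), w ∈ eig n → ⟪u, toL2 w⟫ = 0 := by
    intro n w hw
    rcases Nat.eq_zero_or_pos n with rfl | hn
    · rw [eig_zero hw, map_zero, inner_zero_right]
    · have h1 : ⟪powA α u, toL2 w⟫ = (n : ℝ) ^ α * ⟪u, toL2 w⟫ := by
        have h2 := hus.hasSum.mapL (innerSL ℝ (toL2 w))
        have h3 := h2.unique (hasSum_single n fun m hm => by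
          simp only [innerSL_apply_apply, inner_smul_right]
          rw [show ⟪toL2 w, toL2 (R m u)⟫ = 0 from
            shell_orth (fun h => hm h.symm) (eig_shell hw) (eig_shell (R m u).2), mul_zero])
        rw [innerSL_apply_apply, innerSL_apply_apply, inner_smul_right,
          real_inner_comm (toL2 (R n u)) (toL2 w), inner_R u hw] at h3
        rw [real_inner_comm]
        exact h3
      rw [hu, inner_zero_left] at h1
      have hpos : (n : ℝ) ^ α ≠ 0 := (Real.rpow_pos_of_pos (by exact_mod_cast hn) α).ne'
      exact (mul_eq_zero.1 h1.symm).resolve_left hpos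
  have horth : u ∈ Hᗮ := orth_H fun v => by
    have hv : v ∈ ⨆ n, eig n := by rw [iSup_eig]; trivial
    induction hv using Submodule.iSup_induction' with
    | mem m x hx => exact hR m x hx
    | zero => simp
    | add x y _ _ h1 h2 => rw [map_add, inner_add_right, h1, h2, add_zero]
  have h0 : u = 0 := by
    have := (Submodule.mem_orthogonal _ _).1 horth u huH
    exact inner_self_eq_zero.1 this
  exact Subtype.ext h0

/-- The norm of `D(A^α)` is `|A^α u|`. -/
instance (α : ℝ) : NormedAddCommGroup (Dom α) :=
  NormedAddCommGroup.induced (Dom α) L2 (Dom.pow α) (Dom.pow_injective α)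

instance (α : ℝ) : NormedSpace ℝ (Dom α) := NormedSpace.induced ℝ (Dom α) L2 (Dom.pow α)

theorem toL2_mem_domA (α : ℝ) (v : VV) : toL2 v ∈ domA α := by
  refine ⟨toL2_mem v, summable_of_hasFiniteSupport ((R_finite v).subset fun n hn h => hn ?_)⟩
  simp [h]

/-- An element of `𝒱` as an element of `D(A^α)`. -/
def toDom (α : ℝ) (v : VV) : Dom α := ⟨toL2 v, toL2_mem_domA α v⟩

/-- The gradient of an element of `𝒱`, in `L²`. -/
def gradL2 : VV →ₗ[ℝ] Lp (E3 →L[ℝ] E3) 2 (volume.restrict cell) where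
  toFun v := (memLp_cell (trigPoly_fderiv_continuous v.2.1) 2).toLp (fderiv ℝ v.1)
  map_add' u v := by
    rw [← MemLp.toLp_add]
    congr 1
    funext x
    exact fderiv_add (trigPoly_differentiable u.2.1 x) (trigPoly_differentiable v.2.1 x)
  map_smul' c u := by
    rw [RingHom.id_apply, ← MemLp.toLp_const_smul]
    congr 1
    funext x
    exact fderiv_const_smul (trigPoly_differentiable u.2.1 x) c

/-- The space `V`, the closure of `𝒱` in `H¹(Ω)³`: `H¹(Ω)³` is identified with the set of pairs
`(u, ∇u)` in `L² × L²`, and `u` is the first component. -/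
def V : Submodule ℝ L2 :=
  (LinearMap.range (toL2.prod gradL2)).topologicalClosure.map (LinearMap.fst ℝ L2 _)

/-- `C^∞(ℝ³, ℝ³) ∩ V`, a smooth function being `2π`-periodic here. -/
def eInf : Submodule ℝ L2 where
  carrier := {u | u ∈ V ∧ ∃ f : E3 → E3, ContDiff ℝ ∞ f ∧ IsPeriodic f ∧
    u =ᵐ[volume.restrict cell] f}
  add_mem' := by
    rintro u v ⟨hu, f, hf, hfp, hfu⟩ ⟨hv, g, hg, hgp, hgv⟩
    refine ⟨add_mem hu hv, f + g, hf.add hg, fun x i => ?_, ?_⟩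
    · simp [hfp x i, hgp x i]
    · exact (Lp.coeFn_add u v).trans (hfu.add hgv)
  zero_mem' := ⟨zero_mem _, 0, contDiff_const, fun _ _ => rfl, Lp.coeFn_zero _ _ _⟩
  smul_mem' := by
    rintro c u ⟨hu, f, hf, hfp, hfu⟩
    refine ⟨Submodule.smul_mem _ c hu, c • f, contDiff_const.smul hf, fun x i => ?_, ?_⟩
    · simp [hfp x i]
    · exact (Lp.coeFn_smul c u).trans (hfu.const_smul c)

/-- The space `E^∞`. -/
def EInf : Type := eInf

instance : AddCommGroup EInf := inferInstanceAs (AddCommGroup eInf)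

instance : Module ℝ EInf := inferInstanceAs (Module ℝ eInf)

/-- The inclusion of `E^∞` in `L²(Ω)³`. -/
def EInf.val : EInf →ₗ[ℝ] L2 := eInf.subtype

/-- The topology of `E^∞` is generated by the norms `|A^α u|`, `α ≥ 0`. -/
instance : TopologicalSpace EInf :=
  ⨅ α : {α : ℝ // 0 ≤ α}, TopologicalSpace.induced (fun u : EInf => powA α u.val) inferInstance

theorem toL2_mem_eInf (v : VV) : toL2 v ∈ eInf :=
  ⟨⟨(toL2 v, gradL2 v), Submodule.le_topologicalClosure _ ⟨v, rfl⟩, rfl⟩, v.1,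
    trigPoly_contDiff v.2.1, trigPoly_periodic v.2.1,
    (memLp_cell (trigPoly_continuous v.2.1) 2).coeFn_toLp⟩

/-- An element of `𝒱` as an element of `E^∞`. -/
def toEInf (v : VV) : EInf := ⟨toL2 v, toL2_mem_eInf v⟩

/-- The space `S_A = R_1 H ⊕ R_2 H ⊕ ...` of all sequences of eigenvectors. The component of index
`0` is in the zero space. -/
abbrev SA := ∀ j : ℕ, eig j

/-- The element `(R_j ξ)_j` of `S_A`. -/
def comps (ξ : L2) : SA := fun j => R j ξ

/-- Polynomials in `t` with coefficients in `𝒱`; `p n` is the coefficient of `t ^ n`. -/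
abbrev TPoly := ℕ →₀ VV

/-- The value at `t`. -/
def evalT (t : ℝ) (p : TPoly) : VV := p.sum fun n c => t ^ n • c

/-- The derivative with respect to `t`. -/
def derivT (p : TPoly) : TPoly := p.sum fun n c => Finsupp.single (n - 1) ((n : ℝ) • c)

/-- The primitive `∫_0^t`. -/
def integT (p : TPoly) : TPoly := p.sum fun n c => Finsupp.single (n + 1) (((n : ℝ) + 1)⁻¹ • c)

/-- A map applied to all coefficients. -/
def mapT (F : VV → VV) (p : TPoly) : TPoly := p.sum fun n c => Finsupp.single n (F c)

/-- The polynomial `t ↦ B (p t, q t)`. -/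
def bilT (p q : TPoly) : TPoly :=
  p.sum fun m u => q.sum fun n v => Finsupp.single (m + n) (bil u v)

/-- The degree in `t`. -/
def degT (p : TPoly) : ℕ := p.support.sup id

/-- `(A - j)^{-n-1} (I - R_j)` on `𝒱`. The sum is finite. -/
def resolv (j n : ℕ) (u : VV) : VV :=
  ∑ᶠ (m : ℕ) (_ : m ≠ j), (((m : ℝ) - j) ^ (n + 1))⁻¹ • (R m (toL2 u) : VV)

/-- The polynomials `q_j (t, ξ)`:
`q_j = ξ_j - ∫_0^t R_j β_j + ∑_n (-1)^{n+1} (A - j)^{-n-1} (d/dt)^n (I - R_j) β_j` with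
`β_j = ∑_{k + l = j, k, l ≥ 1} B (q_k, q_l)`. -/
def q (ξ : SA) (j : ℕ) : TPoly :=
  let β : TPoly := ∑ k : Finset.Ioo 0 j, bilT (q ξ k) (q ξ (j - k))
  Finsupp.single 0 (ξ j : VV) - integT (mapT (fun u => R j (toL2 u)) β)
    + ∑ n ∈ Finset.range (degT β + 1), (-1 : ℝ) ^ (n + 1) • mapT (resolv j n) (derivT^[n] β)
termination_by j
decreasing_by
  all_goals
    have := Finset.mem_Ioo.1 k.2
    omega

/-- `P_j (ξ) = q_j (0, ξ)`. -/
def Pj (j : ℕ) (ξ : SA) : VV := evalT 0 (q ξ j)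

/-- `B_j (ξ) = ∑_{k + l = j, k, l ≥ 1} R_j B (P_k (ξ), P_l (ξ))`. -/
def Bj (j : ℕ) (ξ : SA) : VV :=
  ∑ k ∈ Finset.Ioo 0 j, R j (toL2 (bil (Pj k ξ) (Pj (j - k) ξ)))

open Classical in
/-- The homogeneous part of degree `d` of a polynomial map `F`, at `ξ`: the coefficient of `s ^ d`
in the polynomial `s ↦ F (s ξ)`. -/
def homPart {X Y : Type*} [AddCommGroup X] [Module ℝ X] [AddCommGroup Y] [Module ℝ Y]
    (F : X → Y) (d : ℕ) (ξ : X) : Y :=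
  if h : ∃ p : ℕ →₀ Y, ∀ s : ℝ, F (s • ξ) = p.sum fun n c => s ^ n • c then h.choose d else 0

/-- `P_j^{[d]}`. -/
def Pjd (d j : ℕ) (ξ : L2) : VV := homPart (Pj j) d (comps ξ)

/-- `B_j^{[d]}`. -/
def Bjd (d j : ℕ) (ξ : L2) : VV := homPart (Bj j) d (comps ξ)

/-- `P^{[d]} (ξ) = ∑_{j ≥ d} P_j^{[d]} (ξ)`. -/
def Pd (d : ℕ) (ξ : L2) : L2 := ∑' j : Set.Ici d, toL2 (Pjd d j ξ)

/-- `B^{[d]} (ξ) = ∑_{j ≥ 1} B_j^{[d]} (ξ)`. -/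
def Bd (d : ℕ) (ξ : L2) : L2 := ∑' j : Set.Ici 1, toL2 (Bjd d j ξ)

/-- Continuous homogeneous polynomials of degree `d`: restrictions to the diagonal of continuous
`d`-linear maps. -/
def IsContHomPoly {X Y : Type*} [AddCommGroup X] [Module ℝ X] [TopologicalSpace X]
    [AddCommGroup Y] [Module ℝ Y] [TopologicalSpace Y] (d : ℕ) (F : X → Y) : Prop :=
  ∃ Q : ContinuousMultilinearMap ℝ (fun _ : Fin d => X) Y, ∀ ξ, F ξ = Q fun _ => ξ

end NSE

end

noncomputable section

namespace NSE

/-! ### Linear maps on `𝒱` and on polynomials in `t` -/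

/-! The recursion is solved degree by degree in ξ. The part of degree d of q_j is the diagonal of a
d-linear form `homT d j`: it is ξ_j for d = 1, and for d ≥ 2 it is the linear operator `solveT j`
applied to the sum of all products of a form of degree a with one of degree d - a. Taking t = 0
gives `polP`; taking t = 0 in the products and applying R_j gives `polB`. Uniqueness of polynomial
coefficients (`homPart_eq`) identifies their diagonals with P_j^{[d]} and B_j^{[d]}.

Every estimate is made in one kind of norm, a weighted absolute sum of Fourier amplitudes: the
monomial t^m cos(k·x + θ) a with k ≠ 0 has weight m! s^m |k|^r |a|. Three facts carry the proof. (1)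
`bilTL_mem_majorants`: the bilinear form maps exponents (r + 1, 2s) to (r, s). One power of |k| pays
for the derivative, the doubling of s pays for (m + n)!/(m! n!), and |k ± l| ≤ 2|k||l| holds because
nonzero frequencies have length at least 1. (2) `solveT_mem_majorants`: `solveT j` is bounded for s
≥ 2, uniformly in j. Distinct eigenvalues are distinct integers, so there are no small divisors, and
the weight m! s^m makes the series of t-derivatives geometric. (3) `sum_conv_le`: the sums over k +
l = j are convolutions, so a sum over j is at most a product of sums. A form of degree d involves d
- 1 products. Hence the sum over j of the weights at exponent r is at most a constant times the
product, over the d arguments, of the sums over n of the weights of R_n ξ at exponent r + d - 1.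

To return to the norms of D(A^α), take r = 2α. Since there are O(n) frequencies with |k|² = n, the
weight of R_n ξ is O(n^{1 + (2α + d - 1)/2} |R_n ξ|), while |R_n ξ| ≤ n^{-α - 3d/2} |A^{α + 3d/2}
ξ|. What remains is the sum of n^{1/2 - d}, finite for d ≥ 2; degree one is estimated directly.
Completeness of D(A^α) (`exists_hasSum_toDom`) then produces the limits.

For E^∞, Green's identity gives rapid decay of R_n ξ, so all the weighted sums are finite. The
series therefore converges together with all its derivatives, its sum is again in E^∞, and
continuity follows from the maps D(A^{α + 3d/2}) → D(A^α), because E^∞ carries the initial topology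
of its inclusions in the spaces D(A^α). -/

theorem adv_add_left (u u' v : E3 → E3) : adv (u + u') v = adv u v + adv u' v := by
  funext x
  simp [adv]

theorem adv_smul_left (c : ℝ) (u v : E3 → E3) : adv (c • u) v = c • adv u v := by
  funext x
  simp [adv]

theorem adv_add_right (u : E3 → E3) {v v' : E3 → E3} (hv : Differentiable ℝ v)
    (hv' : Differentiable ℝ v') : adv u (v + v') = adv u v + adv u v' := by
  funext x
  simp [adv, fderiv_add (hv x) (hv' x)]

theorem adv_smul_right (c : ℝ) (u : E3 → E3) {v : E3 → E3} (hv : Differentiable ℝ v) :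
    adv u (c • v) = c • adv u v := by
  funext x
  simp [adv, fderiv_const_smul (hv x)]

/-- The bilinear form `B` as a bilinear map. -/
def bilL : VV →ₗ[ℝ] VV →ₗ[ℝ] VV :=
  LinearMap.mk₂ ℝ bil
    (fun u u' v => by
      simp only [bil]
      rw [← map_add]
      congr 1
      exact Subtype.ext (adv_add_left u u' v))
    (fun c u v => by
      simp only [bil]
      rw [← map_smul]
      congr 1
      exact Subtype.ext (adv_smul_left c u v))
    (fun u v v' => by
      simp only [bil]
      rw [← map_add]
      congr 1
      exact Subtype.ext (adv_add_right u (trigPoly_differentiable v.2.1)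
        (trigPoly_differentiable v'.2.1)))
    (fun c u v => by
      simp only [bil]
      rw [← map_smul]
      congr 1
      exact Subtype.ext (adv_smul_right c u (trigPoly_differentiable v.2.1)))

theorem bilL_apply (u v : VV) : bilL u v = bil u v := rfl

/-- The eigenprojection `R_j` as an endomorphism of `𝒱`. -/
def projV (j : ℕ) : VV →ₗ[ℝ] VV := (eig j).subtype ∘ₗ R j ∘ₗ toL2

theorem projV_apply (j : ℕ) (u : VV) : projV j u = R j (toL2 u) := rfl

/-- Absorbing the excluded index into a zero coefficient leaves a single finite-support sum, whose
additivity is available at once. -/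
theorem resolv_eq (j n : ℕ) (u : VV) :
    resolv j n u = ∑ᶠ m : ℕ, (if m = j then 0 else (((m : ℝ) - j) ^ (n + 1))⁻¹) • projV m u := by
  unfold resolv
  refine finsum_congr fun m => ?_
  by_cases h : m = j
  · simp [h]
  · simp [h, projV_apply]

/-- The operator `(A - j)^{-n-1} (I - R_j)` as an endomorphism of `𝒱`. -/
def resolvL (j n : ℕ) : VV →ₗ[ℝ] VV where
  toFun := resolv j n
  map_add' u v := by
    simp only [resolv_eq, map_add, smul_add]
    refine finsum_add_distrib ((R_finite u).subset fun m hm h => hm ?_)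
      ((R_finite v).subset fun m hm h => hm ?_) <;> simp [projV_apply, h]
  map_smul' c u := by
    simp only [resolv_eq, map_smul, RingHom.id_apply]
    rw [smul_finsum]
    exact finsum_congr fun m => smul_comm _ _ _

theorem resolvL_apply (j n : ℕ) (u : VV) : resolvL j n u = resolv j n u := rfl

theorem projV_of_mem {m : ℕ} {v : VV} (hv : v ∈ eig m) (n : ℕ) :
    projV n v = if n = m then v else 0 := by
  split_ifs with h
  · subst h
    apply toL2_injective
    rw [projV_apply, toL2_R]
    exact Submodule.starProjection_eq_self_iff.2 ⟨v, hv, rfl⟩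
  · rw [projV_apply, R_of_ne (fun h' => h h'.symm) hv]
    rfl

theorem resolvL_of_mem {m : ℕ} {v : VV} (hv : v ∈ eig m) (j n : ℕ) :
    resolvL j n v = (if m = j then 0 else (((m : ℝ) - j) ^ (n + 1))⁻¹) • v := by
  rw [resolvL_apply, resolv_eq, finsum_eq_single _ m]
  · rw [projV_of_mem hv, if_pos rfl]
  · intro k hk
    rw [projV_of_mem hv, if_neg hk, smul_zero]

/-- The bilinear form on polynomials in `t` as a bilinear map. -/
def bilTL : TPoly →ₗ[ℝ] TPoly →ₗ[ℝ] TPoly :=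
  Finsupp.lsum ℝ fun m => LinearMap.flip <| Finsupp.lsum ℝ fun n =>
    (LinearMap.compr₂ bilL (Finsupp.lsingle (m + n))).flip

theorem bilTL_single (m n : ℕ) (u v : VV) :
    bilTL (Finsupp.single m u) (Finsupp.single n v) = Finsupp.single (m + n) (bil u v) := by
  simp [bilTL, bilL_apply]

theorem bilTL_apply (p r : TPoly) : bilTL p r = bilT p r := by
  conv_lhs => rw [← Finsupp.sum_single p, ← Finsupp.sum_single r]
  simp only [Finsupp.sum, map_sum, LinearMap.sum_apply, bilTL_single, bilT]
  rw [Finset.sum_comm]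

/-- Evaluation at `t = 0`. -/
def evalZ : TPoly →ₗ[ℝ] VV := Finsupp.lapply 0

theorem evalZ_apply (p : TPoly) : evalZ p = p 0 := rfl

theorem evalT_zero (p : TPoly) : evalT 0 p = evalZ p := by
  rw [evalT, evalZ_apply, Finsupp.sum, Finset.sum_eq_single 0]
  · simp
  · intro b _ hb
    simp [hb]
  · intro h
    simpa using h

theorem evalZ_bilTL (p r : TPoly) : evalZ (bilTL p r) = bil (evalZ p) (evalZ r) := by
  conv_lhs => rw [← Finsupp.sum_single p, ← Finsupp.sum_single r]
  simp only [Finsupp.sum, map_sum, LinearMap.sum_apply, bilTL_single, evalZ_apply]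
  rw [Finset.sum_eq_single 0, Finset.sum_eq_single 0]
  · simp
  · intro b _ hb
    simp [hb]
  · intro h
    rw [Finsupp.notMem_support_iff.1 h, ← bilL_apply]
    simp
  · intro b _ hb
    exact Finset.sum_eq_zero fun n _ => by simp [hb]
  · intro h
    refine Finset.sum_eq_zero fun n _ => ?_
    rw [Finsupp.notMem_support_iff.1 h, ← bilL_apply]
    simp

/-- The operator solving `q' + (A - j) q + β = 0` for `β` a polynomial in `t`, with zero `R_j`
component at `t = 0`. -/
def solveT (j : ℕ) : TPoly →ₗ[ℝ] TPoly :=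
  Finsupp.lsum ℝ fun m =>
    -(((m : ℝ) + 1)⁻¹ • Finsupp.lsingle (m + 1) ∘ₗ projV j) +
      ∑ n ∈ Finset.range (m + 1),
        ((-1 : ℝ) ^ (n + 1) * m.descFactorial n) • Finsupp.lsingle (m - n) ∘ₗ resolvL j n

theorem solveT_single (j m : ℕ) (u : VV) :
    solveT j (Finsupp.single m u) = -(((m : ℝ) + 1)⁻¹ • Finsupp.single (m + 1) (projV j u)) +
      ∑ n ∈ Finset.range (m + 1),
        ((-1 : ℝ) ^ (n + 1) * m.descFactorial n) • Finsupp.single (m - n) (resolvL j n u) := by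
  simp [solveT, LinearMap.sum_apply]

/-- The derivative with respect to `t` as a linear map. -/
def derivTL : TPoly →ₗ[ℝ] TPoly :=
  Finsupp.lsum ℝ fun n => (n : ℝ) • Finsupp.lsingle (n - 1)

theorem derivTL_apply (p : TPoly) : derivTL p = derivT p := by
  rw [derivTL, Finsupp.lsum_apply, derivT]
  exact Finsupp.sum_congr fun n _ => by simp

theorem derivTL_single (m : ℕ) (u : VV) :
    derivTL (Finsupp.single m u) = (m : ℝ) • Finsupp.single (m - 1) u := by
  simp [derivTL]

theorem derivTL_iterate_single (n m : ℕ) (u : VV) :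
    derivTL^[n] (Finsupp.single m u) = (m.descFactorial n : ℝ) • Finsupp.single (m - n) u := by
  induction n with
  | zero => simp
  | succ n ih =>
    rw [Function.iterate_succ_apply', ih, map_smul, derivTL_single, smul_smul,
      Nat.descFactorial_succ, Nat.sub_sub]
    push_cast
    rw [mul_comm]

theorem mapT_eq (F : VV →ₗ[ℝ] VV) (p : TPoly) : mapT F p = Finsupp.mapRange.linearMap F p := by
  conv_rhs => rw [← Finsupp.sum_single p]
  simp [mapT, Finsupp.sum, map_sum]

/-- The primitive with respect to `t` as a linear map. -/
def integTL : TPoly →ₗ[ℝ] TPoly :=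
  Finsupp.lsum ℝ fun n => ((n : ℝ) + 1)⁻¹ • Finsupp.lsingle (n + 1)

theorem integT_eq (p : TPoly) : integT p = integTL p := by
  rw [integT, integTL, Finsupp.lsum_apply]
  exact Finsupp.sum_congr fun n _ => by simp

/-- The recursion cuts the sum over n at the degree of β, a cut that is not linear in β. Cutting at
m on each monomial t^m instead gives a linear operator with the same value, because derivatives of
order n > m kill t^m. -/
theorem solveT_apply (j : ℕ) (p : TPoly) :
    solveT j p = -integT (mapT (fun u => R j (toL2 u)) p)
      + ∑ n ∈ Finset.range (degT p + 1), (-1 : ℝ) ^ (n + 1) • mapT (resolv j n) (derivT^[n] p) := by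
  have hR : mapT (fun u => R j (toL2 u)) p = mapT (projV j) p := rfl
  have hS : ∀ n r, mapT (resolv j n) r = mapT (resolvL j n) r := fun _ _ => rfl
  have hD : derivT = derivTL := by funext r; rw [derivTL_apply]
  simp_rw [hR, hS, hD, mapT_eq, integT_eq, ← Module.End.pow_apply]
  have key : ∀ m ∈ p.support, solveT j (Finsupp.single m (p m)) =
      -(integTL (Finsupp.mapRange.linearMap (projV j) (Finsupp.single m (p m)))) +
      ∑ n ∈ Finset.range (degT p + 1), (-1 : ℝ) ^ (n + 1) •
        Finsupp.mapRange.linearMap (resolvL j n) ((derivTL ^ n) (Finsupp.single m (p m))) := by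
    intro m hm
    have hdeg : m ≤ degT p := Finset.le_sup (f := id) hm
    rw [solveT_single]
    congr 1
    · simp [integTL]
    · refine Finset.sum_subset_zero_on_sdiff (Finset.range_mono (by omega)) ?_ ?_
      · intro n hn
        simp only [Finset.mem_sdiff, Finset.mem_range, not_lt] at hn
        rw [Module.End.pow_apply, derivTL_iterate_single,
          Nat.descFactorial_eq_zero_iff_lt.2 (by omega)]
        simp
      · intro n _
        rw [Module.End.pow_apply, derivTL_iterate_single, map_smul, smul_smul]
        simp
  have h := Finset.sum_congr rfl key
  rw [← map_sum, Finset.sum_add_distrib, Finset.sum_comm, Finset.sum_neg_distrib] at h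
  simp_rw [← Finset.smul_sum, ← map_sum] at h
  have hp : ∑ m ∈ p.support, Finsupp.single m (p m) = p := Finsupp.sum_single p
  rwa [hp] at h

theorem q_eq (ξ : SA) (j : ℕ) :
    q ξ j = Finsupp.single 0 (ξ j : VV)
      + solveT j (∑ k ∈ Finset.Ioo 0 j, bilTL (q ξ k) (q ξ (j - k))) := by
  have h : ∑ k ∈ Finset.Ioo 0 j, bilTL (q ξ k) (q ξ (j - k))
      = ∑ k : Finset.Ioo 0 j, bilT (q ξ k) (q ξ (j - k)) := by
    rw [← Finset.sum_coe_sort]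
    simp only [bilTL_apply]
  rw [h, solveT_apply, q]
  abel

/-! ### Homogeneous parts as multilinear maps -/

/-- Reindexing by (a, b) = (a, d - a). It serves twice: for the splitting of degrees and for the
convolution over eigenvalues. -/
theorem sum_range_sum_Ioo {M : Type*} [AddCommMonoid M] (f : ℕ → ℕ → M) (N : ℕ) :
    ∑ d ∈ Finset.range (N + 1), ∑ a ∈ Finset.Ioo 0 d, f a (d - a)
      = ∑ a ∈ Finset.range (N + 1), ∑ b ∈ Finset.range (N + 1),
        if 0 < a ∧ 0 < b ∧ a + b ≤ N then f a b else 0 := by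
  rw [← Finset.sum_product', ← Finset.sum_filter, Finset.sum_sigma']
  refine Finset.sum_bij' (fun p _ => (p.2, p.1 - p.2)) (fun p _ => ⟨p.1 + p.2, p.1⟩) ?_ ?_ ?_ ?_ ?_
  · rintro ⟨d, a⟩ h
    simp at h ⊢
    omega
  · rintro ⟨a, b⟩ h
    simp at h ⊢
    omega
  · rintro ⟨d, a⟩ h
    simp at h
    have : a + (d - a) = d := by omega
    simp [this]
  · rintro ⟨a, b⟩ h
    simp
  · rintro ⟨d, a⟩ h
    rfl

/-- The `d`-linear form whose restriction to the diagonal is the homogeneous part of degree `d` of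
`q_j`. Only the first `d` entries of `x` matter. -/
def homT (d j : ℕ) (x : ℕ → SA) : TPoly :=
  (if d = 1 then Finsupp.single 0 (x 0 j : VV) else 0) +
    solveT j (∑ a : Finset.Ioo 0 d, ∑ k ∈ Finset.Ioo 0 j,
      bilTL (homT a k x) (homT (d - a) (j - k) fun i => x (i + a)))
termination_by d
decreasing_by
  all_goals
    have := Finset.mem_Ioo.1 a.2
    omega

/-- The `d`-linear form whose restriction to the diagonal is the homogeneous part of degree `d` of
`β_j`. -/
def betaT (d j : ℕ) (x : ℕ → SA) : TPoly :=
  ∑ a ∈ Finset.Ioo 0 d, ∑ k ∈ Finset.Ioo 0 j,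
    bilTL (homT a k x) (homT (d - a) (j - k) fun i => x (i + a))

theorem homT_eq (d j : ℕ) (x : ℕ → SA) :
    homT d j x = (if d = 1 then Finsupp.single 0 (x 0 j : VV) else 0) + solveT j (betaT d j x) := by
  rw [homT, betaT, ← Finset.sum_coe_sort (Finset.Ioo 0 d)]

theorem homT_zero (j : ℕ) (x : ℕ → SA) : homT 0 j x = 0 := by
  rw [homT_eq, betaT]
  simp

theorem homT_one (j : ℕ) (x : ℕ → SA) : homT 1 j x = Finsupp.single 0 (x 0 j : VV) := by
  have h : Finset.Ioo 0 1 = ∅ := rfl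
  rw [homT_eq, betaT, h]
  simp

theorem homT_congr (d j : ℕ) {x y : ℕ → SA} (h : ∀ i < d, x i = y i) :
    homT d j x = homT d j y := by
  induction d using Nat.strong_induction_on generalizing j x y with
  | _ d ih =>
    have hb : betaT d j x = betaT d j y := by
      refine Finset.sum_congr rfl fun a ha => Finset.sum_congr rfl fun k _ => ?_
      rw [Finset.mem_Ioo] at ha
      rw [ih a ha.2 k fun i hi => h i (by omega),
        ih (d - a) (by omega) (j - k) fun i hi => h (i + a) (by omega)]
    rw [homT_eq, homT_eq, hb]
    split_ifs with hd
    · rw [h 0 (by omega)]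
    · rfl

theorem betaT_congr (d j : ℕ) {x y : ℕ → SA} (h : ∀ i < d, x i = y i) :
    betaT d j x = betaT d j y := by
  refine Finset.sum_congr rfl fun a ha => Finset.sum_congr rfl fun k _ => ?_
  rw [Finset.mem_Ioo] at ha
  rw [homT_congr a k fun i hi => h i (by omega),
    homT_congr (d - a) (j - k) fun i hi => h (i + a) (by omega)]

/-- If a + b = d > j = k + l, then k < a or l < b, so one factor of every product vanishes by
induction. The linear term can only occur with j = 0, where the eigenspace is trivial. -/
theorem homT_of_lt {d j : ℕ} (h : j < d) (x : ℕ → SA) : homT d j x = 0 := by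
  induction d using Nat.strong_induction_on generalizing j x with
  | _ d ih =>
    rw [homT_eq]
    have hb : betaT d j x = 0 := by
      refine Finset.sum_eq_zero fun a ha => Finset.sum_eq_zero fun k hk => ?_
      rw [Finset.mem_Ioo] at ha hk
      rcases lt_or_ge k a with hka | hka
      · rw [ih a ha.2 hka, map_zero, LinearMap.zero_apply]
      · rw [ih (d - a) (by omega) (j := j - k) (by omega), map_zero]
    rw [hb, map_zero, add_zero]
    split_ifs with hd
    · have : j = 0 := by omega
      subst this
      rw [eig_zero (x 0 0).2, Finsupp.single_zero]
    · rfl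

theorem betaT_of_lt {d j : ℕ} (h : j < d) (x : ℕ → SA) : betaT d j x = 0 := by
  refine Finset.sum_eq_zero fun a ha => Finset.sum_eq_zero fun k hk => ?_
  rw [Finset.mem_Ioo] at ha hk
  rcases lt_or_ge k a with hka | hka
  · rw [homT_of_lt hka, map_zero, LinearMap.zero_apply]
  · rw [homT_of_lt (d := d - a) (j := j - k) (by omega), map_zero]

/-- The right-hand factor of a product sees the arguments shifted by a. A change in slot i reaches
it, in slot i - a, exactly when a ≤ i. -/
theorem shift_update (x : ℕ → SA) (i a : ℕ) (y : SA) :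
    (fun m => Function.update x i y (m + a))
      = if a ≤ i then Function.update (fun m => x (m + a)) (i - a) y else fun m => x (m + a) := by
  split_ifs with h
  · funext m
    by_cases hm : m = i - a
    · subst hm
      simp [Nat.sub_add_cancel h]
    · have : m + a ≠ i := by omega
      simp [hm, this]
  · funext m
    have : m + a ≠ i := by omega
    simp [this]

theorem homT_update_of_le {d i : ℕ} (h : d ≤ i) (j : ℕ) (x : ℕ → SA) (y : SA) :
    homT d j (Function.update x i y) = homT d j x :=
  homT_congr d j fun m hm => by simp [show m ≠ i by omega]

/-- The left factor reads the slots below a and the right factor those from a on, so slot i enters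
exactly one factor and bilinearity suffices. Linearity of the lower forms is a hypothesis because
the lemma is used inside the induction that proves it. -/
theorem betaT_update_of_homT {d : ℕ}
    (H : ∀ d' < d, ∀ (j i : ℕ), i < d' → ∀ (x : ℕ → SA) (y z : SA) (c : ℝ),
      homT d' j (Function.update x i (y + c • z))
        = homT d' j (Function.update x i y) + c • homT d' j (Function.update x i z))
    {i : ℕ} (hi : i < d) (j : ℕ) (x : ℕ → SA) (y z : SA) (c : ℝ) :
    betaT d j (Function.update x i (y + c • z))
      = betaT d j (Function.update x i y) + c • betaT d j (Function.update x i z) := by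
  simp only [betaT, Finset.smul_sum, ← Finset.sum_add_distrib]
  refine Finset.sum_congr rfl fun a ha => Finset.sum_congr rfl fun k _ => ?_
  rw [Finset.mem_Ioo] at ha
  simp only [shift_update]
  split_ifs with h
  · simp only [homT_update_of_le h]
    rw [H (d - a) (by omega) (j - k) (i - a) (by omega), map_add, map_smul]
  · rw [H a ha.2 k i (by omega), map_add, map_smul, LinearMap.add_apply, LinearMap.smul_apply]

theorem homT_update {d i : ℕ} (hi : i < d) (j : ℕ) (x : ℕ → SA) (y z : SA) (c : ℝ) :
    homT d j (Function.update x i (y + c • z))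
      = homT d j (Function.update x i y) + c • homT d j (Function.update x i z) := by
  induction d using Nat.strong_induction_on generalizing j i x y z c with
  | _ d ih =>
    rw [homT_eq, homT_eq, homT_eq,
      betaT_update_of_homT (fun d' hd' j i hi x y z c => ih d' hd' hi j x y z c) hi, map_add, map_smul]
    split_ifs with hd
    · obtain rfl : i = 0 := by omega
      simp only [Function.update_self, Pi.add_apply, Pi.smul_apply, Submodule.coe_add,
        Submodule.coe_smul, Finsupp.single_add, ← Finsupp.smul_single, smul_add]
      abel
    · simp

theorem betaT_update {d i : ℕ} (hi : i < d) (j : ℕ) (x : ℕ → SA) (y z : SA) (c : ℝ) :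
    betaT d j (Function.update x i (y + c • z))
      = betaT d j (Function.update x i y) + c • betaT d j (Function.update x i z) :=
  betaT_update_of_homT (fun _ _ j _ hi x y z c => homT_update hi j x y z c) hi j x y z c

/-- Extension by zero of a finite tuple. -/
def extend {d : ℕ} (x : Fin d → SA) : ℕ → SA := fun i => if h : i < d then x ⟨i, h⟩ else 0

theorem extend_update {d : ℕ} [DecidableEq (Fin d)] (x : Fin d → SA) (i : Fin d) (y : SA) :
    extend (Function.update x i y) = Function.update (extend x) i y := by
  funext m
  by_cases hm : m < d
  · by_cases h : (⟨m, hm⟩ : Fin d) = i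
    · have h' : m = i := congrArg Fin.val h
      simp [extend, h']
    · have h' : m ≠ i := fun e => h (Fin.ext e)
      simp [extend, h, h', hm]
  · have h' : m ≠ i := fun e => hm (e ▸ i.2)
    simp [extend, hm, h']

/-- A function of sequences which is linear in each of the first `d` entries, as a multilinear
map. -/
def slotMul (d : ℕ) (f : (ℕ → SA) → VV)
    (hf : ∀ i < d, ∀ (x : ℕ → SA) (y z : SA) (c : ℝ), f (Function.update x i (y + c • z))
      = f (Function.update x i y) + c • f (Function.update x i z)) :
    MultilinearMap ℝ (fun _ : Fin d => SA) VV where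
  toFun x := f (extend x)
  map_update_add' x i y z := by
    have := hf i i.2 (extend x) y z 1
    simpa only [extend_update, one_smul] using this
  map_update_smul' x i c y := by
    -- With all entries 0 the rule reads f = f + f, so f vanishes there; homogeneity is then the
    -- rule with y = 0.
    have h0 := hf i i.2 (extend x) 0 0 1
    have h := hf i i.2 (extend x) 0 y c
    simp only [one_smul, add_zero, left_eq_add] at h0
    simpa only [extend_update, h0, zero_add] using h

/-- The polarization of `P_j^{[d]}`. -/
def polP (d j : ℕ) : MultilinearMap ℝ (fun _ : Fin d => SA) VV :=
  slotMul d (fun x => evalZ (homT d j x)) fun _ hi x y z c => by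
    rw [homT_update hi, map_add, map_smul]

/-- The polarization of `B_j^{[d]}`. -/
def polB (d j : ℕ) : MultilinearMap ℝ (fun _ : Fin d => SA) VV :=
  slotMul d (fun x => projV j (evalZ (betaT d j x))) fun _ hi x y z c => by
    rw [betaT_update hi, map_add, map_smul, map_add, map_smul]

theorem polP_apply (d j : ℕ) (x : Fin d → SA) : polP d j x = evalZ (homT d j (extend x)) := rfl

theorem polB_apply (d j : ℕ) (x : Fin d → SA) :
    polB d j x = projV j (evalZ (betaT d j (extend x))) := rfl

theorem polP_diag (d j : ℕ) (ξ : SA) : polP d j (fun _ => ξ) = evalZ (homT d j fun _ => ξ) := by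
  rw [polP_apply, homT_congr d j (y := fun _ => ξ) fun i hi => by simp [extend, hi]]

theorem polB_diag (d j : ℕ) (ξ : SA) :
    polB d j (fun _ => ξ) = projV j (evalZ (betaT d j fun _ => ξ)) := by
  rw [polB_apply, betaT_congr d j (y := fun _ => ξ) fun i hi => by simp [extend, hi]]

theorem polP_of_lt {d j : ℕ} (h : j < d) (x : Fin d → SA) : polP d j x = 0 := by
  rw [polP_apply, homT_of_lt h, map_zero]

theorem polB_of_lt {d j : ℕ} (h : j < d) (x : Fin d → SA) : polB d j x = 0 := by
  rw [polB_apply, betaT_of_lt h, map_zero, map_zero]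

/-- Multiplying the two truncated expansions produces pairs (a, b) with a + b > N as well. They
contribute nothing: a + b > N ≥ j forces k < a or j - k < b. -/
theorem sum_bilTL_of_expansion {ξ : SA} {j N : ℕ} (hN : j ≤ N)
    (hq : ∀ k < j, q ξ k = ∑ d ∈ Finset.range (N + 1), homT d k fun _ => ξ) :
    ∑ k ∈ Finset.Ioo 0 j, bilTL (q ξ k) (q ξ (j - k))
      = ∑ d ∈ Finset.range (N + 1), betaT d j fun _ => ξ := by
  simp only [betaT]
  rw [sum_range_sum_Ioo (fun a b => ∑ k ∈ Finset.Ioo 0 j,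
    bilTL (homT a k fun _ => ξ) (homT b (j - k) fun _ => ξ))]
  have h1 : ∀ k ∈ Finset.Ioo 0 j, bilTL (q ξ k) (q ξ (j - k))
      = ∑ a ∈ Finset.range (N + 1), ∑ b ∈ Finset.range (N + 1),
        bilTL (homT a k fun _ => ξ) (homT b (j - k) fun _ => ξ) := by
    intro k hk
    rw [Finset.mem_Ioo] at hk
    rw [hq k hk.2, hq (j - k) (by omega), map_sum]
    simp_rw [map_sum, LinearMap.sum_apply]
    exact Finset.sum_comm
  rw [Finset.sum_congr rfl h1, Finset.sum_comm]
  refine Finset.sum_congr rfl fun a _ => ?_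
  rw [Finset.sum_comm]
  refine Finset.sum_congr rfl fun b _ => ?_
  split_ifs with h
  · rfl
  · refine Finset.sum_eq_zero fun k hk => ?_
    rw [Finset.mem_Ioo] at hk
    rcases Nat.eq_zero_or_pos a with rfl | ha
    · rw [homT_zero, map_zero, LinearMap.zero_apply]
    rcases Nat.eq_zero_or_pos b with rfl | hb
    · rw [homT_zero, map_zero]
    rcases lt_or_ge k a with hka | hka
    · rw [homT_of_lt hka, map_zero, LinearMap.zero_apply]
    · rw [homT_of_lt (d := b) (j := j - k) (by omega), map_zero]

/-- The cutoff N is independent of j so that one N serves all smaller indices in the induction; 1 ≤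
N keeps the linear term within range. -/
theorem q_expansion (ξ : SA) {j N : ℕ} (hN : j ≤ N) (hN1 : 1 ≤ N) :
    q ξ j = ∑ d ∈ Finset.range (N + 1), homT d j fun _ => ξ := by
  induction j using Nat.strong_induction_on with
  | _ j ih =>
    rw [q_eq, sum_bilTL_of_expansion hN fun k hk => ih k hk (by omega), map_sum]
    simp_rw [homT_eq _ j]
    rw [Finset.sum_add_distrib]
    congr 1
    rw [Finset.sum_ite_eq' (Finset.range (N + 1)) 1, if_pos (Finset.mem_range.2 (by omega))]

/-! ### Identification of the homogeneous parts -/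

theorem coeff_unique {Y : Type*} [AddCommGroup Y] [Module ℝ Y] {p r : ℕ →₀ Y}
    (h : ∀ s : ℝ, (p.sum fun n c => s ^ n • c) = r.sum fun n c => s ^ n • c) : p = r := by
  have hmap : ∀ (φ : Module.Dual ℝ Y) (p : ℕ →₀ Y) (s : ℝ),
      φ (p.sum fun n c => s ^ n • c)
        = (p.sum fun n c => Polynomial.monomial n (φ c)).eval s := by
    intro φ p s
    simp only [Finsupp.sum, map_sum, Polynomial.eval_finsetSum, map_smul, smul_eq_mul,
      Polynomial.eval_monomial]
    exact Finset.sum_congr rfl fun n _ => mul_comm _ _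
  have hcoeff : ∀ (φ : Module.Dual ℝ Y) (p : ℕ →₀ Y) (n : ℕ),
      (p.sum fun n c => Polynomial.monomial n (φ c)).coeff n = φ (p n) := by
    intro φ p n
    simp only [Finsupp.sum, Polynomial.finsetSum_coeff, Polynomial.coeff_monomial]
    rw [Finset.sum_ite_eq']
    split_ifs with hn
    · rfl
    · rw [Finsupp.notMem_support_iff.1 hn, map_zero]
  ext n
  -- Linear functionals separate points, which leaves real polynomials that agree at every real s.
  rw [← sub_eq_zero, ← Module.forall_dual_apply_eq_zero_iff ℝ]
  intro φ
  rw [map_sub, sub_eq_zero, ← hcoeff, ← hcoeff]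
  congr 1
  refine Polynomial.funext fun s => ?_
  rw [← hmap, ← hmap, h s]

/-- `homPart` reads its coefficient from an arbitrarily chosen expansion; uniqueness of coefficients
makes the choice irrelevant. -/
theorem homPart_eq {X Y : Type*} [AddCommGroup X] [Module ℝ X] [AddCommGroup Y] [Module ℝ Y]
    {F : X → Y} {ξ : X} {N : ℕ} {c : ℕ → Y} (hc : ∀ d, N ≤ d → c d = 0)
    (hF : ∀ s : ℝ, F (s • ξ) = ∑ d ∈ Finset.range N, s ^ d • c d) (d : ℕ) :
    homPart F d ξ = c d := by
  set p : ℕ →₀ Y := ∑ n ∈ Finset.range N, Finsupp.single n (c n) with hp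
  have hpn : ∀ n, p n = c n := by
    intro n
    simp only [hp, Finsupp.finsetSum_apply, Finsupp.single_apply]
    rw [Finset.sum_ite_eq']
    split_ifs with h
    · rfl
    · exact (hc n (by simpa using h)).symm
  have hps : ∀ s : ℝ, F (s • ξ) = p.sum fun n c => s ^ n • c := by
    intro s
    rw [hF, Finsupp.sum_of_support_subset p (s := Finset.range N) ?_ _ fun _ _ => smul_zero _]
    · exact Finset.sum_congr rfl fun n _ => by rw [hpn]
    · intro n hn
      by_contra h
      rw [Finsupp.mem_support_iff, hpn] at hn
      exact hn (hc n (by simpa using h))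
  have hex : ∃ p : ℕ →₀ Y, ∀ s : ℝ, F (s • ξ) = p.sum fun n c => s ^ n • c := ⟨p, hps⟩
  rw [homPart, dif_pos hex, ← hpn d]
  congr 1
  exact coeff_unique fun s => (hex.choose_spec s).symm.trans (hps s)

theorem Pj_expansion (j : ℕ) (ξ : SA) :
    Pj j ξ = ∑ d ∈ Finset.range (j + 2), polP d j fun _ => ξ := by
  -- The cutoff is j + 1 and not j, so that it is at least 1 even for j = 0; the extra term vanishes
  -- when d > j.
  rw [Pj, evalT_zero, q_expansion ξ (Nat.le_succ j) (by omega), map_sum]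
  exact Finset.sum_congr rfl fun d _ => (polP_diag d j ξ).symm

theorem Bj_expansion (j : ℕ) (ξ : SA) :
    Bj j ξ = ∑ d ∈ Finset.range (j + 2), polB d j fun _ => ξ := by
  have h : Bj j ξ = projV j (evalZ (∑ k ∈ Finset.Ioo 0 j, bilTL (q ξ k) (q ξ (j - k)))) := by
    simp only [map_sum, Bj, Pj, evalT_zero, evalZ_bilTL, projV_apply]
  rw [h, sum_bilTL_of_expansion (Nat.le_succ j)
    fun k hk => q_expansion ξ (hk.le.trans (Nat.le_succ j)) (by omega), map_sum, map_sum]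
  exact Finset.sum_congr rfl fun d _ => (polB_diag d j ξ).symm

theorem multilinear_diag_smul {d : ℕ} (f : MultilinearMap ℝ (fun _ : Fin d => SA) VV) (s : ℝ)
    (ξ : SA) : f (fun _ => s • ξ) = s ^ d • f fun _ => ξ := by
  rw [f.map_smul_univ (fun _ => s) fun _ => ξ]
  simp

theorem Pjd_eq (d j : ℕ) (ξ : L2) : Pjd d j ξ = polP d j fun _ => comps ξ :=
  homPart_eq (c := fun d => polP d j fun _ => comps ξ) (N := j + 2)
    (fun d hd => polP_of_lt (by omega) _) (fun s => by
      rw [Pj_expansion]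
      exact Finset.sum_congr rfl fun d _ => multilinear_diag_smul _ _ _) d

theorem Bjd_eq (d j : ℕ) (ξ : L2) : Bjd d j ξ = polB d j fun _ => comps ξ :=
  homPart_eq (c := fun d => polB d j fun _ => comps ξ) (N := j + 2)
    (fun d hd => polB_of_lt (by omega) _) (fun s => by
      rw [Bj_expansion]
      exact Finset.sum_congr rfl fun d _ => multilinear_diag_smul _ _ _) d

/-! ### Majorants by sums of Fourier modes -/

theorem wave_add (k l : Fin 3 → ℤ) : wave (k + l) = wave k + wave l := by
  ext i
  simp [wave]

theorem wave_sub (k l : Fin 3 → ℤ) : wave (k - l) = wave k - wave l := by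
  ext i
  simp [wave]

theorem wave_eq_zero {k : Fin 3 → ℤ} (h : wave k = 0) : k = 0 := by
  funext i
  have := congrArg (fun y : E3 => y i) h
  simpa [wave] using this

theorem one_le_norm_wave {k : Fin 3 → ℤ} (hk : k ≠ 0) : 1 ≤ ‖wave k‖ := by
  obtain ⟨n, hn⟩ := norm_wave_sq k
  have hn0 : n ≠ 0 := by
    rintro rfl
    exact hk (wave_eq_zero (by simpa using hn))
  have h1 : (1 : ℝ) ≤ ‖wave k‖ ^ 2 := by
    rw [hn]
    exact_mod_cast Nat.one_le_iff_ne_zero.2 hn0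
  nlinarith [norm_nonneg (wave k)]

theorem mode_smul (c : ℝ) (k : Fin 3 → ℤ) (θ : ℝ) (a : E3) :
    c • mode k θ a = mode k θ (c • a) := by
  funext x
  simp [mode, smul_comm c]

/-- A single mode lies in a single eigenspace, so on it the projections and resolvents act as
scalars. This is why modes are the right atoms for the estimates. -/
theorem eig_of_mode {k : Fin 3 → ℤ} {θ : ℝ} {a : E3} {v : VV} (hv : v.1 = mode k θ a) {n : ℕ}
    (hn : ‖wave k‖ ^ 2 = n) : v ∈ eig n := by
  rw [← leray_incl v]
  exact leray_shell (Submodule.subset_span ⟨k, θ, a, hn, Subtype.ext hv⟩)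

/-- The volume of the periodicity cell. -/
def vol : ℝ := (volume.restrict cell).real Set.univ

theorem vol_pos : 0 < vol := by
  have h : volume cell = ENNReal.ofReal (2 * Real.pi) ^ 3 := by
    rw [cell_eq, (PiLp.volume_preserving_ofLp (Fin 3)).measure_preimage
      (MeasurableSet.univ_pi fun _ => measurableSet_Ico).nullMeasurableSet, Real.volume_pi_Ico]
    simp [Finset.prod_const]
  have hp := Real.pi_pos
  rw [vol, measureReal_def, Measure.restrict_apply_univ, h, ENNReal.toReal_pow,
    ENNReal.toReal_ofReal (by positivity)]
  positivity

theorem norm_sq_trigToL2_mode (k : Fin 3 → ℤ) (θ : ℝ) (a : E3) :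
    ‖trigToL2 ⟨mode k θ a, mode_mem k θ a⟩‖ ^ 2
      = (∫ x in cell, Real.cos (⟪wave k, x⟫ + θ) ^ 2) * ‖a‖ ^ 2 := by
  rw [← real_inner_self_eq_norm_sq, inner_trigToL2, ← integral_mul_const]
  refine integral_congr_ae (Filter.Eventually.of_forall fun x => ?_)
  simp only [mode, inner_smul_left, inner_smul_right, real_inner_self_eq_norm_sq]
  simp
  ring

theorem norm_trigToL2_mode_le (k : Fin 3 → ℤ) (θ : ℝ) (a : E3) :
    ‖trigToL2 ⟨mode k θ a, mode_mem k θ a⟩‖ ≤ √vol * ‖a‖ := by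
  have h : ∫ x in cell, Real.cos (⟪wave k, x⟫ + θ) ^ 2 ≤ vol := by
    have : ∫ x in cell, Real.cos (⟪wave k, x⟫ + θ) ^ 2 ≤ ∫ x in cell, (1 : ℝ) :=
      integral_mono (integrable_cell (by fun_prop)) (integrable_cell continuous_const)
        fun x => Real.cos_sq_le_one _
    simpa [vol] using this
  refine abs_le_of_sq_le_sq' ?_ (by positivity) |>.2
  rw [norm_sq_trigToL2_mode, mul_pow, Real.sq_sqrt vol_pos.le]
  gcongr

theorem integral_cos_sq {k : Fin 3 → ℤ} (hk : k ≠ 0) (θ : ℝ) :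
    ∫ x in cell, Real.cos (⟪wave k, x⟫ + θ) ^ 2 = vol / 2 := by
  have h2 : k + k ≠ 0 := by
    intro h
    apply hk
    funext i
    have := congrFun h i
    simp only [Pi.add_apply, Pi.zero_apply] at this ⊢
    omega
  have e : ∀ x : E3, Real.cos (⟪wave k, x⟫ + θ) ^ 2
      = 1 / 2 + 1 / 2 * Real.cos (⟪wave (k + k), x⟫ + (θ + θ)) := by
    intro x
    rw [Real.cos_sq, wave_add, inner_add_left]
    ring_nf
  simp_rw [e]
  rw [integral_add (integrable_cell continuous_const) (integrable_cell (by fun_prop)),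
    integral_const_mul, integral_cos_eq_zero h2]
  simp [vol]
  ring

/-- For k ≠ 0 the L² norm of a mode is a fixed multiple of its amplitude, whatever the phase, so the
L² contraction P does not increase amplitudes. For k = 0 the projection is zero, as it must be since
atoms exclude that frequency. -/
theorem leray_mode_bound (k : Fin 3 → ℤ) (θ : ℝ) (a : E3) :
    leray ⟨mode k θ a, mode_mem k θ a⟩ = 0 ∨
      k ≠ 0 ∧ ∃ b, (leray ⟨mode k θ a, mode_mem k θ a⟩).1 = mode k θ b ∧ ‖b‖ ≤ ‖a‖ := by
  obtain ⟨⟨b, hb⟩, h0⟩ := leray_mode k θ a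
  by_cases hk : k = 0
  · exact Or.inl (h0 hk)
  refine Or.inr ⟨hk, b, congrArg Subtype.val hb, ?_⟩
  have h1 : ‖toL2 (leray ⟨mode k θ a, mode_mem k θ a⟩)‖
      ≤ ‖trigToL2 ⟨mode k θ a, mode_mem k θ a⟩‖ := by
    rw [toL2_leray]
    exact Submodule.norm_starProjection_apply_le _ _
  have h2 : toL2 (leray ⟨mode k θ a, mode_mem k θ a⟩) = trigToL2 ⟨mode k θ b, mode_mem k θ b⟩ :=
    congrArg trigToL2 hb
  rw [h2] at h1
  have h3 := pow_le_pow_left₀ (norm_nonneg _) h1 2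
  rw [norm_sq_trigToL2_mode, norm_sq_trigToL2_mode, integral_cos_sq hk] at h3
  have := vol_pos
  exact abs_le_of_sq_le_sq' (le_of_mul_le_mul_left h3 (by positivity)) (norm_nonneg _) |>.2

/-- Pairs `(t^m v, b)` with `v` a single Fourier mode of amplitude `a` and frequency `k ≠ 0`,
and `b ≥ m! s^m |k|^r |a|`. -/
def atoms (r s : ℝ) : Set (TPoly × ℝ) :=
  {p | ∃ (m : ℕ) (v : VV) (k : Fin 3 → ℤ) (θ : ℝ) (a : E3), k ≠ 0 ∧ v.1 = mode k θ a ∧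
    p.1 = Finsupp.single m v ∧ m.factorial * s ^ m * (‖wave k‖ ^ r * ‖a‖) ≤ p.2}

/-- `(p, b) ∈ majorants r s` means that `p` is a sum of Fourier modes with total weight at
most `b`. -/
def majorants (r s : ℝ) : AddSubmonoid (TPoly × ℝ) := AddSubmonoid.closure (atoms r s)

theorem sum_mk {ι X Y : Type*} [AddCommMonoid X] [AddCommMonoid Y] (t : Finset ι) (f : ι → X)
    (g : ι → Y) : ∑ i ∈ t, (f i, g i) = (∑ i ∈ t, f i, ∑ i ∈ t, g i) :=
  Prod.ext Prod.fst_sum Prod.snd_sum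

/-- The majorants form only an additive monoid; real coefficients, signs included, are absorbed into
the amplitude. -/
theorem smul_single_mem_majorants {r s : ℝ} {v : VV} {k : Fin 3 → ℤ} {θ : ℝ} {a : E3} (hk : k ≠ 0)
    (hv : v.1 = mode k θ a) (c : ℝ) (m : ℕ) {b : ℝ}
    (h : |c| * (m.factorial * s ^ m * (‖wave k‖ ^ r * ‖a‖)) ≤ b) :
    (c • Finsupp.single m v, b) ∈ majorants r s := by
  refine AddSubmonoid.subset_closure ⟨m, c • v, k, θ, c • a, hk, ?_, ?_, ?_⟩
  · rw [← mode_smul, ← hv]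
    rfl
  · simp
  · rw [norm_smul, Real.norm_eq_abs]
    linarith

/-- An atom may have amplitude zero and any nonnegative bound; this is the slack that later allows
bounds to be enlarged. -/
theorem zero_mem_majorants (r s : ℝ) {b : ℝ} (hb : 0 ≤ b) : (0, b) ∈ majorants r s := by
  have h : (0 : VV).1 = mode (fun _ => 1) 0 0 := by
    funext x
    simp [mode]
  have := smul_single_mem_majorants (r := r) (s := s) (b := b) (k := fun _ => 1)
    (fun h => one_ne_zero (congrFun h 0)) h 0 0 (by simpa using hb)
  simpa using this

theorem majorants_mono_right {r s : ℝ} {p : TPoly} {b b' : ℝ} (h : (p, b) ∈ majorants r s)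
    (hb : b ≤ b') : (p, b') ∈ majorants r s := by
  have := add_mem h (zero_mem_majorants r s (sub_nonneg.2 hb))
  simpa using this

theorem atom_weight_nonneg {r s : ℝ} (hs : 0 ≤ s) (m : ℕ) (k : Fin 3 → ℤ) (a : E3) :
    0 ≤ m.factorial * s ^ m * (‖wave k‖ ^ r * ‖a‖) := by positivity

theorem majorants_nonneg {r s : ℝ} (hs : 0 ≤ s) {p : TPoly × ℝ} (h : p ∈ majorants r s) :
    0 ≤ p.2 := by
  induction h using AddSubmonoid.closure_induction with
  | mem p hp =>
    obtain ⟨m, v, k, θ, a, -, -, -, hb⟩ := hp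
    exact (atom_weight_nonneg hs m k a).trans hb
  | zero => simp
  | add p p' _ _ h h' => exact add_nonneg h h'

/-- Since |k| ≥ 1 on atoms, the weight increases with r as well as with s. -/
theorem majorants_anti {r r' s s' : ℝ} (hr : r ≤ r') (hs : 0 ≤ s) (hss : s ≤ s') :
    majorants r' s' ≤ majorants r s := by
  refine AddSubmonoid.closure_mono ?_
  rintro p ⟨m, v, k, θ, a, hk, hv, hp, hb⟩
  refine ⟨m, v, k, θ, a, hk, hv, hp, le_trans ?_ hb⟩
  have := one_le_norm_wave hk
  have : 0 ≤ s' := hs.trans hss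
  gcongr

theorem single_leray_mem_majorants {r s : ℝ} (hs : 0 ≤ s) (m : ℕ) (k : Fin 3 → ℤ) (θ : ℝ) (a : E3)
    {b : ℝ} (hb0 : 0 ≤ b) (hb : m.factorial * s ^ m * (‖wave k‖ ^ r * ‖a‖) ≤ b) :
    (Finsupp.single m (leray ⟨mode k θ a, mode_mem k θ a⟩), b) ∈ majorants r s := by
  rcases leray_mode_bound k θ a with h | ⟨hk, a', ha', hle⟩
  · rw [h, Finsupp.single_zero]
    exact zero_mem_majorants r s hb0
  · have := smul_single_mem_majorants (r := r) (s := s) hk ha' 1 m (b := b) ?_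
    · simpa using this
    · rw [abs_one, one_mul]
      refine le_trans ?_ hb
      gcongr

/-! ### Majorants of products and of solutions -/

theorem bil_mode {u v : VV} {k l : Fin 3 → ℤ} {θ η : ℝ} {a b : E3} (hu : u.1 = mode k θ a)
    (hv : v.1 = mode l η b) :
    bil u v =
      leray ⟨mode (k + l) (θ + (η + Real.pi / 2)) ((1 / 2 * ⟪wave l, a⟫) • b), mode_mem _ _ _⟩ +
      leray ⟨mode (k - l) (θ - (η + Real.pi / 2)) ((1 / 2 * ⟪wave l, a⟫) • b), mode_mem _ _ _⟩ := by
  rw [bil, ← map_add]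
  congr 1
  apply Subtype.ext
  change adv u.1 v.1 = mode (k + l) _ _ + mode (k - l) _ _
  rw [mul_smul, ← mode_smul (1 / 2), ← mode_smul (1 / 2), ← cos_smul_mode]
  funext x
  simp only [adv, hu, hv, fderiv_mode, mode, inner_smul_right, smul_smul]
  congr 1
  ring

theorem factorial_add_le (m n : ℕ) :
    ((m + n).factorial : ℝ) ≤ 2 ^ (m + n) * (m.factorial * n.factorial) := by
  have h := Nat.add_choose_mul_factorial_mul_factorial m n
  have h2 := Nat.choose_le_two_pow (m + n) n
  have h3 : (m + n).factorial ≤ 2 ^ (m + n) * (m.factorial * n.factorial) := by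
    rw [← h, mul_assoc]
    exact Nat.mul_le_mul_right _ h2
  exact_mod_cast h3

/-- The product of modes of frequencies k and l has frequencies k + l and k - l, each of length at
most 2|k||l|, and amplitude at most |l||a||a'|/2. The passage from atoms to sums is bilinearity. -/
theorem bilTL_mem_majorants {r s : ℝ} (hr : 0 ≤ r) (hs : 0 ≤ s) {p p' : TPoly × ℝ}
    (hp : p ∈ majorants (r + 1) (2 * s)) (hp' : p' ∈ majorants (r + 1) (2 * s)) :
    (bilTL p.1 p'.1, 2 ^ r * (p.2 * p'.2)) ∈ majorants r s := by
  induction hp using AddSubmonoid.closure_induction with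
  | mem p hp =>
    induction hp' using AddSubmonoid.closure_induction with
    | mem p' hp' =>
      obtain ⟨m, u, k, θ, a, hk, hu, hpu, hb⟩ := hp
      obtain ⟨n, v, l, η, a', hl, hv, hpv, hb'⟩ := hp'
      rw [hpu, hpv, bilTL_single, bil_mode hu hv, Finsupp.single_add]
      have hk1 := one_le_norm_wave hk
      have hl1 := one_le_norm_wave hl
      have hw := atom_weight_nonneg (r := r + 1) (s := 2 * s) (by positivity) m k a
      have hw' := atom_weight_nonneg (r := r + 1) (s := 2 * s) (by positivity) n l a'
      have hbb := mul_le_mul hb hb' hw' (hw.trans hb)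
      have hnn : 0 ≤ p.2 * p'.2 := (mul_nonneg hw hw').trans hbb
      have key : ∀ w : Fin 3 → ℤ, ‖wave w‖ ≤ ‖wave k‖ + ‖wave l‖ →
          (m + n).factorial * s ^ (m + n) *
            (‖wave w‖ ^ r * ‖(1 / 2 * ⟪wave l, a⟫) • a'‖) ≤ 1 / 2 * (2 ^ r * (p.2 * p'.2)) := by
        intro w hw
        have h1 : ‖wave w‖ ^ r ≤ 2 ^ r * (‖wave k‖ ^ r * ‖wave l‖ ^ r) := by
          rw [← Real.mul_rpow (by positivity) (by positivity),
            ← Real.mul_rpow (by positivity) (by positivity)]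
          refine Real.rpow_le_rpow (by positivity) (hw.trans ?_) hr
          -- From (|k| - 1)(|l| - 1) ≥ 0 and |k||l| ≥ 1 one gets |k| + |l| ≤ 2|k||l|.
          nlinarith [mul_nonneg (sub_nonneg.2 hk1) (sub_nonneg.2 hl1)]
        have h2 : ‖(1 / 2 * ⟪wave l, a⟫) • a'‖ ≤ 1 / 2 * (‖wave l‖ * ‖a‖ * ‖a'‖) := by
          rw [norm_smul, norm_mul, Real.norm_eq_abs, abs_of_pos (by norm_num : (0 : ℝ) < 1 / 2),
            mul_assoc]
          gcongr
          exact norm_inner_le_norm _ _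
        have h3 := factorial_add_le m n
        calc _ ≤ 2 ^ (m + n) * (m.factorial * n.factorial) * s ^ (m + n) *
              (2 ^ r * (‖wave k‖ ^ r * ‖wave l‖ ^ r) * (1 / 2 * (‖wave l‖ * ‖a‖ * ‖a'‖))) := by
              gcongr
          -- Only the differentiated factor needs the extra power of its frequency; a spare |k| ≥ 1
          -- is inserted so that both factors carry exponent r + 1.
          _ ≤ 2 ^ (m + n) * (m.factorial * n.factorial) * s ^ (m + n) *
              (2 ^ r * (‖wave k‖ ^ r * ‖wave l‖ ^ r) * (1 / 2 * (‖wave l‖ * ‖a‖ * ‖a'‖)))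
              * ‖wave k‖ := le_mul_of_one_le_right (by positivity) hk1
          _ = 1 / 2 * (2 ^ r * ((m.factorial * (2 * s) ^ m * (‖wave k‖ ^ (r + 1) * ‖a‖)) *
              (n.factorial * (2 * s) ^ n * (‖wave l‖ ^ (r + 1) * ‖a'‖)))) := by
              rw [Real.rpow_add_one (by positivity), Real.rpow_add_one (by positivity)]
              ring
          _ ≤ _ := by gcongr
      have e : 2 ^ r * (p.2 * p'.2)
          = 1 / 2 * (2 ^ r * (p.2 * p'.2)) + 1 / 2 * (2 ^ r * (p.2 * p'.2)) := by ring
      rw [e, ← Prod.mk_add_mk]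
      refine add_mem (single_leray_mem_majorants hs _ _ _ _ (by positivity) (key _ ?_))
        (single_leray_mem_majorants hs _ _ _ _ (by positivity) (key _ ?_))
      · rw [wave_add]
        exact norm_add_le _ _
      · rw [wave_sub]
        exact norm_sub_le _ _
    | zero => simpa using zero_mem_majorants r s le_rfl
    | add y z _ _ h h' =>
      have := add_mem h h'
      simpa only [Prod.fst_add, Prod.snd_add, map_add, mul_add, Prod.mk_add_mk] using this
  | zero => simpa using zero_mem_majorants r s le_rfl
  | add y z _ _ h h' =>
    have := add_mem h h'
    simpa only [Prod.fst_add, Prod.snd_add, map_add, LinearMap.add_apply, add_mul, mul_add,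
      Prod.mk_add_mk] using this

theorem mul_half_pow_le {s : ℝ} (hs : 2 ≤ s) {m n : ℕ} (h : n ≤ m) :
    s ^ (m - n) ≤ s ^ m * (1 / 2) ^ n := by
  obtain ⟨i, rfl⟩ := Nat.exists_eq_add_of_le h
  rw [Nat.add_sub_cancel_left, pow_add, mul_right_comm, ← mul_pow]
  exact le_mul_of_one_le_left (by positivity) (one_le_pow₀ (by linarith))

/-- No small divisors: two distinct integers differ by at least 1. -/
theorem abs_resolv_coeff_le (m j n : ℕ) :
    |if m = j then (0 : ℝ) else (((m : ℝ) - j) ^ (n + 1))⁻¹| ≤ 1 := by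
  split_ifs with h
  · simp
  · rw [abs_inv, abs_pow]
    refine inv_le_one_of_one_le₀ (one_le_pow₀ ?_)
    have h1 : (1 : ℤ) ≤ |(m : ℤ) - j| := Int.one_le_abs (by omega)
    exact_mod_cast h1

/-- The weight m! s^m is made for this operator. Integration turns t^m into t^{m+1}/(m + 1), which
costs exactly s. The n-th derivative has weight m! s^{m-n}, at most 2^{-n} times the original
because s ≥ 2, and these factors sum to at most 2. Neither r nor s is lost. -/
theorem solveT_mem_majorants {r s : ℝ} (hs : 2 ≤ s) (j : ℕ) {p : TPoly × ℝ}
    (hp : p ∈ majorants r s) : (solveT j p.1, (s + 2) * p.2) ∈ majorants r s := by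
  have hs0 : 0 ≤ s := by linarith
  induction hp using AddSubmonoid.closure_induction with
  | mem p hp =>
    obtain ⟨m, v, k, θ, a, hk, hv, hpv, hb⟩ := hp
    obtain ⟨N, hN⟩ := norm_wave_sq k
    have hmem := eig_of_mode hv hN
    rw [hpv, solveT_single]
    set w : ℝ := ‖wave k‖ ^ r * ‖a‖ with hw
    have hw0 : 0 ≤ w := by positivity
    have hb0 : 0 ≤ p.2 := le_trans (by positivity) hb
    have h1 : (-(((m : ℝ) + 1)⁻¹ • Finsupp.single (m + 1) (projV j v) : TPoly), s * p.2)
        ∈ majorants r s := by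
      rw [projV_of_mem hmem]
      split_ifs with h
      · rw [← neg_smul]
        refine smul_single_mem_majorants hk hv _ _ ?_
        rw [abs_neg, abs_of_nonneg (by positivity), ← hw]
        calc _ = s * (m.factorial * s ^ m * w) := by
              rw [Nat.factorial_succ, pow_succ]
              push_cast
              field_simp
          _ ≤ _ := by gcongr
      · simpa using zero_mem_majorants r s (by positivity)
    have h2 : ∀ n ∈ Finset.range (m + 1), (((-1 : ℝ) ^ (n + 1) * m.descFactorial n) •
        Finsupp.single (m - n) (resolvL j n v), (1 / 2 : ℝ) ^ n * p.2) ∈ majorants r s := by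
      intro n hn
      have hnm : n ≤ m := by
        rw [Finset.mem_range] at hn
        omega
      rw [resolvL_of_mem hmem, ← Finsupp.smul_single, smul_smul]
      refine smul_single_mem_majorants hk hv _ _ ?_
      rw [abs_mul, abs_mul, abs_pow, abs_neg, abs_one, one_pow, one_mul, Nat.abs_cast, ← hw]
      have hf : ((m - n).factorial : ℝ) * m.descFactorial n = m.factorial := by
        exact_mod_cast Nat.factorial_mul_descFactorial hnm
      calc _ ≤ (m.descFactorial n : ℝ) * 1 * ((m - n).factorial * s ^ (m - n) * w) := by
            gcongr
            exact abs_resolv_coeff_le N j n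
        _ = m.factorial * s ^ (m - n) * w := by
            rw [← hf]
            ring
        _ ≤ m.factorial * (s ^ m * (1 / 2) ^ n) * w := by
            gcongr
            exact mul_half_pow_le hs hnm
        _ = (1 / 2) ^ n * (m.factorial * s ^ m * w) := by ring
        _ ≤ _ := by gcongr
    have h3 := add_mem h1 (sum_mem h2)
    rw [sum_mk, Prod.mk_add_mk] at h3
    refine majorants_mono_right h3 ?_
    rw [← Finset.sum_mul, ← add_mul]
    gcongr
    exact sum_geometric_two_le _
  | zero => simpa using zero_mem_majorants r s le_rfl
  | add y z _ _ h h' =>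
    have := add_mem h h'
    simpa only [Prod.fst_add, Prod.snd_add, map_add, mul_add, Prod.mk_add_mk] using this

/-- The property that `f j` has a majorant whose sum over `j` is controlled by the product of the
sums of the majorants of the first `d` arguments. -/
def ConvBound (d : ℕ) (f : ℕ → (ℕ → SA) → TPoly) : Prop :=
  ∀ r s : ℝ, 0 ≤ r → 2 ≤ s → ∃ C : ℝ, 0 ≤ C ∧ ∀ (x : ℕ → SA) (A : ℕ → ℕ → ℝ),
    -- A form of degree d contains d - 1 products, each costing one power of the frequency and one
    -- doubling of s. Bounding partial sums up to a common J avoids any question of convergence.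
    (∀ i k, (Finsupp.single 0 (x i k : VV), A i k) ∈ majorants (r + d - 1) (2 ^ (d - 1) * s)) →
    ∃ b : ℕ → ℝ, (∀ j, (f j x, b j) ∈ majorants r s) ∧
      ∀ J, ∑ j ∈ Finset.range J, b j
        ≤ C * ∏ i ∈ Finset.range d, ∑ k ∈ Finset.range J, A i k

/-- The pairs (k, l) with k + l < J lie in the square k, l < J, and all terms are nonnegative. -/
theorem sum_conv_le {b c : ℕ → ℝ} (hb : ∀ k, 0 ≤ b k) (hc : ∀ k, 0 ≤ c k) (J : ℕ) :
    ∑ j ∈ Finset.range J, ∑ k ∈ Finset.Ioo 0 j, b k * c (j - k)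
      ≤ (∑ k ∈ Finset.range J, b k) * ∑ k ∈ Finset.range J, c k := by
  rcases J with _ | N
  · simp
  rw [sum_range_sum_Ioo (fun k l => b k * c l), Finset.sum_mul_sum]
  refine Finset.sum_le_sum fun k _ => Finset.sum_le_sum fun l _ => ?_
  split_ifs
  · exact le_rfl
  · exact mul_nonneg (hb k) (hc l)

/-- The factors are estimated at (r + 1, 2s). A factor of degree a then requires (r + a, 2^a s) of
its arguments, which the given (r + d - 1, 2^{d-1} s) dominates because a < d. The products over the
first a and the last d - a arguments recombine into the product over all d. -/
theorem betaT_convBound {d : ℕ} (H : ∀ a, 0 < a → a < d → ConvBound a (homT a)) :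
    ConvBound d (betaT d) := by
  intro r s hr hs
  have H' : ∀ a, 0 < a → a < d → _ := fun a h0 hd =>
    H a h0 hd (r + 1) (2 * s) (by linarith) (by linarith)
  choose! C hC0 hC using H'
  refine ⟨∑ a ∈ Finset.Ioo 0 d, 2 ^ r * (C a * C (d - a)), ?_, ?_⟩
  · refine Finset.sum_nonneg fun a ha => ?_
    rw [Finset.mem_Ioo] at ha
    exact mul_nonneg (by positivity) (mul_nonneg (hC0 a ha.1 ha.2)
      (hC0 (d - a) (by omega) (by omega)))
  intro x A hA
  have hs0 : 0 ≤ s := by linarith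
  have hA0 : ∀ i k, 0 ≤ A i k := fun i k => majorants_nonneg (by positivity) (hA i k)
  have hle : ∀ a, 0 < a → a < d → majorants (r + d - 1) (2 ^ (d - 1) * s)
      ≤ majorants (r + 1 + a - 1) (2 ^ (a - 1) * (2 * s)) := by
    intro a h0 hd
    refine majorants_anti ?_ (by positivity) ?_
    · have : (a : ℝ) + 1 ≤ d := by exact_mod_cast hd
      linarith
    · rw [← mul_assoc, ← pow_succ]
      gcongr
      · norm_num
      · omega
  have h1 : ∀ a, 0 < a → a < d → _ := fun a h0 hd =>
    hC a h0 hd x A fun i k => hle a h0 hd (hA i k)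
  have h2 : ∀ a, 0 < a → a < d → _ := fun a h0 hd =>
    hC (d - a) (by omega) (by omega) (fun i => x (i + a)) (fun i => A (i + a)) fun i k =>
      hle (d - a) (by omega) (by omega) (hA (i + a) k)
  choose! b hb hbs using h1
  choose! c hc hcs using h2
  refine ⟨fun j => ∑ a ∈ Finset.Ioo 0 d, ∑ k ∈ Finset.Ioo 0 j, 2 ^ r * (b a k * c a (j - k)),
    fun j => ?_, fun J => ?_⟩
  · rw [betaT]
    simp only [← sum_mk]
    refine sum_mem fun a ha => sum_mem fun k hk => ?_
    rw [Finset.mem_Ioo] at ha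
    exact bilTL_mem_majorants hr hs0 (hb a ha.1 ha.2 k) (hc a ha.1 ha.2 (j - k))
  · rw [Finset.sum_comm, Finset.sum_mul]
    refine Finset.sum_le_sum fun a ha => ?_
    rw [Finset.mem_Ioo] at ha
    have hb0 : ∀ k, 0 ≤ b a k := fun k => majorants_nonneg (by positivity) (hb a ha.1 ha.2 k)
    have hc0 : ∀ k, 0 ≤ c a k := fun k => majorants_nonneg (by positivity) (hc a ha.1 ha.2 k)
    simp only [← Finset.mul_sum]
    rw [mul_assoc]
    refine mul_le_mul_of_nonneg_left ?_ (by positivity)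
    refine (sum_conv_le hb0 hc0 J).trans ?_
    refine (mul_le_mul (hbs a ha.1 ha.2 J) (hcs a ha.1 ha.2 J)
      (Finset.sum_nonneg fun k _ => hc0 k) ?_).trans_eq ?_
    · exact mul_nonneg (hC0 a ha.1 ha.2) (Finset.prod_nonneg fun i _ =>
        Finset.sum_nonneg fun k _ => hA0 i k)
    · have hprod := Finset.prod_range_add (fun i => ∑ k ∈ Finset.range J, A i k) a (d - a)
      rw [Nat.add_sub_cancel' ha.2.le] at hprod
      rw [hprod]
      simp only [add_comm _ a]
      exact mul_mul_mul_comm _ _ _ _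

theorem homT_convBound {d : ℕ} (hd : 0 < d) : ConvBound d (homT d) := by
  induction d using Nat.strong_induction_on with
  | _ d ih =>
    intro r s hr hs
    by_cases h1 : d = 1
    · subst h1
      refine ⟨1, zero_le_one, fun x A hA => ⟨A 0, fun j => ?_, fun J => ?_⟩⟩
      · rw [homT_one]
        simpa using hA 0 j
      · simp
    · obtain ⟨C, hC0, hC⟩ := betaT_convBound (fun a h0 ha => ih a ha h0) r s hr hs
      refine ⟨(s + 2) * C, mul_nonneg (by linarith) hC0, fun x A hA => ?_⟩
      obtain ⟨b, hb, hbs⟩ := hC x A hA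
      refine ⟨fun j => (s + 2) * b j, fun j => ?_, fun J => ?_⟩
      · have h := solveT_mem_majorants (p := (betaT d j x, b j)) hs j (hb j)
        have e : homT d j x = solveT j (betaT d j x) := by rw [homT_eq, if_neg h1, zero_add]
        rw [e]
        exact h
      · rw [← Finset.mul_sum, mul_assoc]
        exact mul_le_mul_of_nonneg_left (hbs J) (by linarith)

/-! ### Fourier coefficients and the norms of `D(A^α)` -/

theorem integral_cos (k : Fin 3 → ℤ) (θ : ℝ) :
    ∫ x in cell, Real.cos (⟪wave k, x⟫ + θ) = if k = 0 then vol * Real.cos θ else 0 := by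
  split_ifs with h
  · subst h
    simp [wave_zero, vol]
  · exact integral_cos_eq_zero h θ

/-- The Fourier coefficient of a trigonometric polynomial with respect to `cos (k · x + θ)`. -/
def coef (k : Fin 3 → ℤ) (θ : ℝ) : TrigPoly →ₗ[ℝ] E3 where
  toFun u := vol⁻¹ • ∫ x in cell, Real.cos (⟪wave k, x⟫ + θ) • u.1 x
  map_add' u v := by
    have hu := trigPoly_continuous u.2
    have hv := trigPoly_continuous v.2
    rw [← smul_add, ← integral_add (integrable_cell (by fun_prop)) (integrable_cell (by fun_prop))]
    congr 2
    funext x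
    exact smul_add _ _ _
  map_smul' c u := by
    rw [RingHom.id_apply, smul_comm c]
    congr 1
    rw [← integral_smul]
    congr 1
    funext x
    exact smul_comm (Real.cos (⟪wave k, x⟫ + θ)) c (u.1 x)

theorem coef_mode (k l : Fin 3 → ℤ) (θ η : ℝ) (a : E3) :
    coef k θ ⟨mode l η a, mode_mem l η a⟩
      = ((if k + l = 0 then Real.cos (θ + η) / 2 else 0)
        + if k - l = 0 then Real.cos (θ - η) / 2 else 0) • a := by
  change vol⁻¹ • ∫ x in cell, Real.cos (⟪wave k, x⟫ + θ) • mode l η a x = _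
  have e := cos_smul_mode k l θ η a
  have e' : ∀ x, Real.cos (⟪wave k, x⟫ + θ) • mode l η a x
      = (1 / 2 : ℝ) • (Real.cos (⟪wave (k + l), x⟫ + (θ + η)) • a)
        + (1 / 2 : ℝ) • (Real.cos (⟪wave (k - l), x⟫ + (θ - η)) • a) := fun x => congrFun e x
  simp_rw [e']
  rw [integral_add (integrable_cell (by fun_prop)) (integrable_cell (by fun_prop)), integral_smul,
    integral_smul, integral_smul_const, integral_smul_const, integral_cos, integral_cos]
  have := vol_pos.ne'
  simp only [smul_smul, ← add_smul]
  congr 1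
  split_ifs <;> field_simp <;> ring

/-- By duality: u is tested against the mode whose amplitude is the coefficient itself, and
Cauchy–Schwarz is applied. -/
theorem norm_coef_le (k : Fin 3 → ℤ) (θ : ℝ) (u : TrigPoly) :
    ‖coef k θ u‖ ≤ vol⁻¹ * √vol * ‖trigToL2 u‖ := by
  set c := coef k θ u with hc
  have hu := trigPoly_continuous u.2
  have hv := vol_pos
  have h1 : ‖c‖ ^ 2 = vol⁻¹ * ⟪trigToL2 ⟨mode k θ c, mode_mem k θ c⟩, trigToL2 u⟫ := by
    rw [← real_inner_self_eq_norm_sq, inner_trigToL2]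
    nth_rw 2 [hc]
    change ⟪c, vol⁻¹ • ∫ x in cell, Real.cos (⟪wave k, x⟫ + θ) • u.1 x⟫ = _
    rw [inner_smul_right, ← integral_inner (integrable_cell (by fun_prop))]
    congr 2
    funext x
    simp [mode, inner_smul_left, inner_smul_right]
  have h2 : ‖c‖ ^ 2 ≤ vol⁻¹ * (√vol * ‖c‖ * ‖trigToL2 u‖) := by
    rw [h1]
    refine mul_le_mul_of_nonneg_left ?_ (by positivity)
    refine (real_inner_le_norm _ _).trans ?_
    gcongr
    exact norm_trigToL2_mode_le k θ c
  rcases (norm_nonneg c).eq_or_lt with h | h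
  · rw [← h]
    positivity
  · nlinarith

/-- `a ↦ cos (k · x + θ) a`. -/
def modeL (k : Fin 3 → ℤ) (θ : ℝ) : E3 →ₗ[ℝ] TrigPoly where
  toFun a := ⟨mode k θ a, mode_mem k θ a⟩
  map_add' a b := Subtype.ext (by funext x; exact smul_add _ _ _)
  map_smul' c a := Subtype.ext (by funext x; exact smul_comm _ _ _)

/-- The wave vectors `k` with `|k|² = n`. -/
def waves (n : ℕ) : Finset (Fin 3 → ℤ) := (wave_finite n).toFinset

theorem mem_waves {n : ℕ} {k : Fin 3 → ℤ} : k ∈ waves n ↔ ‖wave k‖ ^ 2 = n := by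
  simp [waves]

/-- The sum runs over k and -k separately, and each of the two reproduces half of a mode; hence no
factor 2 in `coef`. For frequency zero both halves fall on the same k. -/
theorem fourier_shell {n : ℕ} {u : TrigPoly} (hu : u ∈ shell n) :
    ∑ k ∈ waves n, (modeL k 0 (coef k 0 u)
      + modeL k (-(Real.pi / 2)) (coef k (-(Real.pi / 2)) u)) = u := by
  induction hu using Submodule.span_induction with
  | mem u hu =>
    obtain ⟨l, η, a, hl, rfl⟩ := hu
    apply Subtype.ext
    funext x
    have hl1 : l ∈ waves n := mem_waves.2 hl
    have hl2 : -l ∈ waves n := by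
      rw [mem_waves, ← zero_sub, wave_sub, wave_zero, zero_sub, norm_neg, hl]
    have e : ∀ k : Fin 3 → ℤ, (modeL k 0 (coef k 0 ⟨mode l η a, mode_mem l η a⟩)
        + modeL k (-(Real.pi / 2)) (coef k (-(Real.pi / 2)) ⟨mode l η a, mode_mem l η a⟩)).1 x
        = (if k = -l then Real.cos (⟪wave k, x⟫ - η) / 2 else 0) • a
          + (if k = l then Real.cos (⟪wave k, x⟫ + η) / 2 else 0) • a := by
      intro k
      change mode k 0 (coef k 0 _) x + mode k (-(Real.pi / 2)) (coef k (-(Real.pi / 2)) _) x = _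
      rw [coef_mode, coef_mode]
      simp only [mode, smul_smul, ← add_smul, add_eq_zero_iff_eq_neg, sub_eq_zero]
      congr 1
      have h1 : Real.cos (⟪wave k, x⟫ + -(Real.pi / 2)) = Real.sin ⟪wave k, x⟫ := by
        rw [← sub_eq_add_neg, Real.cos_sub_pi_div_two]
      have h2 : Real.cos (-(Real.pi / 2) + η) = Real.sin η := by
        rw [add_comm, ← sub_eq_add_neg, Real.cos_sub_pi_div_two]
      have h3 : Real.cos (-(Real.pi / 2) - η) = -Real.sin η := by
        rw [← Real.cos_neg, neg_sub, sub_neg_eq_add, Real.cos_add_pi_div_two]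
      rw [h1, h2, h3, zero_sub, zero_add, add_zero, Real.cos_neg, Real.cos_sub ⟪wave k, x⟫ η,
        Real.cos_add ⟪wave k, x⟫ η]
      split_ifs <;> ring
    have hsum : ∀ t : Finset (Fin 3 → ℤ), ∀ f : (Fin 3 → ℤ) → TrigPoly,
        (∑ k ∈ t, f k).1 x = ∑ k ∈ t, (f k).1 x := by
      intro t f
      change TrigPoly.subtype (∑ k ∈ t, f k) x = _
      rw [map_sum, Finset.sum_apply]
      rfl
    rw [hsum, Finset.sum_congr rfl fun k _ => e k, Finset.sum_add_distrib]
    simp only [ite_smul, zero_smul, Finset.sum_ite_eq', hl1, hl2, if_true]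
    have hw : ⟪wave (-l), x⟫ = -⟪wave l, x⟫ := by
      rw [← zero_sub, wave_sub, wave_zero, zero_sub, inner_neg_left]
    rw [hw, ← add_smul, ← neg_add', Real.cos_neg, add_halves]
    rfl
  | zero => simp
  | add u v _ _ h h' =>
    nth_rw 3 [← h, ← h']
    rw [← Finset.sum_add_distrib]
    refine Finset.sum_congr rfl fun k _ => ?_
    simp only [map_add]
    abel
  | smul c u _ h =>
    nth_rw 3 [← h]
    rw [Finset.smul_sum]
    refine Finset.sum_congr rfl fun k _ => ?_
    simp only [map_smul, smul_add]

/-- With s the integer part of √n, the first two coordinates lie in [-s, s] and the third is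
determined by its sign. This gives 3(2s + 1)² ≤ 27s² ≤ 27n, using s ≥ 1. -/
theorem card_waves_le {n : ℕ} (hn : n ≠ 0) : (waves n).card ≤ 27 * n := by
  obtain ⟨s, hs⟩ : ∃ s : ℤ, s = (Nat.sqrt n : ℕ) := ⟨_, rfl⟩
  have hsn : s * s ≤ n := by
    rw [hs]
    exact_mod_cast Nat.sqrt_le n
  have hs1 : 1 ≤ s := by
    have : 1 ≤ Nat.sqrt n := Nat.sqrt_pos.2 (by omega)
    rw [hs]
    exact_mod_cast this
  have hlt : (n : ℤ) < (s + 1) * (s + 1) := by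
    rw [hs]
    exact_mod_cast Nat.lt_succ_sqrt n
  have hnorm : ∀ k ∈ waves n, k 0 ^ 2 + k 1 ^ 2 + k 2 ^ 2 = (n : ℤ) := by
    intro k hk
    rw [mem_waves, EuclideanSpace.norm_sq_eq] at hk
    simp only [wave, Fin.sum_univ_three, Real.norm_eq_abs, sq_abs] at hk
    exact_mod_cast hk
  have hcard : (waves n).card
      ≤ ((Finset.Icc (-s) s) ×ˢ (Finset.Icc (-s) s) ×ˢ (Finset.Icc (-1 : ℤ) 1)).card := by
    refine Finset.card_le_card_of_injOn (fun k => (k 0, k 1, (k 2).sign)) ?_ ?_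
    · intro k hk
      have h := hnorm k hk
      have hb : ∀ z : ℤ, z ^ 2 ≤ n → -s ≤ z ∧ z ≤ s := by
        intro z hz
        constructor <;> nlinarith
      have h0 := hb (k 0) (by nlinarith [sq_nonneg (k 1), sq_nonneg (k 2)])
      have h1 := hb (k 1) (by nlinarith [sq_nonneg (k 0), sq_nonneg (k 2)])
      have h2 : -1 ≤ (k 2).sign ∧ (k 2).sign ≤ 1 := by
        rcases Int.sign_trichotomy (k 2) with h | h | h <;> omega
      simp only [Finset.coe_product, Finset.coe_Icc, Set.mem_prod, Set.mem_Icc]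
      exact ⟨h0, h1, h2⟩
    · intro k hk l hl h
      simp only [Prod.mk.injEq] at h
      obtain ⟨h0, h1, h2⟩ := h
      have hk' := hnorm k hk
      have hl' := hnorm l hl
      rw [h0, h1] at hk'
      have hsq : (k 2) ^ 2 = (l 2) ^ 2 := by linarith
      have h3 : k 2 = l 2 := by
        rw [← Int.sign_mul_natAbs (k 2), ← Int.sign_mul_natAbs (l 2), h2,
          Int.natAbs_eq_iff_sq_eq.2 hsq]
      funext i
      fin_cases i
      · exact h0
      · exact h1
      · exact h3
  refine hcard.trans ?_
  simp only [Finset.card_product, Int.card_Icc]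
  have h1 : ((s + 1 - -s).toNat : ℤ) = 2 * s + 1 := by
    rw [Int.toNat_of_nonneg (by omega)]
    ring
  zify
  rw [h1]
  norm_num
  nlinarith

/-- Each of at most 27n frequencies contributes a cosine and a sine, which gives the 54 and the
extra power of n; the rest is |k|^r = n^{r/2}. The individual Fourier terms of v are passed through
`leray`, which fixes v, in order to stay in 𝒱. -/
theorem eig_mem_majorants {r s : ℝ} (hs : 0 ≤ s) {n : ℕ} {v : VV} (hv : v ∈ eig n) :
    (Finsupp.single 0 v, 54 * (vol⁻¹ * √vol) * ((n : ℝ) ^ (1 + r / 2) * ‖toL2 v‖))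
      ∈ majorants r s := by
  have hvol := vol_pos
  rcases Nat.eq_zero_or_pos n with rfl | hn
  · rw [eig_zero hv, Finsupp.single_zero]
    exact zero_mem_majorants r s (by positivity)
  have hn0 : (0 : ℝ) < n := by exact_mod_cast hn
  have h := fourier_shell (eig_shell hv)
  set B : ℝ := (n : ℝ) ^ (r / 2) * (vol⁻¹ * √vol * ‖toL2 v‖) with hB
  have hB0 : 0 ≤ B := by positivity
  have key : ∀ k ∈ waves n, ∀ θ, (Finsupp.single 0 (leray (modeL k θ (coef k θ (incl v)))), B)
      ∈ majorants r s := by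
    intro k hk θ
    refine single_leray_mem_majorants hs 0 k θ _ hB0 ?_
    have hkn : ‖wave k‖ ^ r = (n : ℝ) ^ (r / 2) := by
      rw [← mem_waves.1 hk, ← Real.rpow_natCast, ← Real.rpow_mul (norm_nonneg _)]
      congr 1
      push_cast
      ring
    rw [hkn, Nat.factorial_zero, Nat.cast_one, pow_zero, one_mul, one_mul, hB]
    gcongr
    exact norm_coef_le k θ (incl v)
  have hsum : (Finsupp.single 0 v, ∑ k ∈ waves n, (B + B)) ∈ majorants r s := by
    rw [← leray_incl v, ← h, map_sum, Finsupp.single_finsetSum, ← sum_mk]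
    refine sum_mem fun k hk => ?_
    rw [map_add, Finsupp.single_add, ← Prod.mk_add_mk]
    refine add_mem ?_ ?_
    · exact key k hk 0
    · exact key k hk (-(Real.pi / 2))
  refine majorants_mono_right hsum ?_
  rw [Finset.sum_const, nsmul_eq_mul]
  have hc : ((waves n).card : ℝ) ≤ 27 * n := by exact_mod_cast card_waves_le hn.ne'
  calc _ ≤ 27 * n * (B + B) := by gcongr
    _ = _ := by
      rw [hB, Real.rpow_add hn0, Real.rpow_one]
      ring

theorem toL2_R_powA {β : ℝ} {u : L2} (hu : u ∈ domA β) (n : ℕ) :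
    toL2 (R n (powA β u)) = (n : ℝ) ^ β • toL2 (R n u) := by
  rw [toL2_R, powA, ContinuousLinearMap.map_tsum _ hu.2, tsum_eq_single n]
  · rw [map_smul, ← toL2_R, ← projV_apply, projV_of_mem (R n u).2, if_pos rfl]
  · intro m hm
    rw [map_smul, ← toL2_R, ← projV_apply, projV_of_mem (R m u).2, if_neg hm.symm, map_zero,
      smul_zero]

theorem norm_toL2_R_le (n : ℕ) (u : L2) : ‖toL2 (R n u)‖ ≤ ‖u‖ := by
  rw [toL2_R]
  exact Submodule.norm_starProjection_apply_le _ _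

theorem rpow_mul_norm_R_le {β : ℝ} (ξ : Dom β) (n : ℕ) :
    (n : ℝ) ^ β * ‖toL2 (R n ξ.val)‖ ≤ ‖ξ‖ := by
  have h := norm_toL2_R_le n (powA β ξ.val)
  have hξ : ξ.val ∈ domA β := ξ.2
  rwa [toL2_R_powA hξ, norm_smul, Real.norm_of_nonneg (by positivity)] at h

theorem norm_toDom_of_mem (α : ℝ) {n : ℕ} {v : VV} (hv : v ∈ eig n) :
    ‖toDom α v‖ = (n : ℝ) ^ α * ‖toL2 v‖ := by
  have h : powA α (toL2 v) = (n : ℝ) ^ α • toL2 v := by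
    rw [powA, tsum_eq_single n]
    · rw [← projV_apply, projV_of_mem hv, if_pos rfl]
    · intro m hm
      rw [← projV_apply, projV_of_mem hv, if_neg hm, map_zero, smul_zero]
  change ‖powA α (toL2 v)‖ = _
  rw [h, norm_smul, Real.norm_of_nonneg (by positivity)]

/-- `toDom` as a linear map. -/
def toDomL (α : ℝ) : VV →ₗ[ℝ] Dom α where
  toFun := toDom α
  map_add' u v := Subtype.ext (map_add toL2 u v)
  map_smul' c u := Subtype.ext (map_smul toL2 c u)

theorem toDomL_apply (α : ℝ) (v : VV) : toDomL α v = toDom α v := rfl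

/-- A^α multiplies a mode of frequency k by |k|^{2α}, so the weight with r = 2α controls the norm of
D(A^α). Only the terms with m = 0 survive at t = 0. -/
theorem norm_toDom_le_of_majorants {α s : ℝ} (hs : 0 ≤ s) {p : TPoly × ℝ}
    (hp : p ∈ majorants (2 * α) s) : ‖toDom α (evalZ p.1)‖ ≤ √vol * p.2 := by
  rw [← toDomL_apply]
  induction hp using AddSubmonoid.closure_induction with
  | mem p hp =>
    obtain ⟨m, v, k, θ, a, hk, hv, hpv, hb⟩ := hp
    rw [hpv, evalZ_apply, Finsupp.single_apply]
    have hb0 : 0 ≤ p.2 := (atom_weight_nonneg hs m k a).trans hb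
    split_ifs with hm
    · subst hm
      obtain ⟨n, hn⟩ := norm_wave_sq k
      rw [toDomL_apply, norm_toDom_of_mem α (eig_of_mode hv hn)]
      have h1 : toL2 v = trigToL2 ⟨mode k θ a, mode_mem k θ a⟩ := congrArg trigToL2 (Subtype.ext hv)
      have h2 : (n : ℝ) ^ α = ‖wave k‖ ^ (2 * α) := by
        rw [← hn, ← Real.rpow_natCast, ← Real.rpow_mul (norm_nonneg _)]
        norm_num
      rw [Nat.factorial_zero, Nat.cast_one, pow_zero, one_mul, one_mul] at hb
      rw [h1, h2]
      calc _ ≤ ‖wave k‖ ^ (2 * α) * (√vol * ‖a‖) := by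
            gcongr
            exact norm_trigToL2_mode_le k θ a
        _ = √vol * (‖wave k‖ ^ (2 * α) * ‖a‖) := by ring
        _ ≤ _ := by gcongr
    · rw [map_zero, norm_zero]
      positivity
  | zero => simp
  | add y z _ _ h h' =>
    rw [Prod.fst_add, Prod.snd_add, map_add, map_add, mul_add]
    exact (norm_add_le _ _).trans (add_le_add h h')

theorem single_evalZ_mem_majorants {r s : ℝ} (hs : 0 ≤ s) {p : TPoly × ℝ}
    (hp : p ∈ majorants r s) : (Finsupp.single 0 (evalZ p.1), p.2) ∈ majorants r s := by
  induction hp using AddSubmonoid.closure_induction with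
  | mem p hp =>
    obtain ⟨m, v, k, θ, a, hk, hv, hpv, hb⟩ := id hp
    rw [hpv, evalZ_apply, Finsupp.single_apply]
    split_ifs with hm
    · subst hm
      rw [← hpv]
      exact AddSubmonoid.subset_closure hp
    · rw [Finsupp.single_zero]
      exact zero_mem_majorants r s ((atom_weight_nonneg hs m k a).trans hb)
  | zero => simpa using zero_mem_majorants r s le_rfl
  | add y z _ _ h h' =>
    have := add_mem h h'
    simpa only [Prod.fst_add, Prod.snd_add, map_add, Finsupp.single_add, Prod.mk_add_mk] using this

/-- The projection onto an eigenspace keeps a mode or kills it, so it never increases a weight. -/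
theorem single_projV_mem_majorants {r s : ℝ} (hs : 0 ≤ s) (j : ℕ) {p : TPoly × ℝ}
    (hp : p ∈ majorants r s) : (Finsupp.single 0 (projV j (evalZ p.1)), p.2) ∈ majorants r s := by
  induction hp using AddSubmonoid.closure_induction with
  | mem p hp =>
    obtain ⟨m, v, k, θ, a, hk, hv, hpv, hb⟩ := id hp
    obtain ⟨n, hn⟩ := norm_wave_sq k
    have hb0 := (atom_weight_nonneg hs m k a).trans hb
    rw [hpv, evalZ_apply, Finsupp.single_apply]
    split_ifs with hm
    · subst hm
      rw [projV_of_mem (eig_of_mode hv hn)]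
      split_ifs
      · rw [← hpv]
        exact AddSubmonoid.subset_closure hp
      · rw [Finsupp.single_zero]
        exact zero_mem_majorants r s hb0
    · rw [map_zero, Finsupp.single_zero]
      exact zero_mem_majorants r s hb0
  | zero => simpa using zero_mem_majorants r s le_rfl
  | add y z _ _ h h' =>
    have := add_mem h h'
    simpa only [Prod.fst_add, Prod.snd_add, map_add, Finsupp.single_add, Prod.mk_add_mk] using this

/-! ### Bounded families of multilinear maps into `𝒱` -/

/-- `MulBound d G`: the family `G j` of `d`-linear maps has majorants whose sum over `j` is
controlled by the product of the sums of the majorants of the arguments. -/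
def MulBound (d : ℕ) (G : ℕ → MultilinearMap ℝ (fun _ : Fin d => SA) VV) : Prop :=
  ∀ r : ℝ, 0 ≤ r → ∃ C : ℝ, 0 ≤ C ∧ ∀ (x : Fin d → SA) (A : Fin d → ℕ → ℝ),
    (∀ i k, (Finsupp.single 0 (x i k : VV), A i k) ∈ majorants (r + d - 1) (2 ^ (d - 1) * 2)) →
    ∃ b : ℕ → ℝ, (∀ j, (Finsupp.single 0 (G j x), b j) ∈ majorants r 2) ∧
      ∀ J, ∑ j ∈ Finset.range J, b j ≤ C * ∏ i, ∑ k ∈ Finset.range J, A i k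

theorem mulBound_of_convBound {d : ℕ} {f : ℕ → (ℕ → SA) → TPoly} (hf : ConvBound d f)
    {G : ℕ → MultilinearMap ℝ (fun _ : Fin d => SA) VV}
    (hG : ∀ (j : ℕ) (x : Fin d → SA) (b : ℝ) (r : ℝ), (f j (extend x), b) ∈ majorants r 2 →
      (Finsupp.single 0 (G j x), b) ∈ majorants r 2) : MulBound d G := by
  intro r hr
  obtain ⟨C, hC0, hC⟩ := hf r 2 hr le_rfl
  refine ⟨C, hC0, fun x A hA => ?_⟩
  have hA' : ∀ i k, (Finsupp.single 0 (extend x i k : VV), if h : i < d then A ⟨i, h⟩ k else 0)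
      ∈ majorants (r + d - 1) (2 ^ (d - 1) * 2) := by
    intro i k
    by_cases h : i < d
    · simpa [extend, h] using hA ⟨i, h⟩ k
    · simpa [extend, h] using zero_mem_majorants _ _ le_rfl
  obtain ⟨b, hb, hbs⟩ := hC (extend x) _ hA'
  refine ⟨b, fun j => hG j x _ r (hb j), fun J => (hbs J).trans_eq ?_⟩
  rw [Finset.prod_range]
  simp

theorem polP_mulBound {d : ℕ} (hd : 0 < d) : MulBound d (polP d) :=
  mulBound_of_convBound (homT_convBound hd) fun j x _ _ h => by
    have := single_evalZ_mem_majorants zero_le_two h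
    rwa [polP_apply]

theorem polB_mulBound (d : ℕ) : MulBound d (polB d) :=
  mulBound_of_convBound (betaT_convBound fun _ h0 _ => homT_convBound h0) fun j x _ _ h => by
    have := single_projV_mem_majorants zero_le_two j h
    rwa [polB_apply]

/-- `DomBound d G`: the norms of `G j` from `D(A^{α + 3d/2})` to `D(A^α)` have a bounded sum. -/
def DomBound (d : ℕ) (G : ℕ → MultilinearMap ℝ (fun _ : Fin d => SA) VV) : Prop :=
  ∀ α : ℝ, 0 ≤ α → ∃ M : ℝ, 0 < M ∧ ∀ (x : Fin d → Dom (α + 3 * d / 2)) (J : ℕ),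
    ∑ j ∈ Finset.range J, ‖toDom α (G j fun i => comps (x i).val)‖ ≤ M * ∏ i, ‖x i‖

theorem rpow_mul_norm_R_le_rpow {β : ℝ} (ξ : Dom β) (e : ℝ) (n : ℕ) :
    (n : ℝ) ^ e * ‖toL2 (R n ξ.val)‖ ≤ (n : ℝ) ^ (e - β) * ‖ξ‖ := by
  rcases Nat.eq_zero_or_pos n with rfl | hn
  · rw [eig_zero (R 0 ξ.val).2, map_zero, norm_zero, mul_zero]
    positivity
  have hn0 : (0 : ℝ) < n := by exact_mod_cast hn
  have h := rpow_mul_norm_R_le ξ n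
  calc _ = (n : ℝ) ^ (e - β) * ((n : ℝ) ^ β * ‖toL2 (R n ξ.val)‖) := by
        rw [← mul_assoc, ← Real.rpow_add hn0, sub_add_cancel]
    _ ≤ _ := by gcongr

theorem exists_sum_rpow_mul_norm_R_le {e β : ℝ} (h : e - β < -1) :
    ∃ S : ℝ, 0 < S ∧ ∀ (ξ : Dom β) (J : ℕ),
      ∑ n ∈ Finset.range J, (n : ℝ) ^ e * ‖toL2 (R n ξ.val)‖ ≤ S * ‖ξ‖ := by
  have hs : Summable fun n : ℕ => (n : ℝ) ^ (e - β) := Real.summable_nat_rpow.2 h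
  have h0 : 0 ≤ ∑' n : ℕ, (n : ℝ) ^ (e - β) := tsum_nonneg fun n => by positivity
  -- The summand 1 makes positivity of the constant immediate.
  refine ⟨∑' n : ℕ, (n : ℝ) ^ (e - β) + 1, by positivity, fun ξ J => ?_⟩
  calc _ ≤ ∑ n ∈ Finset.range J, (n : ℝ) ^ (e - β) * ‖ξ‖ :=
        Finset.sum_le_sum fun n _ => rpow_mul_norm_R_le_rpow ξ e n
    _ = (∑ n ∈ Finset.range J, (n : ℝ) ^ (e - β)) * ‖ξ‖ := (Finset.sum_mul ..).symm
    _ ≤ _ := by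
      gcongr
      have := hs.sum_le_tsum (Finset.range J) fun n _ => by positivity
      linarith

/-- The exponent count is 1 + (2α + d - 1)/2 - (α + 3d/2) = 1/2 - d, which is below -1 because d ≥
2. -/
theorem domBound_of_mulBound {d : ℕ} (hd : 2 ≤ d)
    {G : ℕ → MultilinearMap ℝ (fun _ : Fin d => SA) VV} (hG : MulBound d G) : DomBound d G := by
  intro α hα
  obtain ⟨C, hC0, hC⟩ := hG (2 * α) (by linarith)
  have hd' : (2 : ℝ) ≤ d := by exact_mod_cast hd
  obtain ⟨S, hS0, hS⟩ := exists_sum_rpow_mul_norm_R_le (e := 1 + (2 * α + d - 1) / 2)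
    (β := α + 3 * d / 2) (by linarith)
  have hvol := vol_pos
  set K : ℝ := 54 * (vol⁻¹ * √vol) with hK
  have hK0 : 0 < K := by positivity
  -- √vol converts weights into L² norms, K S is the cost of each argument, and C + 1 replaces C to
  -- make the constant positive.
  refine ⟨√vol * ((C + 1) * (K * S) ^ d), by positivity, fun x J => ?_⟩
  obtain ⟨b, hb, hbs⟩ := hC (fun i => comps (x i).val)
    (fun i k => K * ((k : ℝ) ^ (1 + (2 * α + d - 1) / 2) * ‖toL2 (R k (x i).val)‖))
    (fun i k => eig_mem_majorants (by positivity) (R k (x i).val).2)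
  have h1 : ∀ j, ‖toDom α (G j fun i => comps (x i).val)‖ ≤ √vol * b j := by
    intro j
    have := norm_toDom_le_of_majorants zero_le_two (hb j)
    simpa [evalZ_apply] using this
  calc _ ≤ ∑ j ∈ Finset.range J, √vol * b j := Finset.sum_le_sum fun j _ => h1 j
    _ = √vol * ∑ j ∈ Finset.range J, b j := (Finset.mul_sum ..).symm
    _ ≤ √vol * (C * ∏ i, ∑ k ∈ Finset.range J,
        K * ((k : ℝ) ^ (1 + (2 * α + d - 1) / 2) * ‖toL2 (R k (x i).val)‖)) := by
        gcongr
        exact hbs J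
    _ ≤ √vol * ((C + 1) * ∏ i, (K * S * ‖x i‖)) := by
        gcongr with i
        · linarith
        · rw [← Finset.mul_sum, mul_assoc K S]
          exact mul_le_mul_of_nonneg_left (hS (x i) J) hK0.le
    _ = _ := by
        rw [Finset.prod_mul_distrib, Finset.prod_const, Finset.card_univ, Fintype.card_fin]
        ring

theorem polP_one (j : ℕ) (x : Fin 1 → SA) : polP 1 j x = x 0 j := by
  rw [polP_apply, homT_one, evalZ_apply, Finsupp.single_eq_same]
  simp [extend]

/-- For d = 1 counting Fourier modes would leave the divergent sum of n^{-1/2}. But P_j^{[1]}(ξ) is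
R_j ξ, and n^α |R_n ξ| ≤ n^{-3/2} |A^{α+3/2} ξ| is summable directly. -/
theorem polP_domBound {d : ℕ} (hd : 1 ≤ d) : DomBound d (polP d) := by
  rcases hd.eq_or_lt with rfl | hd
  · intro α _
    obtain ⟨S, hS0, hS⟩ := exists_sum_rpow_mul_norm_R_le (e := α)
      (β := α + 3 * ((1 : ℕ) : ℝ) / 2) (by norm_num)
    refine ⟨S, hS0, fun x J => ?_⟩
    simp only [polP_one, Fin.prod_univ_one]
    refine (Finset.sum_congr rfl fun j _ => ?_).trans_le (hS (x 0) J)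
    exact norm_toDom_of_mem α (R j (x 0).val).2
  · exact domBound_of_mulBound hd (polP_mulBound (by omega))

/-! ### Spectral expansion and completeness of `D(A^α)` -/

theorem inner_of_mem_eig {m n : ℕ} (h : m ≠ n) {v w : VV} (hv : v ∈ eig m) (hw : w ∈ eig n) :
    ⟪toL2 v, toL2 w⟫ = 0 := shell_orth h (eig_shell hv) (eig_shell hw)

theorem norm_sq_sum_eig (w : ∀ n, eig n) (s : Finset ℕ) :
    ‖∑ n ∈ s, toL2 (w n)‖ ^ 2 = ∑ n ∈ s, ‖toL2 (w n)‖ ^ 2 := by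
  rw [← real_inner_self_eq_norm_sq, sum_inner]
  refine Finset.sum_congr rfl fun n hn => ?_
  rw [inner_sum, Finset.sum_eq_single n]
  · exact real_inner_self_eq_norm_sq _
  · intro m _ hm
    exact inner_of_mem_eig hm.symm (w n).2 (w m).2
  · exact fun h => absurd hn h

/-- Bessel's inequality: the squared norm of the partial sum is its inner product with z. -/
theorem norm_sum_R_le (s : Finset ℕ) (z : L2) : ‖∑ n ∈ s, toL2 (R n z)‖ ≤ ‖z‖ := by
  set y := ∑ n ∈ s, toL2 (R n z) with hy
  have h1 : ‖y‖ ^ 2 = ⟪z, y⟫ := by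
    rw [hy, norm_sq_sum_eig (fun n => R n z), inner_sum]
    refine Finset.sum_congr rfl fun n _ => ?_
    rw [← inner_R z (R n z).2, real_inner_self_eq_norm_sq]
  have h2 : ‖y‖ ^ 2 ≤ ‖z‖ * ‖y‖ := h1 ▸ real_inner_le_norm z y
  rcases (norm_nonneg y).eq_or_lt with h | h
  · rw [← h]
    positivity
  · nlinarith

theorem sum_R_toL2 (v : VV) : HasSum (fun n => toL2 (R n (toL2 v))) (toL2 v) := by
  have hv : v ∈ ⨆ n, eig n := by rw [iSup_eig]; trivial
  induction hv using Submodule.iSup_induction' with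
  | mem m x hx =>
    have h := hasSum_single (f := fun n => toL2 (R n (toL2 x))) m fun n hn => by
      rw [← projV_apply, projV_of_mem hx, if_neg hn, map_zero]
    rwa [← projV_apply, projV_of_mem hx, if_pos rfl] at h
  | zero => simp
  | add x y _ _ h1 h2 => simpa only [map_add, Submodule.coe_add] using h1.add h2

/-- The partial sums are contractions and converge on the dense subspace 𝒱, where only finitely many
terms are nonzero. -/
theorem hasSum_R {z : L2} (hz : z ∈ H) : HasSum (fun n => toL2 (R n z)) z := by
  rw [HasSum, SummationFilter.unconditional_filter, Metric.tendsto_atTop]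
  intro ε hε
  have hcl : z ∈ closure (LinearMap.range toL2 : Set L2) := hz
  obtain ⟨_, ⟨v, rfl⟩, hv⟩ := Metric.mem_closure_iff.1 hcl (ε / 3) (by positivity)
  have h := sum_R_toL2 v
  rw [HasSum, SummationFilter.unconditional_filter, Metric.tendsto_atTop] at h
  obtain ⟨s, hs⟩ := h (ε / 3) (by positivity)
  refine ⟨s, fun t ht => ?_⟩
  have h1 := hs t ht
  have h2 : dist (∑ n ∈ t, toL2 (R n z)) (∑ n ∈ t, toL2 (R n (toL2 v))) ≤ dist z (toL2 v) := by
    rw [dist_eq_norm, dist_eq_norm, ← Finset.sum_sub_distrib]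
    refine le_trans (le_of_eq ?_) (norm_sum_R_le t (z - toL2 v))
    congr 1
    exact Finset.sum_congr rfl fun n _ => by rw [map_sub, Submodule.coe_sub, map_sub]
  calc _ ≤ dist (∑ n ∈ t, toL2 (R n z)) (∑ n ∈ t, toL2 (R n (toL2 v)))
        + dist (∑ n ∈ t, toL2 (R n (toL2 v))) (toL2 v) + dist (toL2 v) z := dist_triangle4 ..
    _ < ε := by
      rw [dist_comm (toL2 v) z]
      linarith

/-- All nonzero eigencomponents belong to eigenvalues n ≥ 1, where n^α ≥ 1. -/
theorem norm_val_le {α : ℝ} (hα : 0 ≤ α) (ξ : Dom α) : ‖ξ.val‖ ≤ ‖ξ‖ := by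
  have hξ : ξ.val ∈ domA α := ξ.2
  have h1 : Filter.Tendsto (fun s : Finset ℕ => ‖∑ n ∈ s, toL2 (R n ξ.val)‖ ^ 2) Filter.atTop
      (nhds (‖ξ.val‖ ^ 2)) := by
    have := (hasSum_R hξ.1)
    rw [HasSum, SummationFilter.unconditional_filter] at this
    exact (this.norm).pow 2
  have h2 : Filter.Tendsto
      (fun s : Finset ℕ => ‖∑ n ∈ s, (n : ℝ) ^ α • toL2 (R n ξ.val)‖ ^ 2) Filter.atTop
      (nhds (‖ξ‖ ^ 2)) := by
    have := hξ.2.hasSum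
    rw [HasSum, SummationFilter.unconditional_filter] at this
    exact (this.norm).pow 2
  refine abs_le_of_sq_le_sq' (le_of_tendsto_of_tendsto' h1 h2 fun s => ?_) (norm_nonneg _) |>.2
  have e := norm_sq_sum_eig (fun n => (n : ℝ) ^ α • R n ξ.val) s
  simp only [Submodule.coe_smul, map_smul] at e
  rw [norm_sq_sum_eig (fun n => R n ξ.val), e]
  refine Finset.sum_le_sum fun n _ => ?_
  rcases Nat.eq_zero_or_pos n with rfl | hn
  · rw [eig_zero (R 0 ξ.val).2]
    simp
  · rw [norm_smul, Real.norm_of_nonneg (by positivity)]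
    gcongr
    exact le_mul_of_one_le_left (norm_nonneg _)
      (Real.one_le_rpow (by exact_mod_cast hn) hα)

/-- This is the closedness of A^α. If u sums v_j and z sums A^α v_j in L², then R_n z = n^α R_n u
for every n; expanding z in its components shows that u lies in the domain and A^α u = z. -/
theorem exists_hasSum_toDom {α : ℝ} (hα : 0 ≤ α) {v : ℕ → VV}
    (hv : Summable fun j => ‖toDom α (v j)‖) :
    ∃ u : Dom α, HasSum (fun j => toDom α (v j)) u ∧ HasSum (fun j => toL2 (v j)) u.val := by
  have h1 : Summable fun j => toL2 (v j) :=
    Summable.of_norm (hv.of_nonneg_of_le (fun _ => norm_nonneg _)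
      fun j => norm_val_le hα (toDom α (v j)))
  have h2 : Summable fun j => powA α (toL2 (v j)) := Summable.of_norm hv
  set u := ∑' j, toL2 (v j) with hu
  set z := ∑' j, powA α (toL2 (v j)) with hz
  have hH : ∀ {f : ℕ → L2}, (∀ j, f j ∈ H) → ∑' j, f j ∈ H := fun hf =>
    tsum_mem (Submodule.isClosed_topologicalClosure _) hf
  have huH : u ∈ H := hH fun j => toL2_mem (v j)
  have hzH : z ∈ H := hH fun j => hH fun n => Submodule.smul_mem _ _ (toL2_mem _)
  have hR : ∀ n, toL2 (R n z) = (n : ℝ) ^ α • toL2 (R n u) := by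
    intro n
    rw [toL2_R, toL2_R, hz, hu, ContinuousLinearMap.map_tsum _ h2, ContinuousLinearMap.map_tsum _ h1,
      ← tsum_const_smul'']
    refine tsum_congr fun j => ?_
    rw [← toL2_R, ← toL2_R, toL2_R_powA (toL2_mem_domA α (v j))]
  have hsum : HasSum (fun n : ℕ => (n : ℝ) ^ α • toL2 (R n u)) z := by
    simpa only [hR] using hasSum_R hzH
  obtain ⟨w, hw⟩ : ∃ w : Dom α, w.val = u := ⟨⟨u, huH, hsum.summable⟩, rfl⟩
  have hpow : Dom.pow α w = z := by
    change powA α w.val = z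
    rw [hw]
    exact hsum.tsum_eq
  refine ⟨w, ?_, hw ▸ h1.hasSum⟩
  -- The norm of D(A^α) is pulled back along A^α, so convergence may be checked after applying A^α.
  have hind : Topology.IsInducing (Dom.pow α) := ⟨rfl⟩
  refine (hind.hasSum_iff _ _).1 ?_
  rw [hpow]
  exact h2.hasSum

/-! ### Convergence in `D(A^α)` -/

theorem comps_add (x y : L2) : comps (x + y) = comps x + comps y := funext fun j => map_add (R j) x y

theorem comps_smul (c : ℝ) (x : L2) : comps (c • x) = c • comps x :=
  funext fun j => map_smul (R j) c x

theorem comps_update {X : Type*} [AddCommGroup X] [Module ℝ X] (φ : X →ₗ[ℝ] L2) {d : ℕ}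
    [DecidableEq (Fin d)] (x : Fin d → X) (i : Fin d) (y : X) :
    (fun i' => comps (φ (Function.update x i y i')))
      = Function.update (fun i' => comps (φ (x i'))) i (comps (φ y)) := by
  funext i'
  by_cases h : i' = i
  · subst h
    simp
  · simp [h]

theorem summable_toDom {d : ℕ} {G : ℕ → MultilinearMap ℝ (fun _ : Fin d => SA) VV} {α M : ℝ}
    (hM : ∀ (x : Fin d → Dom (α + 3 * d / 2)) (J : ℕ),
      ∑ j ∈ Finset.range J, ‖toDom α (G j fun i => comps (x i).val)‖ ≤ M * ∏ i, ‖x i‖)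
    (x : Fin d → Dom (α + 3 * d / 2)) :
    Summable fun j => ‖toDom α (G j fun i => comps (x i).val)‖ :=
  summable_of_sum_range_le (fun _ => norm_nonneg _) (hM x)

/-- Multilinearity passes from the terms to the sum by uniqueness of limits, and the summed bound
gives continuity. -/
theorem exists_multilinear_dom {d : ℕ} {G : ℕ → MultilinearMap ℝ (fun _ : Fin d => SA) VV}
    (hG : DomBound d G) {α : ℝ} (hα : 0 ≤ α) :
    ∃ Q : ContinuousMultilinearMap ℝ (fun _ : Fin d => Dom (α + 3 * d / 2)) (Dom α),
      ∀ x, HasSum (fun j => toDom α (G j fun i => comps (x i).val)) (Q x) ∧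
        HasSum (fun j => toL2 (G j fun i => comps (x i).val)) (Q x).val := by
  obtain ⟨M, hM0, hM⟩ := hG α hα
  have hs := summable_toDom hM
  choose Q hQ hQ' using fun x => exists_hasSum_toDom hα (hs x)
  let Qm : MultilinearMap ℝ (fun _ : Fin d => Dom (α + 3 * d / 2)) (Dom α) :=
    { toFun := Q
      map_update_add' := by
        intro _ x i y z
        refine (hQ _).unique ?_
        convert! (hQ (Function.update x i y)).add (hQ (Function.update x i z)) using 1
        funext j
        simp only [comps_update, map_add, comps_add, MultilinearMap.map_update_add,
          ← toDomL_apply]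
      map_update_smul' := by
        intro _ x i c y
        refine (hQ _).unique ?_
        convert! (hQ (Function.update x i y)).const_smul c using 1
        funext j
        simp only [comps_update, map_smul, comps_smul, MultilinearMap.map_update_smul,
          ← toDomL_apply] }
  refine ⟨Qm.mkContinuous M fun x => ?_, fun x => ⟨hQ x, hQ' x⟩⟩
  change ‖Q x‖ ≤ _
  rw [← (hQ x).tsum_eq]
  exact (norm_tsum_le_tsum_norm (hs x)).trans ((hs x).tsum_le_of_sum_range_le (hM x))

/-- As the terms below d vanish, the sums started at any m ≤ d coincide with the full one. This
covers both P^{[d]}, started at d, and B^{[d]}, started at 1. -/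
theorem hasSum_Ici {Y : Type*} [AddCommMonoid Y] [TopologicalSpace Y] {m d : ℕ} (hm : m ≤ d)
    {f : ℕ → Y} {y : Y} (hf : ∀ j < d, f j = 0) (hy : HasSum f y) :
    HasSum (fun j : Set.Ici m => f j) y := by
  refine (hasSum_subtype_iff_of_support_subset fun j hj => ?_).2 hy
  by_contra h
  exact hj (hf j (lt_of_lt_of_le (not_le.1 h) hm))

theorem dom_convergence {d : ℕ} {G : ℕ → MultilinearMap ℝ (fun _ : Fin d => SA) VV}
    (hG : DomBound d G) (h0 : ∀ j < d, ∀ x, G j x = 0) {m : ℕ} (hm : m ≤ d) {α : ℝ} (hα : 0 ≤ α) :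
    ∃ F : Dom (α + 3 * d / 2) → Dom α,
      (∀ ξ, (F ξ).val = ∑' j : Set.Ici m, toL2 (G j fun _ => comps ξ.val)) ∧
      (∀ ξ, HasSum (fun j : Set.Ici m => toDom α (G j fun _ => comps ξ.val)) (F ξ)) ∧
      IsContHomPoly d F ∧
      ∃ M : ℝ, 0 < M ∧ ∀ ξ,
        Summable (fun j : Set.Ici m => ‖toDom α (G j fun _ => comps ξ.val)‖) ∧
        ‖F ξ‖ ≤ ∑' j : Set.Ici m, ‖toDom α (G j fun _ => comps ξ.val)‖ ∧
        ∑' j : Set.Ici m, ‖toDom α (G j fun _ => comps ξ.val)‖ ≤ M * ‖ξ‖ ^ d := by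
  obtain ⟨Q, hQ⟩ := exists_multilinear_dom hG hα
  obtain ⟨M, hM0, hM⟩ := hG α hα
  have hz : ∀ j < d, ∀ x, toDom α (G j x) = 0 := fun j hj x => by
    rw [h0 j hj, ← toDomL_apply, map_zero]
  have hsum : ∀ ξ : Dom (α + 3 * d / 2),
      HasSum (fun j : Set.Ici m => toDom α (G j fun _ => comps ξ.val)) (Q fun _ => ξ) := fun ξ =>
    hasSum_Ici hm (fun j hj => hz j hj _) (hQ fun _ => ξ).1
  have hns : ∀ ξ : Dom (α + 3 * d / 2), HasSum
      (fun j : Set.Ici m => ‖toDom α (G j fun _ => comps ξ.val)‖)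
      (∑' j, ‖toDom α (G j fun _ => comps ξ.val)‖) := fun ξ =>
    hasSum_Ici hm (fun j hj => by rw [hz j hj, norm_zero]) (summable_toDom hM fun _ => ξ).hasSum
  refine ⟨fun ξ => Q fun _ => ξ, fun ξ => ?_, hsum, ⟨Q, fun _ => rfl⟩, M, hM0, fun ξ =>
    ⟨(hns ξ).summable, ?_, ?_⟩⟩
  · exact (hasSum_Ici hm (fun j hj => by rw [h0 j hj, map_zero]) (hQ fun _ => ξ).2).tsum_eq.symm
  · change ‖Q fun _ => ξ‖ ≤ _
    rw [← (hsum ξ).tsum_eq]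
    exact norm_tsum_le_tsum_norm (hns ξ).summable
  · rw [(hns ξ).tsum_eq]
    refine ((summable_toDom hM fun _ => ξ).tsum_le_of_sum_range_le (hM fun _ => ξ)).trans_eq ?_
    simp

/-! ### Integration by parts for smooth periodic fields -/

/-- The basis vectors of `ℝ³`. -/
def basisVec (i : Fin 3) : E3 := EuclideanSpace.single i 1

theorem integral_cell_eq (f : E3 → ℝ) :
    ∫ x in cell, f x = ∫ y in Set.Icc (0 : Fin 3 → ℝ) (fun _ => 2 * Real.pi), f (WithLp.toLp 2 y) := by
  have h : ∫ x in cell, f x = ∫ y in Set.univ.pi fun _ : Fin 3 => Set.Ico 0 (2 * Real.pi),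
      f (WithLp.toLp 2 y) := by
    rw [cell_eq]
    exact (PiLp.volume_preserving_ofLp (Fin 3)).setIntegral_preimage_emb
      (MeasurableEquiv.toLp 2 (Fin 3 → ℝ)).symm.measurableEmbedding
      (fun y => f (WithLp.toLp 2 y)) _
  rw [h]
  exact setIntegral_congr_set Measure.univ_pi_Ico_ae_eq_Icc

/-- The divergence theorem on the cube: by periodicity the integrals over opposite faces cancel. -/
theorem integral_divergence_periodic {g : Fin 3 → E3 → ℝ} (hg : ∀ i, ContDiff ℝ 1 (g i))
    (hp : ∀ i x, g i (x + EuclideanSpace.single i (2 * Real.pi)) = g i x) :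
    ∫ x in cell, ∑ i, fderiv ℝ (g i) x (basisVec i) = 0 := by
  rw [integral_cell_eq]
  let eL : (Fin 3 → ℝ) →L[ℝ] E3 := (PiLp.continuousLinearEquiv 2 ℝ fun _ : Fin 3 => ℝ).symm
  have heL : ∀ y, eL y = WithLp.toLp 2 y := fun y => rfl
  have hcd : ∀ i, Continuous (fderiv ℝ (g i)) := fun i => (hg i).continuous_fderiv (by simp)
  have hb : ∀ i, eL (Pi.single i 1) = basisVec i := by
    intro i
    rfl
  have h := integral_divergence_of_hasFDerivAt_off_countable' (0 : Fin 3 → ℝ)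
    (fun _ => 2 * Real.pi) (fun i => Real.two_pi_pos.le) (fun i y => g i (eL y))
    (fun i y => (fderiv ℝ (g i) (eL y)).comp eL) ∅ Set.countable_empty
    (fun i => ((hg i).continuous.comp eL.continuous).continuousOn)
    (fun y _ i => ((hg i).differentiable (by simp) (eL y)).hasFDerivAt.comp y eL.hasFDerivAt)
    (by
      refine Continuous.integrableOn_Icc ?_
      have := fun i => (hcd i).comp eL.continuous
      simp only [ContinuousLinearMap.comp_apply]
      refine continuous_finsetSum _ fun i _ => ?_
      exact (this i).clm_apply continuous_const)
  simp only [ContinuousLinearMap.comp_apply, hb, heL] at h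
  rw [h]
  refine Finset.sum_eq_zero fun i _ => ?_
  rw [sub_eq_zero]
  congr 1
  funext y
  rw [← hp i (WithLp.toLp 2 (Fin.insertNth i ((0 : Fin 3 → ℝ) i) y))]
  congr 1
  ext j
  rcases Fin.eq_self_or_eq_succAbove i j with rfl | ⟨j, rfl⟩
  · simp
  · simp [Fin.succAbove_ne]

theorem contDiff_partial {f : E3 → E3} (hf : ContDiff ℝ ∞ f) (h : E3) :
    ContDiff ℝ ∞ fun x => fderiv ℝ f x h :=
  (hf.fderiv_right (m := ∞) (by simp)).clm_apply contDiff_const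

theorem laplacian_eq_sum {f : E3 → E3} (hf : ContDiff ℝ ∞ f) (x : E3) :
    Δ f x = ∑ i, fderiv ℝ (fun y => fderiv ℝ f y (basisVec i)) x (basisVec i) := by
  rw [InnerProductSpace.laplacian_eq_iteratedFDeriv_orthonormalBasis _
    (EuclideanSpace.basisFun (Fin 3) ℝ)]
  refine Finset.sum_congr rfl fun i _ => ?_
  have hdd : DifferentiableAt ℝ (fderiv ℝ f) x :=
    (hf.fderiv_right (m := 1) (by norm_cast)).differentiable (by simp) x
  have h := (hdd.hasFDerivAt.clm_apply (hasFDerivAt_const (basisVec i) x)).fderiv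
  rw [h]
  simp [iteratedFDeriv_two_apply, basisVec]

theorem contDiff_laplacian {f : E3 → E3} (hf : ContDiff ℝ ∞ f) : ContDiff ℝ ∞ (Δ f) := by
  have : Δ f = fun x => ∑ i, fderiv ℝ (fun y => fderiv ℝ f y (basisVec i)) x (basisVec i) :=
    funext (laplacian_eq_sum hf)
  rw [this]
  exact ContDiff.sum fun i _ => contDiff_partial (contDiff_partial hf _) _

theorem partial_periodic {f : E3 → E3} (hp : IsPeriodic f) (h : E3) :
    IsPeriodic fun x => fderiv ℝ f x h := by
  intro x i
  have e : (fun y => f (y + EuclideanSpace.single i (2 * Real.pi))) = f := funext fun y => hp y i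
  have := fderiv_comp_add_right (𝕜 := ℝ) (f := f) (x := x) (EuclideanSpace.single i (2 * Real.pi))
  rw [e] at this
  simp only [this]

theorem laplacian_periodic {f : E3 → E3} (hf : ContDiff ℝ ∞ f) (hp : IsPeriodic f) :
    IsPeriodic (Δ f) := by
  intro x i
  rw [laplacian_eq_sum hf, laplacian_eq_sum hf]
  exact Finset.sum_congr rfl fun l _ => partial_periodic (partial_periodic hp _) _ x i

/-- Green's second identity: the field with components ⟨f, ∂_i w⟩ - ⟨∂_i f, w⟩ is periodic, and the
products of first derivatives cancel in its divergence. -/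
theorem integral_inner_laplacian {f w : E3 → E3} (hf : ContDiff ℝ ∞ f) (hfp : IsPeriodic f)
    (hw : ContDiff ℝ ∞ w) (hwp : IsPeriodic w) :
    ∫ x in cell, ⟪f x, Δ w x⟫ = ∫ x in cell, ⟪Δ f x, w x⟫ := by
  have hD : ∀ {u : E3 → E3}, ContDiff ℝ ∞ u → Differentiable ℝ u := fun h =>
    h.differentiable (by simp)
  have hC : ∀ {u v : E3 → E3}, ContDiff ℝ ∞ u → ContDiff ℝ ∞ v →
      Integrable (fun x => ⟪u x, v x⟫) (volume.restrict cell) := fun hu hv =>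
    integrable_cell (hu.continuous.inner hv.continuous)
  have h := integral_divergence_periodic
    (g := fun i x => ⟪f x, fderiv ℝ w x (basisVec i)⟫ - ⟪fderiv ℝ f x (basisVec i), w x⟫)
    (fun i => (((hf.inner ℝ (contDiff_partial hw _)).sub
      ((contDiff_partial hf _).inner ℝ hw)).of_le (by norm_cast)))
    (fun i x => by
      have h1 := partial_periodic hfp (basisVec i) x i
      have h2 := partial_periodic hwp (basisVec i) x i
      simp only at h1 h2
      rw [h1, h2, hfp x i, hwp x i])
  rw [← sub_eq_zero, ← integral_sub (hC hf (contDiff_laplacian hw)) (hC (contDiff_laplacian hf) hw),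
    ← h]
  congr 1
  funext x
  rw [laplacian_eq_sum hf, laplacian_eq_sum hw, inner_sum, sum_inner, ← Finset.sum_sub_distrib]
  refine Finset.sum_congr rfl fun i _ => ?_
  have h1 := ((hD hf x).hasFDerivAt.inner ℝ (hD (contDiff_partial hw (basisVec i)) x).hasFDerivAt)
  have h2 := ((hD (contDiff_partial hf (basisVec i)) x).hasFDerivAt.inner ℝ (hD hw x).hasFDerivAt)
  rw [(h1.fun_sub h2).fderiv]
  simp
  ring

theorem laplacian_of_mem_eig {n : ℕ} {w : VV} (hw : w ∈ eig n) :
    Δ w.1 = (-(n : ℝ)) • w.1 :=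
  congrArg Subtype.val (shell_lap (eig_shell hw))

/-- On the eigenspace Δ acts as -n, so each transfer of a Laplacian to f gains a factor n. -/
theorem integral_inner_decay (m : ℕ) {f : E3 → E3} (hf : ContDiff ℝ ∞ f) (hfp : IsPeriodic f) :
    ∃ C : ℝ, ∀ (n : ℕ) (w : VV), w ∈ eig n →
      (n : ℝ) ^ m * |∫ x in cell, ⟪f x, w.1 x⟫| ≤ C * ‖toL2 w‖ := by
  induction m generalizing f with
  | zero =>
    set F : L2 := (memLp_cell hf.continuous 2).toLp f with hF
    refine ⟨‖F‖, fun n w _ => ?_⟩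
    have h : ∫ x in cell, ⟪f x, w.1 x⟫ = ⟪F, toL2 w⟫ := by
      rw [L2.inner_def]
      refine integral_congr_ae ?_
      filter_upwards [(memLp_cell hf.continuous 2).coeFn_toLp,
        (memLp_cell (trigPoly_continuous w.2.1) 2).coeFn_toLp] with x hx hx'
      change _ = ⟪F x, (memLp_cell (trigPoly_continuous w.2.1) 2).toLp w.1 x⟫
      rw [hF, hx, hx']
    rw [pow_zero, one_mul, h]
    exact abs_real_inner_le_norm _ _
  | succ m ih =>
    obtain ⟨C, hC⟩ := ih (contDiff_laplacian hf) (laplacian_periodic hf hfp)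
    refine ⟨C, fun n w hw => le_trans (le_of_eq ?_) (hC n w hw)⟩
    rw [← integral_inner_laplacian hf hfp (trigPoly_contDiff w.2.1) (trigPoly_periodic w.2.1),
      laplacian_of_mem_eig hw]
    have h : ∀ x, ⟪f x, ((-(n : ℝ)) • w.1) x⟫ = -(n : ℝ) * ⟪f x, w.1 x⟫ := fun x => by
      rw [Pi.smul_apply, inner_smul_right]
    simp_rw [h]
    rw [integral_const_mul, abs_mul, abs_neg, Nat.abs_cast]
    ring

/-- The smooth representative is tested against R_n u itself, where the integral equals |R_n u|²;
one factor |R_n u| is then divided out. -/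
theorem eInf_decay {u : L2} (hu : u ∈ eInf) (m : ℕ) :
    ∃ C : ℝ, ∀ n : ℕ, (n : ℝ) ^ m * ‖toL2 (R n u)‖ ≤ C := by
  obtain ⟨-, f, hf, hfp, hfu⟩ := hu
  obtain ⟨C, hC⟩ := integral_inner_decay m hf hfp
  -- The maximum with 0 handles the indices with R_n u = 0, where nothing can be divided out.
  refine ⟨max C 0, fun n => ?_⟩
  have h := hC n (R n u) (R n u).2
  have h1 : ∫ x in cell, ⟪f x, (R n u).1.1 x⟫ = ‖toL2 (R n u)‖ ^ 2 := by
    rw [← real_inner_self_eq_norm_sq, inner_R u (R n u).2, L2.inner_def]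
    refine integral_congr_ae ?_
    filter_upwards [hfu, (memLp_cell (trigPoly_continuous (R n u).1.2.1) 2).coeFn_toLp] with x hx hx'
    change _ = ⟪u x, (memLp_cell (trigPoly_continuous (R n u).1.2.1) 2).toLp (R n u).1.1 x⟫
    rw [hx, hx']
  rw [h1, abs_of_nonneg (by positivity)] at h
  rcases (norm_nonneg (toL2 (R n u))).eq_or_lt with h0 | h0
  · rw [← h0, mul_zero]
    exact le_max_right _ _
  · refine le_trans (le_of_mul_le_mul_right ?_ h0) (le_max_left _ _)
    calc _ = (n : ℝ) ^ m * ‖toL2 (R n u)‖ ^ 2 := by ring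
      _ ≤ _ := h

theorem eInf_summable {u : L2} (hu : u ∈ eInf) (e : ℝ) :
    Summable fun n : ℕ => (n : ℝ) ^ e * ‖toL2 (R n u)‖ := by
  obtain ⟨m, hm⟩ := exists_nat_ge (e + 2)
  obtain ⟨C, hC⟩ := eInf_decay hu m
  have hs : Summable fun n : ℕ => C * (n : ℝ) ^ (-2 : ℝ) :=
    (Real.summable_nat_rpow.2 (by norm_num)).mul_left C
  refine hs.of_nonneg_of_le (fun n => by positivity) fun n => ?_
  have hC0 : 0 ≤ C := le_trans (by positivity) (hC 0)
  rcases Nat.eq_zero_or_pos n with rfl | hn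
  · rw [eig_zero (R 0 u).2, map_zero, norm_zero, mul_zero]
    positivity
  have hn1 : (1 : ℝ) ≤ n := by exact_mod_cast hn
  calc (n : ℝ) ^ e * ‖toL2 (R n u)‖ ≤ (n : ℝ) ^ (-2 + m : ℝ) * ‖toL2 (R n u)‖ := by
        gcongr
        linarith
    _ = (n : ℝ) ^ (-2 : ℝ) * ((n : ℝ) ^ m * ‖toL2 (R n u)‖) := by
        rw [Real.rpow_add (by linarith), Real.rpow_natCast]
        ring
    _ ≤ (n : ℝ) ^ (-2 : ℝ) * C := by
        gcongr
        exact hC n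
    _ = _ := mul_comm _ _

/-! ### E^∞ inside the spaces D(A^β), and its topology -/

theorem V_le_H : V ≤ H := by
  rintro _ ⟨p, hp, rfl⟩
  have h : (LinearMap.range (toL2.prod gradL2)).topologicalClosure
      ≤ H.comap (LinearMap.fst ℝ L2 _) := by
    refine Submodule.topologicalClosure_minimal _ ?_ ?_
    · rintro _ ⟨v, rfl⟩
      exact toL2_mem v
    · exact (Submodule.isClosed_topologicalClosure _).preimage continuous_fst
  exact h hp

theorem eInf_le_domA (β : ℝ) : eInf ≤ domA β := by
  intro u hu
  refine ⟨V_le_H hu.1, Summable.of_norm ((eInf_summable hu β).congr fun n => ?_)⟩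
  rw [norm_smul, Real.norm_of_nonneg (by positivity)]

/-- The inclusion of `E^∞` in `D(A^β)`. -/
def EInf.toDom (β : ℝ) : EInf →ₗ[ℝ] Dom β := Submodule.inclusion (eInf_le_domA β)

theorem EInf.val_toDom (β : ℝ) (u : EInf) : (EInf.toDom β u).val = u.val := rfl

theorem EInf.pow_toDom (α : ℝ) (u : EInf) : Dom.pow α (EInf.toDom α u) = powA α u.val := rfl

theorem EInf.nhds_eq (u : EInf) : nhds u = ⨅ α : {α : ℝ // 0 ≤ α},
    Filter.comap (fun u : EInf => powA α u.val) (nhds (powA α u.val)) := by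
  refine (nhds_iInf (t := fun α : {α : ℝ // 0 ≤ α} =>
    TopologicalSpace.induced (fun u : EInf => powA α u.val) inferInstance) (a := u)).trans ?_
  exact iInf_congr fun α => nhds_induced _ _

theorem Dom.pow_isInducing (α : ℝ) : Topology.IsInducing (Dom.pow α) := ⟨rfl⟩

/-- E^∞ carries the initial topology of its inclusions in D(A^α), α ≥ 0, so limits can be taken in
each D(A^α) separately. -/
theorem tendsto_EInf {ι : Type*} {l : Filter ι} {f : ι → EInf} {u : EInf} :
    Filter.Tendsto f l (nhds u) ↔
      ∀ α : ℝ, 0 ≤ α → Filter.Tendsto (fun i => EInf.toDom α (f i)) l (nhds (EInf.toDom α u)) := by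
  rw [EInf.nhds_eq, Filter.tendsto_iInf]
  simp only [Filter.tendsto_comap_iff, Subtype.forall, (Dom.pow_isInducing _).tendsto_nhds_iff,
    Function.comp_def, EInf.pow_toDom]

/-! ### Sums of modes in `E^∞` -/

theorem iteratedDeriv_cos_smul (m : ℕ) (θ : ℝ) (a : E3) :
    iteratedDeriv m (fun t : ℝ => Real.cos (t + θ) • a)
      = fun t => Real.cos (t + (θ + m * (Real.pi / 2))) • a := by
  induction m generalizing θ with
  | zero => simp
  | succ m ih =>
    rw [iteratedDeriv_succ']
    have h : deriv (fun t : ℝ => Real.cos (t + θ) • a)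
        = fun t => Real.cos (t + (θ + Real.pi / 2)) • a := by
      funext t
      have h1 : HasDerivAt (fun t : ℝ => Real.cos (t + θ) • a) ((-Real.sin (t + θ) * 1) • a) t :=
        (((hasDerivAt_id t).add_const θ).cos).smul_const a
      rw [h1.deriv, ← add_assoc, Real.cos_add_pi_div_two, mul_one]
    rw [h, ih]
    funext t
    congr 2
    push_cast
    ring

theorem norm_iteratedFDeriv_mode_le (m : ℕ) (k : Fin 3 → ℤ) (θ : ℝ) (a x : E3) :
    ‖iteratedFDeriv ℝ m (mode k θ a) x‖ ≤ ‖wave k‖ ^ m * ‖a‖ := by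
  have hg : ContDiff ℝ ∞ fun t : ℝ => Real.cos (t + θ) • a := by fun_prop
  have e : mode k θ a = (fun t : ℝ => Real.cos (t + θ) • a) ∘ innerSL ℝ (wave k) := rfl
  rw [e, ContinuousLinearMap.iteratedFDeriv_comp_right _ hg x (i := m) (by norm_cast; exact le_top)]
  refine (ContinuousMultilinearMap.norm_compContinuousLinearMap_le _ _).trans ?_
  rw [norm_iteratedFDeriv_eq_norm_iteratedDeriv, iteratedDeriv_cos_smul, Finset.prod_const,
    Finset.card_univ, Fintype.card_fin, innerSL_apply_norm, mul_comm, norm_smul]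
  gcongr
  exact mul_le_of_le_one_left (norm_nonneg a) (Real.abs_cos_le_one _)

/-- Each derivative of a mode costs one factor |k|, so the weight with r = m bounds the derivative
of order m uniformly in x. -/
theorem norm_iteratedFDeriv_le_of_majorants {s : ℝ} (hs : 0 ≤ s) (m : ℕ) {p : TPoly × ℝ}
    (hp : p ∈ majorants m s) (x : E3) : ‖iteratedFDeriv ℝ m (evalZ p.1).1 x‖ ≤ p.2 := by
  induction hp using AddSubmonoid.closure_induction with
  | mem p hp =>
    obtain ⟨i, v, k, θ, a, hk, hv, hpv, hb⟩ := hp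
    rw [hpv, evalZ_apply, Finsupp.single_apply]
    split_ifs with hi
    · subst hi
      rw [hv]
      refine (norm_iteratedFDeriv_mode_le m k θ a x).trans (le_trans (le_of_eq ?_) hb)
      simp
    · have h0 : ((0 : VV) : E3 → E3) = 0 := rfl
      rw [h0, iteratedFDeriv_zero]
      simpa using (atom_weight_nonneg hs i k a).trans hb
  | zero =>
    simp
  | add y z _ _ h h' =>
    have e : (evalZ (y + z).1).1 = (evalZ y.1).1 + (evalZ z.1).1 := by
      rw [Prod.fst_add, map_add]
      rfl
    have hc : ∀ v : VV, ContDiffAt ℝ m v.1 x := fun v =>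
      (trigPoly_contDiff v.2.1).contDiffAt.of_le (by norm_cast; exact le_top)
    rw [e, iteratedFDeriv_add_apply (hc _) (hc _)]
    exact (norm_add_le _ _).trans (add_le_add h h')

/-- Summable majorants at every exponent m make the series converge uniformly with all derivatives,
so the pointwise sum is smooth and periodic. What remains is to identify it with the L² sum and to
place that sum in V. -/
theorem tsum_mem_eInf {v : ℕ → VV}
    (hv : ∀ m : ℕ, ∃ b : ℕ → ℝ, Summable b ∧
      ∀ j, (Finsupp.single 0 (v j), b j) ∈ majorants m 2) :
    ∑' j, toL2 (v j) ∈ eInf := by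
  choose b hb hvb using hv
  have hder : ∀ (m j : ℕ) (x : E3), ‖iteratedFDeriv ℝ m (v j).1 x‖ ≤ b m j := by
    intro m j x
    have := norm_iteratedFDeriv_le_of_majorants zero_le_two m (hvb m j) x
    simpa [evalZ_apply] using this
  have hnorm : ∀ j x, ‖(v j).1 x‖ ≤ b 0 j := fun j x => by
    have := hder 0 j x
    rwa [norm_iteratedFDeriv_zero] at this
  -- Summing among bounded continuous functions links the two sums, because both point evaluation
  -- and the passage to L² are continuous there.
  let φ : ℕ → BoundedContinuousFunction E3 E3 := fun j =>
    BoundedContinuousFunction.ofNormedAddCommGroup (v j).1 (trigPoly_continuous (v j).2.1) (b 0 j)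
      (hnorm j)
  have hφ : Summable φ := Summable.of_norm_bounded (hb 0) fun j =>
    BoundedContinuousFunction.norm_ofNormedAddCommGroup_le _
      ((norm_nonneg _).trans (hnorm j 0)) (hnorm j)
  have hφL : ∀ j, BoundedContinuousFunction.toLp 2 (volume.restrict cell) ℝ (φ j) = toL2 (v j) := by
    intro j
    apply Lp.ext
    refine (BoundedContinuousFunction.coeFn_toLp 2 (volume.restrict cell) ℝ (φ j)).trans ?_
    exact (memLp_cell (trigPoly_continuous (v j).2.1) 2).coeFn_toLp.symm
  have hsum : HasSum (fun j => toL2 (v j))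
      (BoundedContinuousFunction.toLp 2 (volume.restrict cell) ℝ (∑' j, φ j)) := by
    have := hφ.hasSum.mapL (BoundedContinuousFunction.toLp 2 (volume.restrict cell) ℝ)
    simpa only [hφL] using this
  have happ : ∀ x, (∑' j, φ j) x = ∑' j, (v j).1 x := fun x =>
    (hφ.hasSum.mapL (BoundedContinuousFunction.evalCLM ℝ x)).tsum_eq.symm
  refine ⟨?_, fun x => ∑' j, (v j).1 x, ?_, ?_, ?_⟩
  -- For V, the pairs (v_j, ∇v_j) are summed in L² × L²; their sum stays in the closure of the graph
  -- of the gradient.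
  · have hg : Summable fun j => gradL2 (v j) := by
      refine Summable.of_norm_bounded ((hb 1).mul_left
        ((measureUnivNNReal (volume.restrict cell) ^ (2 : ENNReal).toReal⁻¹ : NNReal) : ℝ)) fun j => ?_
      refine Lp.norm_le_of_ae_bound ((norm_nonneg _).trans (hder 1 j 0)) ?_
      filter_upwards [(memLp_cell (trigPoly_fderiv_continuous (v j).2.1) 2).coeFn_toLp] with x hx
      change ‖(memLp_cell (trigPoly_fderiv_continuous (v j).2.1) 2).toLp _ x‖ ≤ _
      rw [hx]
      have := hder 1 j x
      rwa [norm_iteratedFDeriv_one] at this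
    have hpair := hsum.summable.hasSum.prodMk hg.hasSum
    refine ⟨(∑' j, toL2 (v j), ∑' j, gradL2 (v j)), ?_, rfl⟩
    rw [HasSum, SummationFilter.unconditional_filter] at hpair
    exact (Submodule.isClosed_topologicalClosure _).mem_of_tendsto hpair
      (Filter.Eventually.of_forall fun s => Submodule.sum_mem _ fun j _ =>
        Submodule.le_topologicalClosure _ ⟨v j, rfl⟩)
  · exact contDiff_tsum (fun j => trigPoly_contDiff (v j).2.1) (fun m _ => hb m)
      fun m j x _ => hder m j x
  · intro x i
    exact tsum_congr fun j => trigPoly_periodic (v j).2.1 x i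
  · rw [hsum.tsum_eq]
    refine (BoundedContinuousFunction.coeFn_toLp 2 (volume.restrict cell) ℝ _).trans ?_
    exact Filter.Eventually.of_forall happ

/-! ### Convergence in `E^∞` -/

/-- For arguments in E^∞ the weights of R_k ξ are summable at every exponent, so `MulBound` applies
with each r = m. -/
theorem tsum_multilinear_mem_eInf {d : ℕ} {G : ℕ → MultilinearMap ℝ (fun _ : Fin d => SA) VV}
    (hG : MulBound d G) (x : Fin d → EInf) :
    ∑' j, toL2 (G j fun i => comps (x i).val) ∈ eInf := by
  refine tsum_mem_eInf fun m => ?_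
  obtain ⟨C, hC0, hC⟩ := hG m (Nat.cast_nonneg m)
  have hvol := vol_pos
  set A : Fin d → ℕ → ℝ := fun i k => 54 * (vol⁻¹ * √vol) *
    ((k : ℝ) ^ (1 + ((m : ℝ) + d - 1) / 2) * ‖toL2 (R k (x i).val)‖) with hA
  have hAs : ∀ i, Summable (A i) := fun i => (eInf_summable (x i).2 _).mul_left _
  have hA0 : ∀ i k, 0 ≤ A i k := fun i k => by positivity
  obtain ⟨b, hb, hbs⟩ := hC (fun i => comps (x i).val) A
    fun i k => eig_mem_majorants (by positivity) (R k (x i).val).2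
  refine ⟨b, ?_, hb⟩
  refine summable_of_sum_range_le (c := C * ∏ i, ∑' k, A i k)
    (fun j => majorants_nonneg zero_le_two (hb j)) fun J => (hbs J).trans ?_
  gcongr with i
  exact (hAs i).sum_le_tsum _ fun k _ => hA0 i k

theorem EInf.val_injective : Function.Injective EInf.val := Subtype.val_injective

/-- `toEInf` as a linear map. -/
def toEInfL : VV →ₗ[ℝ] EInf where
  toFun := toEInf
  map_add' u v := Subtype.ext (map_add toL2 u v)
  map_smul' c u := Subtype.ext (map_smul toL2 c u)

theorem toEInfL_apply (v : VV) : toEInfL v = toEInf v := rfl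

theorem toDom_toEInf (α : ℝ) (v : VV) : EInf.toDom α (toEInf v) = toDom α v := rfl

/-- The L² sum agrees, in every D(A^α), with the continuous map from D(A^{α+3d/2}) already built.
Continuity on E^∞ and convergence in E^∞ are thus read off for each α separately. -/
theorem exists_multilinear_eInf {d : ℕ} {G : ℕ → MultilinearMap ℝ (fun _ : Fin d => SA) VV}
    (hM : MulBound d G) (hG : DomBound d G) :
    ∃ Q : ContinuousMultilinearMap ℝ (fun _ : Fin d => EInf) EInf,
      ∀ x, HasSum (fun j => toEInf (G j fun i => comps (x i).val)) (Q x) ∧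
        HasSum (fun j => toL2 (G j fun i => comps (x i).val)) (Q x).val := by
  choose! D hD using fun (α : ℝ) (hα : 0 ≤ α) => exists_multilinear_dom hG hα
  have hval : ∀ x : Fin d → EInf, HasSum (fun j => toL2 (G j fun i => comps (x i).val))
      (∑' j, toL2 (G j fun i => comps (x i).val)) := fun x =>
    ((hD 0 le_rfl) fun i => EInf.toDom _ (x i)).2.summable.hasSum
  let Q : (Fin d → EInf) → EInf := fun x => ⟨_, tsum_multilinear_mem_eInf hM x⟩
  have hQ : ∀ x, HasSum (fun j => toL2 (G j fun i => comps (x i).val)) (Q x).val := hval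
  have hQD : ∀ x α, 0 ≤ α → EInf.toDom α (Q x) = D α fun i => EInf.toDom _ (x i) := by
    intro x α hα
    apply Subtype.ext
    exact (hQ x).unique ((hD α hα) fun i => EInf.toDom _ (x i)).2
  let Qm : MultilinearMap ℝ (fun _ : Fin d => EInf) EInf :=
    { toFun := Q
      map_update_add' := by
        intro _ x i y z
        apply EInf.val_injective
        refine (hQ _).unique ?_
        rw [map_add]
        convert! (hQ (Function.update x i y)).add (hQ (Function.update x i z)) using 1
        funext j
        simp only [comps_update, map_add, comps_add, MultilinearMap.map_update_add]
      map_update_smul' := by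
        intro _ x i c y
        apply EInf.val_injective
        refine (hQ _).unique ?_
        rw [map_smul]
        convert! (hQ (Function.update x i y)).const_smul c using 1
        funext j
        simp only [comps_update, map_smul, comps_smul, MultilinearMap.map_update_smul] }
  have hcont : Continuous Q := by
    refine continuous_iff_continuousAt.2 fun x => tendsto_EInf.2 fun α hα => ?_
    simp only [hQD _ α hα]
    refine ((D α).cont.tendsto _).comp (tendsto_pi_nhds.2 fun i => ?_)
    have hi : Filter.Tendsto (fun x : Fin d → EInf => x i) (nhds x) (nhds (x i)) :=
      (continuous_apply i).tendsto x
    exact tendsto_EInf.1 hi _ (by positivity)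
  refine ⟨⟨Qm, hcont⟩, fun x => ⟨?_, hQ x⟩⟩
  change HasSum _ (Q x)
  rw [HasSum, SummationFilter.unconditional_filter, tendsto_EInf]
  intro α hα
  rw [hQD x α hα]
  have h := ((hD α hα) fun i => EInf.toDom _ (x i)).1
  rw [HasSum, SummationFilter.unconditional_filter] at h
  simpa only [map_sum, toDom_toEInf, EInf.val_toDom] using h

theorem eInf_convergence {d : ℕ} {G : ℕ → MultilinearMap ℝ (fun _ : Fin d => SA) VV}
    (hM : MulBound d G) (hG : DomBound d G) (h0 : ∀ j < d, ∀ x, G j x = 0) {m : ℕ} (hm : m ≤ d) :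
    ∃ F : EInf → EInf,
      (∀ ξ, (F ξ).val = ∑' j : Set.Ici m, toL2 (G j fun _ => comps ξ.val)) ∧
      (∀ ξ, HasSum (fun j : Set.Ici d => toEInf (G j fun _ => comps ξ.val)) (F ξ)) ∧
      IsContHomPoly d F := by
  obtain ⟨Q, hQ⟩ := exists_multilinear_eInf hM hG
  refine ⟨fun ξ => Q fun _ => ξ, fun ξ => ?_, fun ξ => ?_, Q, fun _ => rfl⟩
  · exact (hasSum_Ici hm (fun j hj => by rw [h0 j hj, map_zero]) (hQ fun _ => ξ).2).tsum_eq.symm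
  · exact hasSum_Ici le_rfl (fun j hj => by rw [h0 j hj, ← toEInfL_apply, map_zero])
      (hQ fun _ => ξ).1

end NSE

end

/-! ### The theorem -/

theorem theorem6p5 :
    (∀ α : ℝ, 1 / 2 ≤ α →
      (∀ d : ℕ, 1 ≤ d →
        ∃ F : NSE.Dom (α + 3 * d / 2) → NSE.Dom α,
          (∀ ξ, (F ξ).val = NSE.Pd d ξ.val) ∧
          (∀ ξ, HasSum (fun j : Set.Ici d => NSE.toDom α (NSE.Pjd d j ξ.val)) (F ξ)) ∧
          NSE.IsContHomPoly d F ∧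
          ∃ M : ℝ, 0 < M ∧ ∀ ξ,
            Summable (fun j : Set.Ici d => ‖NSE.toDom α (NSE.Pjd d j ξ.val)‖) ∧
            ‖F ξ‖ ≤ ∑' j : Set.Ici d, ‖NSE.toDom α (NSE.Pjd d j ξ.val)‖ ∧
            ∑' j : Set.Ici d, ‖NSE.toDom α (NSE.Pjd d j ξ.val)‖ ≤ M * ‖ξ‖ ^ d) ∧
      (∀ d : ℕ, 2 ≤ d →
        ∃ F : NSE.Dom (α + 3 * d / 2) → NSE.Dom α,
          (∀ ξ, (F ξ).val = NSE.Bd d ξ.val) ∧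
          (∀ ξ, HasSum (fun j : Set.Ici 1 => NSE.toDom α (NSE.Bjd d j ξ.val)) (F ξ)) ∧
          NSE.IsContHomPoly d F ∧
          ∃ C : ℝ, 0 < C ∧ ∀ ξ,
            Summable (fun j : Set.Ici 1 => ‖NSE.toDom α (NSE.Bjd d j ξ.val)‖) ∧
            ‖F ξ‖ ≤ ∑' j : Set.Ici 1, ‖NSE.toDom α (NSE.Bjd d j ξ.val)‖ ∧
            ∑' j : Set.Ici 1, ‖NSE.toDom α (NSE.Bjd d j ξ.val)‖ ≤ C * ‖ξ‖ ^ d)) ∧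
    (∀ d : ℕ, 1 ≤ d →
      ∃ F : NSE.EInf → NSE.EInf,
        (∀ ξ, (F ξ).val = NSE.Pd d ξ.val) ∧
        (∀ ξ, HasSum (fun j : Set.Ici d => NSE.toEInf (NSE.Pjd d j ξ.val)) (F ξ)) ∧
        NSE.IsContHomPoly d F) ∧
    (∀ d : ℕ, 2 ≤ d →
      ∃ F : NSE.EInf → NSE.EInf,
        (∀ ξ, (F ξ).val = NSE.Bd d ξ.val) ∧
        (∀ ξ, HasSum (fun j : Set.Ici d => NSE.toEInf (NSE.Bjd d j ξ.val)) (F ξ)) ∧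
        NSE.IsContHomPoly d F) := by
  refine ⟨fun α hα => ⟨fun d hd => ?_, fun d hd => ?_⟩, fun d hd => ?_, fun d hd => ?_⟩
  · simp only [NSE.Pd, NSE.Pjd_eq]
    exact NSE.dom_convergence (NSE.polP_domBound hd) (fun j hj x => NSE.polP_of_lt hj x) le_rfl
      (by linarith)
  · simp only [NSE.Bd, NSE.Bjd_eq]
    -- The sum defining B^{[d]} starts at 1 ≤ d; its terms with j < d are zero.
    exact NSE.dom_convergence (NSE.domBound_of_mulBound hd (NSE.polB_mulBound d))
      (fun j hj x => NSE.polB_of_lt hj x) (by omega) (by linarith)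
  · simp only [NSE.Pd, NSE.Pjd_eq]
    exact NSE.eInf_convergence (NSE.polP_mulBound hd) (NSE.polP_domBound hd)
      (fun j hj x => NSE.polP_of_lt hj x) le_rfl
  · simp only [NSE.Bd, NSE.Bjd_eq]
    exact NSE.eInf_convergence (NSE.polB_mulBound d)
      (NSE.domBound_of_mulBound hd (NSE.polB_mulBound d))
      (fun j hj x => NSE.polB_of_lt hj x) (by omega)
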